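/- **Setting.** Let $d\in\mathbb N$, $L>0$, $\kappa>0$, and let $U=[-\frac L2,\frac L2]^d$ be the flat torus of side length $L$. Let $D\in W^{2,\infty}(U)$ be a periodic potential, and let $(\Omega,\mathcal A,\mu)$ be a probability space. A *graphop* is a bounded linear operator $A:L^\infty(\Omega)\to L^1(\Omega)$ that is self-adjoint ($\int gAf\,d\mu=\int fAg\,d\mu$ for all $f,g\in L^\infty(\Omega)$) and positivity preserving. It is associated with a graphon $W:\Omega\times\Omega\to\mathbb R$ if $(Af)(\xi)=\int_\Omega W(\xi,\tilde\xi)f(\tilde\xi)\,d\mu(\tilde\xi)$ for all $f\in L^\infty(\Omega)$ and almost every $\xi$; then $W$ is symmetric and nonnegative almost everywhere. Write $A_W$ for this integral operator and $\|W\|_2=(\int_\Omega\int_\Omega W^2\,d\mu\,d\mu)^{1/2}$. Consider $$\partial_t\rho=\kappa\,\mathrm{div}_x\big(\rho\,V[A_W](\rho)\big)+\Delta_x\rho,\qquad \rho(0)=\rho_0,\qquad V[A_W](\rho)(t,x,\xi)=\int_U\nabla D(x-\tilde x)\,(A_W\rho)(t,\tilde x,\xi)\,d\tilde x,$$ where $A_W$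 acts on the variable $\xi$. An initial datum $\rho_0(x,\xi)$ is *admissible* if for a.e. $\xi$ the function $\rho_0(\cdot,\xi)$ is a probability density in $H^{3+d}(U)$, and $\rho_0(x,\cdot)\in L^\infty(\Omega)$ for every $x$. A *classical solution* is a function $\rho(t,x,\xi)$, measurable in $(x,\xi)$ for each $t\ge0$, such that for a.e. $\xi$ the function $\rho(\cdot,\cdot,\xi)$ is continuous on $[0,\infty)\times U$, of class $C^1$ in $t$ and $C^2$ in $x$ on $(0,\infty)\times U$, is a probability density on $U$ at each $t\ge 0$, equals $\rho_0(\cdot,\xi)$ almost everywhere at $t=0$, and satisfies the equation pointwise for $t>0$. With $\rho_\infty=L^{-d}$ let $$\hat H(\rho|\rho_\infty)=\int_\Omega\int_U\rho\log\frac{\rho}{\rho_\infty}\,dx\,d\mu(\xi).$$ For $c\ge0$, say that *entropy decay holds with constant $c$ for $W$* if the condition $$\kappa<\frac{2\pi^2}{L^2\,\|\Delta D\|_{L^\infty(U)}\,c}$$ (no condition if the denominator vanishes) implies that $\hat\alpha:=\frac{4\pi^2}{L^2}-2\kappa\|\Delta D\|_{L^\infty(U)}\,c>0$ and that, for every admissible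 $\rho_0$ with $\hat H(\rho_0|\rho_\infty)<\infty$, every classical solution $\rho$ with initial datum $\rho_0$ satisfies, with a finite left-hand side, $$\hat H(\rho(t)|\rho_\infty)\le e^{-\hat\alpha t}\,\hat H(\rho_0|\rho_\infty),\qquad t\ge0.$$ **Corollary 3.4.** 1. Let $A_W$ be a graphop associated with a graphon $W$ with $\|W\|_2<\infty$. Then $A_W$, as an operator on $L^2(\Omega)$, has a largest eigenvalue $\lambda_{\max}$, and $\lambda_{\max}\le\|W\|_2$. Entropy decay holds for $W$ with constant $c=\lambda_{\max}$. It also holds with constant $c=\|W\|_2$. 2. (Erdős–Rényi.) If $W\equiv p$ with $p\in(0,1)$, then $\lambda_{\max}=p$ and entropy decay holds for $W$ with constant $c=p$. 3. (Power law.) Let $\Omega=[0,1]$ with Lebesgue measure and $W_\alpha(\xi,\tilde\xi)=(1-\alpha)^2(\xi\tilde\xi)^{-\alpha}$ with $\alpha\in(0,\frac12)$. Then $\|W_\alpha\|_2=\frac{(1-\alpha)^2}{1-2\alpha}<\infty$ and entropy decay holds for $W_\alpha$ with constant $c=\frac{(1-\alpha)^2}{1-2\alpha}$. -/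

import Mathlib

open MeasureTheory Set
open scoped ENNReal ContDiff

noncomputable section

namespace GraphopMcKeanVlasov

/-! ### The flat torus of side length `L`

Functions on the torus are `L`-periodic functions on `ℝ^d`; integrals over the torus are integrals
over the fundamental cell `[-L/2, L/2]^d`. -/

/-- `ℝ^d` with its Euclidean structure. -/
abbrev E (d : ℕ) : Type := EuclideanSpace ℝ (Fin d)

/-- The cell `U = [-L/2, L/2]^d`. -/
def cell (d : ℕ) (L : ℝ) : Set (E d) := {x | ∀ i, x i ∈ Icc (-L / 2) (L / 2)}

/-- `L`-periodicity in every coordinate direction. -/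
def IsPeriodic {d : ℕ} (L : ℝ) (f : E d → ℝ) : Prop :=
  ∀ (x : E d) (i : Fin d), f (x + EuclideanSpace.single i L) = f x

/-- The classical partial derivative `∂_i f (x)`. -/
def partialD {d : ℕ} (i : Fin d) (f : E d → ℝ) (x : E d) : ℝ :=
  fderiv ℝ f x (EuclideanSpace.single i 1)

/-- The classical Laplacian. -/
def lap {d : ℕ} (f : E d → ℝ) (x : E d) : ℝ := ∑ i, partialD i (partialD i f) x

/-- The classical divergence of the vector field with components `F i`. -/
def divergence {d : ℕ} (F : Fin d → E d → ℝ) (x : E d) : ℝ := ∑ i, partialD i (F i) x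

/-- `g` is the weak `i`-th partial derivative of `f`. (For periodic `f`, testing with functions in
`C_c^∞(ℝ^d)` is the same as testing with smooth functions on the torus.) -/
structure IsWeakPartial {d : ℕ} (i : Fin d) (f g : E d → ℝ) : Prop where
  locallyIntegrable_left : LocallyIntegrable f
  locallyIntegrable_right : LocallyIntegrable g
  integral_eq : ∀ φ : E d → ℝ, ContDiff ℝ ∞ φ → HasCompactSupport φ →
    ∫ x, f x * partialD i φ x = -∫ x, g x * φ x

/-- The Sobolev space `H^k(U) = W^{k,2}(U)` (for periodic functions): all weak derivatives up to
order `k` exist and are square integrable on `U`. -/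
def MemSobolev {d : ℕ} (L : ℝ) : ℕ → (E d → ℝ) → Prop
  | 0, f => MemLp f 2 (volume.restrict (cell d L))
  | k + 1, f => MemLp f 2 (volume.restrict (cell d L)) ∧
      ∀ i, ∃ g, IsWeakPartial i f g ∧ MemSobolev L k g

/-- `f` is the density of an absolutely continuous probability measure on `U`. -/
structure IsProbDensity {d : ℕ} (L : ℝ) (f : E d → ℝ) : Prop where
  nonneg : ∀ᵐ x, 0 ≤ f x
  integrableOn : IntegrableOn f (cell d L)
  integral_eq_one : ∫ x in cell d L, f x = 1

/-- A periodic interaction potential `D ∈ W^{2,∞}(U)`, together with (representatives of) its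
weak first and second derivatives, which are unique up to null sets. -/
structure Potential (d : ℕ) (L : ℝ) where
  toFun : E d → ℝ
  /-- the weak partial derivatives `∂_i D` -/
  grad : Fin d → E d → ℝ
  /-- the weak second partial derivatives `∂_j ∂_i D` -/
  hess : Fin d → Fin d → E d → ℝ
  periodic : IsPeriodic L toFun
  memLp_toFun : MemLp toFun ∞ volume
  memLp_grad : ∀ i, MemLp (grad i) ∞ volume
  memLp_hess : ∀ i j, MemLp (hess i j) ∞ volume
  isWeakPartial_grad : ∀ i, IsWeakPartial i toFun (grad i)
  isWeakPartial_hess : ∀ i j, IsWeakPartial j (grad i) (hess i j)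

/-- `‖Δ D‖_{L^∞(U)}`, an essential supremum. -/
def Potential.lapNorm {d : ℕ} {L : ℝ} (D : Potential d L) : ℝ :=
  (eLpNorm (fun x => ∑ i, D.hess i i x) ∞ (volume.restrict (cell d L))).toReal

section Network

variable {Ω : Type*} [MeasurableSpace Ω]

/-! ### Graphops and graphons -/

/-- A bounded operator `L^∞(Ω) → L^1(Ω)` is a graphop if it is self-adjoint and positivity
preserving. -/
structure IsGraphop {μ : Measure Ω} (A : Lp ℝ ∞ μ →L[ℝ] Lp ℝ 1 μ) : Prop where
  selfAdjoint : ∀ f g : Lp ℝ ∞ μ, ∫ ξ, g ξ * (A f) ξ ∂μ = ∫ ξ, f ξ * (A g) ξ ∂μ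
  posPreserving : ∀ f : Lp ℝ ∞ μ, 0 ≤ f → 0 ≤ A f

/-- The integral operator `(A_W f)(ξ) = ∫ W(ξ, ξ') f(ξ') dμ(ξ')`. -/
def kernelOp (μ : Measure Ω) (W : Ω → Ω → ℝ) (f : Ω → ℝ) (ξ : Ω) : ℝ :=
  ∫ ξ', W ξ ξ' * f ξ' ∂μ

/-- The operator `A` is associated with the graphon kernel `W`. -/
def HasGraphon {μ : Measure Ω} (A : Lp ℝ ∞ μ →L[ℝ] Lp ℝ 1 μ) (W : Ω → Ω → ℝ) : Prop :=
  ∀ f : Lp ℝ ∞ μ, A f =ᵐ[μ] kernelOp μ W f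

/-- The graphon norm `‖W‖_p = (∫∫ |W|^p dμ dμ)^{1/p}`. -/
def graphonNorm (μ : Measure Ω) (W : Ω → Ω → ℝ) (p : ℝ≥0∞) : ℝ :=
  (eLpNorm (Function.uncurry W) p (μ.prod μ)).toReal

/-- The set of eigenvalues of `A_W` as an operator on the real Hilbert space `L²(Ω, μ)`. -/
def eigenvalues (μ : Measure Ω) (W : Ω → Ω → ℝ) : Set ℝ :=
  {lam | ∃ f : Ω → ℝ, MemLp f 2 μ ∧ ¬ f =ᵐ[μ] 0 ∧ kernelOp μ W f =ᵐ[μ] fun ξ => lam * f ξ}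

/-- `λ_max`, the largest eigenvalue of `A_W` on `L²(Ω, μ)`. -/
def lambdaMax (μ : Measure Ω) (W : Ω → Ω → ℝ) : ℝ := sSup (eigenvalues μ W)

/-! ### Relative entropy -/

/-- The integrand `ρ log (ρ / ρ_∞)` with `ρ_∞ = 1 / L^d`. -/
def entropyIntegrand {d : ℕ} (L : ℝ) (r : E d → Ω → ℝ) (x : E d) (ξ : Ω) : ℝ :=
  r x ξ * Real.log (r x ξ / (1 / L ^ d))

/-- The relative entropy `Ĥ(r | ρ_∞) = ∫_Ω ∫_U r log (r / ρ_∞) dx dμ(ξ)`. -/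
def entropy {d : ℕ} (L : ℝ) (μ : Measure Ω) (r : E d → Ω → ℝ) : ℝ :=
  ∫ ξ, (∫ x in cell d L, entropyIntegrand L r x ξ) ∂μ

/-- `Ĥ(r | ρ_∞) < ∞`. The integrand is bounded below and `U × Ω` has finite measure, so finiteness
of the integral is integrability. -/
def FiniteEntropy {d : ℕ} (L : ℝ) (μ : Measure Ω) (r : E d → Ω → ℝ) : Prop :=
  Integrable (fun p : E d × Ω => entropyIntegrand L r p.1 p.2)
    ((volume.restrict (cell d L)).prod μ)

/-! ### The equation -/

/-- Admissible initial data: for almost every `ξ`, `ρ₀(·, ξ)` is a probability density in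
`H^{3+d}(U)`, and `ρ₀(x, ·) ∈ L^∞(Ω)` for every `x`. -/
structure IsAdmissible {d : ℕ} (L : ℝ) (μ : Measure Ω) (ρ₀ : E d → Ω → ℝ) : Prop where
  aestronglyMeasurable :
    AEStronglyMeasurable (fun p : E d × Ω => ρ₀ p.1 p.2) (volume.prod μ)
  periodic : ∀ᵐ ξ ∂μ, IsPeriodic L (fun x => ρ₀ x ξ)
  isProbDensity : ∀ᵐ ξ ∂μ, IsProbDensity L (fun x => ρ₀ x ξ)
  memSobolev : ∀ᵐ ξ ∂μ, MemSobolev L (3 + d) (fun x => ρ₀ x ξ)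
  memLp_network : ∀ x, MemLp (fun ξ => ρ₀ x ξ) ∞ μ

/-- The `i`-th component of the interaction term
`V[A_W](r)(x, ξ) = ∫_U ∇D(x - y) (A_W r)(y, ξ) dy`. -/
def interaction {d : ℕ} {L : ℝ} (D : Potential d L) (μ : Measure Ω) (W : Ω → Ω → ℝ)
    (r : E d → Ω → ℝ) (ξ : Ω) (i : Fin d) (x : E d) : ℝ :=
  ∫ y in cell d L, D.grad i (x - y) * kernelOp μ W (r y) ξ

/-- Regularity of a classical solution on the torus: `u` is periodic in space, continuous on
`[0, ∞) × U`, and of class `C^1` in time and `C^2` in space on `(0, ∞) × U`. -/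
structure IsC12 {d : ℕ} (L : ℝ) (u : ℝ → E d → ℝ) : Prop where
  periodic : ∀ t, 0 ≤ t → IsPeriodic L (u t)
  continuousOn : ContinuousOn (fun p : ℝ × E d => u p.1 p.2) (Ici 0 ×ˢ univ)
  differentiableAt_time : ∀ t, 0 < t → ∀ x, DifferentiableAt ℝ (fun s => u s x) t
  continuousOn_time :
    ContinuousOn (fun p : ℝ × E d => deriv (fun s => u s p.2) p.1) (Ioi 0 ×ˢ univ)
  contDiff_space : ∀ t, 0 < t → ContDiff ℝ 2 (u t)
  continuousOn_space : ∀ i,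
    ContinuousOn (fun p : ℝ × E d => partialD i (u p.1) p.2) (Ioi 0 ×ˢ univ)
  continuousOn_space₂ : ∀ i j,
    ContinuousOn (fun p : ℝ × E d => partialD j (partialD i (u p.1)) p.2) (Ioi 0 ×ˢ univ)

/-- `ρ(t, x, ξ)` is a classical solution of
`∂_t ρ = κ div_x (ρ V[A_W](ρ)) + Δ_x ρ`, `ρ(0) = ρ₀`, with values in the probability densities:
for almost every `ξ`, `ρ(·, ·, ξ)` solves the equation pointwise. -/
structure IsClassicalSolution {d : ℕ} {L : ℝ} (D : Potential d L) (κ : ℝ) (μ : Measure Ω)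
    (W : Ω → Ω → ℝ) (ρ₀ : E d → Ω → ℝ) (ρ : ℝ → E d → Ω → ℝ) : Prop where
  aestronglyMeasurable : ∀ t, 0 ≤ t →
    AEStronglyMeasurable (fun p : E d × Ω => ρ t p.1 p.2) (volume.prod μ)
  isProbDensity : ∀ᵐ ξ ∂μ, ∀ t, 0 ≤ t → IsProbDensity L (fun x => ρ t x ξ)
  initial : ∀ᵐ ξ ∂μ, ∀ᵐ x, ρ 0 x ξ = ρ₀ x ξ
  regular : ∀ᵐ ξ ∂μ, IsC12 L (fun t x => ρ t x ξ)
  differentiable_flux : ∀ᵐ ξ ∂μ, ∀ t, 0 < t → ∀ i,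
    Differentiable ℝ (fun y => ρ t y ξ * interaction D μ W (ρ t) ξ i y)
  equation : ∀ᵐ ξ ∂μ, ∀ t, 0 < t → ∀ x,
    deriv (fun s => ρ s x ξ) t =
      κ * divergence (fun i y => ρ t y ξ * interaction D μ W (ρ t) ξ i y) x
        + lap (fun y => ρ t y ξ) x

/-- The rate `4π²/L² - 2 κ ‖ΔD‖_∞ c`. -/
def decayRate {d : ℕ} {L : ℝ} (D : Potential d L) (κ c : ℝ) : ℝ :=
  4 * Real.pi ^ 2 / L ^ 2 - 2 * κ * D.lapNorm * c

/-- Exponential entropy decay governed by the constant `c` (in place of the numerical radius):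
if `κ < 2π² / (L² ‖ΔD‖_∞ c)`, where the right-hand side is read as `+∞` when the denominator
vanishes, then the rate is positive and every classical solution with admissible initial datum of
finite entropy has finite entropy at all times, which decays exponentially with this rate. -/
def EntropyDecay {d : ℕ} {L : ℝ} (D : Potential d L) (κ : ℝ) (μ : Measure Ω)
    (W : Ω → Ω → ℝ) (c : ℝ) : Prop :=
  κ * (L ^ 2 * D.lapNorm * c) < 2 * Real.pi ^ 2 →
    0 < decayRate D κ c ∧
    ∀ (ρ₀ : E d → Ω → ℝ) (ρ : ℝ → E d → Ω → ℝ),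
      IsAdmissible L μ ρ₀ → FiniteEntropy L μ ρ₀ → IsClassicalSolution D κ μ W ρ₀ ρ →
      ∀ t, 0 ≤ t → FiniteEntropy L μ (ρ t) ∧
        entropy L μ (ρ t) ≤ Real.exp (-(decayRate D κ c) * t) * entropy L μ ρ₀

end Network

/-- The power law graphon `W_α(ξ, ξ') = (1 - α)² (ξ ξ')^{-α}` on `[0, 1]`. -/
def powerLaw (α : ℝ) (ξ ξ' : unitInterval) : ℝ :=
  (1 - α) ^ 2 * ((ξ : ℝ) * (ξ' : ℝ)) ^ (-α)

end GraphopMcKeanVlasov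

end

/-! Fix a node ξ, let h(ξ) be the entropy of ρ(·, ξ) relative to ρ_∞ and n(ξ) its L¹ distance to
ρ_∞. Along the equation h loses the Fisher information and gains an interaction term. A logarithmic
Sobolev inequality on the torus (`logSobolev_cell`) bounds the loss below by (4π²/L²) h. In the
gain, integration by parts puts both derivatives on D; as ΔD has mean zero, constants may be
subtracted from both densities, and the gain is at most κ‖ΔD‖_∞ n(ξ) (|W| n)(ξ)
(`Potential.abs_sum_integral_drift_le`, `entropy_production_le`). Integrating over the network
produces the quadratic form of |W| at n, at most c ∫ n². Pinsker's inequality n² ≤ 2h and Grönwall's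
inequality then give the rate 4π²/L² − 2κ‖ΔD‖_∞ c.

The logarithmic Sobolev constant used is twice the optimal one. This slack permits an elementary
proof on the circle from Wirtinger's inequality and a sup bound, and subadditivity of entropy
carries the inequality to every dimension with the same constant.

A density may vanish, and the solution is not regular in time uniformly in ξ. The entropy is
therefore regularized by ε, its differential inequality is integrated in time at each node, ε tends
to 0, and only the integrated inequality is averaged over ξ (`relEntropy_le_of_equation`,
`integral_le_exp_mul_of_coupling`).

It remains to find c. Testing a graphop on indicators shows that its kernel is nonnegative and
symmetric a.e. On L² the operator is Hilbert–Schmidt, hence compact, and self-adjoint; positivity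
makes its norm an eigenvalue, so λ_max is the operator norm, which is at most ‖W‖₂. Every c above
the operator norm is admissible (`entropyDecay_of_opNorm_le`). -/

namespace GraphopMcKeanVlasov

open Filter Topology

/-! ### The logarithmic Sobolev inequality on the circle -/

/-- Parseval for f and f′: integration by parts relates their n-th Fourier coefficients by the
factor 2πin/(b − a), the boundary term vanishing by `hends`, and `hzero` kills the zero mode of f.
-/
theorem wirtinger_of_average_eq_zero {a b : ℝ} (hab : a < b) {f f' : ℝ → ℝ}
    (hf : ∀ x, HasDerivAt f (f' x) x) (hf' : Continuous f') (hends : f b = f a)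
    (hzero : ∫ x in a..b, f x = 0) :
    ∫ x in a..b, f x ^ 2 ≤ ((b - a) / (2 * Real.pi)) ^ 2 * ∫ x in a..b, f' x ^ 2 := by
  have hcf : Continuous f := continuous_iff_continuousAt.2 fun x => (hf x).continuousAt
  have hC : ∀ x, HasDerivAt (fun x => (f x : ℂ)) (f' x : ℂ) x := fun x => (hf x).ofReal_comp
  have memL : ∀ {g : ℝ → ℝ}, Continuous g →
      MemLp (fun x => (g x : ℂ)) 2 (volume.restrict (Ioc a b)) := fun {g} hg => by
    have hg' : Continuous (fun x => (g x : ℂ)) := by fun_prop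
    obtain ⟨C, hC⟩ := isCompact_Icc.exists_bound_of_continuousOn (s := Icc a b) hg'.continuousOn
    refine MemLp.of_bound hg'.aestronglyMeasurable C ?_
    filter_upwards [ae_restrict_mem measurableSet_Ioc] with x hx
    exact hC x (Ioc_subset_Icc_self hx)
  have h1 := hasSum_sq_fourierCoeffOn hab (memL hcf)
  have h2 := hasSum_sq_fourierCoeffOn hab (memL hf')
  have hL : 0 < b - a := sub_pos.2 hab
  have hle : ∀ n : ℤ, ‖fourierCoeffOn hab (fun x => (f x : ℂ)) n‖ ^ 2 ≤
      ((b - a) / (2 * Real.pi)) ^ 2 * ‖fourierCoeffOn hab (fun x => (f' x : ℂ)) n‖ ^ 2 := by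
    intro n
    rcases eq_or_ne n 0 with rfl | hn
    · have : fourierCoeffOn hab (fun x => (f x : ℂ)) 0 = 0 := by
        rw [fourierCoeffOn_eq_integral]
        simp [hzero, intervalIntegral.integral_ofReal]
      rw [this]; simp; positivity
    · rw [fourierCoeffOn_of_hasDerivAt hab hn (fun x _ => hC x)
        ((by fun_prop : Continuous fun x => (f' x : ℂ)).intervalIntegrable _ _)]
      rw [hends, sub_self, mul_zero, zero_sub, norm_mul, norm_neg, norm_mul]
      have e1 : ‖(1 : ℂ) / (-2 * Real.pi * Complex.I * n)‖ = 1 / (2 * Real.pi * |(n : ℝ)|) := by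
        simp [abs_of_pos Real.pi_pos]
      have e2 : ‖((b : ℂ) - a)‖ = b - a := by
        rw [← Complex.ofReal_sub, Complex.norm_real, Real.norm_of_nonneg hL.le]
      rw [e1, e2, ← mul_assoc, mul_pow]
      gcongr
      rw [div_mul_eq_mul_div, one_mul]
      have : (1 : ℝ) ≤ |(n : ℝ)| := by exact_mod_cast Int.one_le_abs hn
      exact div_le_div_of_nonneg_left hL.le (by positivity)
        (le_mul_of_one_le_right (by positivity) this)
  have h3 := hasSum_le hle h1 (h2.mul_left _)
  simp only [Complex.norm_real, Real.norm_eq_abs, sq_abs, smul_eq_mul] at h3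
  have h4 := mul_le_mul_of_nonneg_left h3 hL.le
  rw [mul_inv_cancel_left₀ hL.ne'] at h4
  refine h4.trans_eq ?_
  field_simp

/-- Over the period starting at x, integrating the sawtooth y − x − L/2 against g′ gives L times the
deviation of g x from its mean. Cauchy–Schwarz finishes, the sawtooth having squared norm L³/12. -/
theorem sq_sub_average_le {L : ℝ} (hL : 0 < L) {g g' : ℝ → ℝ} (hg : ∀ x, HasDerivAt g (g' x) x)
    (hg' : Continuous g') (hper : Function.Periodic g L) (a x : ℝ) :
    (g x - L⁻¹ * ∫ y in a..a + L, g y) ^ 2 ≤ L / 12 * ∫ y in a..a + L, g' y ^ 2 := by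
  have hcg : Continuous g := continuous_iff_continuousAt.2 fun x => (hg x).continuousAt
  have hper' : Function.Periodic g' L := fun y => by
    have h1 : HasDerivAt (fun z => g (z + L)) (g' (y + L)) y := (hg (y + L)).comp_add_const y L
    have h2 : (fun z => g (z + L)) = g := funext hper
    rw [h2] at h1
    exact h1.unique (hg y)
  have hper2 : Function.Periodic (fun y => g' y ^ 2) L := fun y => by simp [hper' y]
  rw [hper.intervalIntegral_add_eq a x, hper2.intervalIntegral_add_eq a x]
  set A := ∫ y in x..x + L, g y
  set B := ∫ y in x..x + L, g' y ^ 2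
  set D := ∫ y in x..x + L, (y - x - L / 2) * g' y with hD
  have hDval : D = L * g x - A := by
    rw [hD, intervalIntegral.integral_mul_deriv_eq_deriv_mul (u := fun y => y - x - L / 2)
      (u' := fun _ => 1) (fun y _ => ((hasDerivAt_id y).sub_const x).sub_const (L / 2))
      (fun y _ => hg y) (by simp) (hg'.intervalIntegrable _ _)]
    simp only [one_mul, hper x]
    ring
  have hk : ∫ y in x..x + L, (y - x - L / 2) ^ 2 = L ^ 3 / 12 := by
    have : ∀ y, HasDerivAt (fun y => (y - x - L / 2) ^ 3 / 3) ((y - x - L / 2) ^ 2) y := fun y => by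
      have := ((((hasDerivAt_id y).sub_const x).sub_const (L / 2)).pow 3).div_const 3
      refine HasDerivAt.congr_deriv this ?_
      simp
    rw [intervalIntegral.integral_eq_sub_of_hasDerivAt (fun y _ => this y)
      ((by fun_prop : Continuous fun y => (y - x - L / 2) ^ 2).intervalIntegrable _ _)]
    ring
  -- Cauchy–Schwarz by completing the square; 12 D/L³ is the coefficient of the projection of g′ on
  -- the sawtooth.
  have hpos : 0 ≤ ∫ y in x..x + L, (12 / L ^ 3 * D * (y - x - L / 2) - g' y) ^ 2 :=
    intervalIntegral.integral_nonneg (by linarith) fun y _ => sq_nonneg _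
  have hexp : ∫ y in x..x + L, (12 / L ^ 3 * D * (y - x - L / 2) - g' y) ^ 2 =
      (12 / L ^ 3 * D) ^ 2 * (L ^ 3 / 12) - 2 * (12 / L ^ 3 * D) * D + B := by
    generalize 12 / L ^ 3 * D = E
    rw [← hk, hD, ← intervalIntegral.integral_const_mul, ← intervalIntegral.integral_const_mul,
      ← intervalIntegral.integral_sub, ← intervalIntegral.integral_add]
    · refine intervalIntegral.integral_congr fun y _ => ?_
      ring
    all_goals exact Continuous.intervalIntegrable (by fun_prop) _ _
  rw [hexp] at hpos
  have h5 : D ^ 2 ≤ L ^ 3 / 12 * B := by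
    have h6 : (12 / L ^ 3 * D) ^ 2 * (L ^ 3 / 12) - 2 * (12 / L ^ 3 * D) * D + B
        = B - 12 / L ^ 3 * D ^ 2 := by
      field_simp
      ring
    rw [h6] at hpos
    have h7 := mul_le_mul_of_nonneg_left (sub_nonneg.1 hpos) (by positivity : 0 ≤ L ^ 3 / 12)
    refine le_trans (le_of_eq ?_) h7
    field_simp
  have h8 : (g x - L⁻¹ * A) ^ 2 = D ^ 2 / L ^ 2 := by
    rw [hDval]
    field_simp
  rw [h8, div_le_iff₀ (by positivity)]
  refine h5.trans_eq ?_
  ring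

/-- The derivative has the sign of s − 1, so F attains its minimum over (0, ∞) at 1. -/
theorem nonneg_of_hasDerivAt_cube_mul {F q : ℝ → ℝ} (hF1 : F 1 = 0) (hq : ∀ s, 0 < s → 0 ≤ q s)
    (hF : ∀ s, 0 < s → HasDerivAt F ((s - 1) ^ 3 * q s) s) {s : ℝ} (hs : 0 < s) : 0 ≤ F s := by
  have hc : ContinuousOn F (Ioi 0) := fun x hx => (hF x hx).continuousAt.continuousWithinAt
  rw [← hF1]
  rcases le_total s 1 with h | h
  · refine antitoneOn_of_deriv_nonpos (convex_Icc s 1) (hc.mono fun x hx => hs.trans_le hx.1)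
      (fun x hx => ?_) (fun x hx => ?_) ⟨le_rfl, h⟩ ⟨h, le_rfl⟩ h <;>
      rw [interior_Icc] at hx <;> have hx0 := hs.trans hx.1
    · exact (hF x hx0).differentiableAt.differentiableWithinAt
    · rw [(hF x hx0).deriv]
      exact mul_nonpos_of_nonpos_of_nonneg
        ((Odd.pow_nonpos_iff (by decide)).2 (by linarith [hx.2])) (hq x hx0)
  · refine monotoneOn_of_deriv_nonneg (convex_Icc 1 s) (hc.mono fun x hx => one_pos.trans_le hx.1)
      (fun x hx => ?_) (fun x hx => ?_) ⟨le_rfl, h⟩ ⟨h, le_rfl⟩ h <;>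
      rw [interior_Icc] at hx <;> have hx0 := one_pos.trans hx.1
    · exact (hF x hx0).differentiableAt.differentiableWithinAt
    · rw [(hF x hx0).deriv]
      have : 0 ≤ x - 1 := by linarith [hx.1]
      have := hq x hx0
      positivity

/-- The right side agrees with log to third order at 1: the difference has derivative (s −
1)³/(3s³). -/
theorem log_le_of_pos {s : ℝ} (hs : 0 < s) :
    Real.log s ≤ s / 3 + 1 / 2 - s⁻¹ + (s ^ 2)⁻¹ / 6 := by
  let F : ℝ → ℝ := fun s => s / 3 + 1 / 2 - s⁻¹ + (s ^ 2)⁻¹ / 6 - Real.log s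
  have hF : ∀ s, 0 < s → HasDerivAt F ((s - 1) ^ 3 * (3 * s ^ 3)⁻¹) s := fun s hs => by
    have h1 := ((hasDerivAt_id s).div_const 3).add_const (1 / 2)
    have h2 := (((hasDerivAt_id s).pow 2).inv (by simpa using hs.ne')).div_const 6
    have := ((h1.sub (hasDerivAt_inv hs.ne')).add h2).sub (Real.hasDerivAt_log hs.ne')
    refine HasDerivAt.congr_deriv this ?_
    simp
    field_simp
    ring
  have := nonneg_of_hasDerivAt_cube_mul (by simp [F]; norm_num)
    (fun s hs => by positivity) hF hs
  simpa [F] using this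

/-- This is `log_le_of_pos` at s/a, multiplied by 2s². The coefficient 2 of the quadratic term is
half of what the logarithmic Sobolev inequality can afford, which leaves room for the cubic term. -/
theorem sq_mul_log_div_le {s a : ℝ} (hs : 0 < s) (ha : 0 < a) :
    s ^ 2 * Real.log (s ^ 2 / a ^ 2) - s ^ 2 + a ^ 2 ≤
      2 * (s - a) ^ 2 + 2 / (3 * a) * (s - a) ^ 3 := by
  have h := mul_le_mul_of_nonneg_left (log_le_of_pos (div_pos hs ha))
    (by positivity : 0 ≤ 2 * s ^ 2)
  rw [← div_pow, Real.log_pow]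
  push_cast
  have : 2 * s ^ 2 * (s / a / 3 + 1 / 2 - (s / a)⁻¹ + ((s / a) ^ 2)⁻¹ / 6) =
    2 * (s - a) ^ 2 + 2 / (3 * a) * (s - a) ^ 3 + s ^ 2 - a ^ 2 := by
    field_simp
    ring
  linarith

/-- The numerical end of the large-energy case below: 1.83² exceeds 10/3, 2.7 is below e, and 7/10
is below 1/√2. -/
theorem quadratic_bound {z : ℝ} (hz : 7 / 10 ≤ z) : (1 + 1.83 * z) / 2.7 ≤ 2 * z ^ 2 := by
  rw [div_le_iff₀ (by norm_num)]
  nlinarith [mul_nonneg (sub_nonneg.2 hz) (sub_nonneg.2 hz)]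

/-- The logarithmic Sobolev inequality on the circle of length `L`, with twice the optimal
constant. -/
theorem logSobolev_circle {L : ℝ} (hL : 0 < L) {f f' : ℝ → ℝ} (hf : ∀ x, HasDerivAt f (f' x) x)
    (hf' : Continuous f') (hper : Function.Periodic f L) (hpos : ∀ x, 0 < f x) (a : ℝ) :
    (∫ x in a..a + L, f x * Real.log (f x)) -
        (∫ x in a..a + L, f x) * Real.log (L⁻¹ * ∫ x in a..a + L, f x) ≤
      L ^ 2 / (4 * Real.pi ^ 2) * ∫ x in a..a + L, f' x ^ 2 / f x := by
  set g : ℝ → ℝ := fun x => √(f x) with hgdef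
  set g' : ℝ → ℝ := fun x => f' x / (2 * √(f x)) with hg'def
  have hcf : Continuous f := continuous_iff_continuousAt.2 fun x => (hf x).continuousAt
  have hg : ∀ x, HasDerivAt g (g' x) x := fun x => (hf x).sqrt (hpos x).ne'
  have hgpos : ∀ x, 0 < g x := fun x => Real.sqrt_pos.2 (hpos x)
  have hgc : Continuous g := hcf.sqrt
  have hg'c : Continuous g' := hf'.div (by fun_prop) fun x => (mul_pos two_pos (hgpos x)).ne'
  have hgper : Function.Periodic g L := fun x => by simp [g, hper x]
  have hgsq : ∀ x, g x ^ 2 = f x := fun x => Real.sq_sqrt (hpos x).le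
  have hg'sq : ∀ x, 4 * g' x ^ 2 = f' x ^ 2 / f x := fun x => by
    simp only [g']
    rw [div_pow, mul_pow, Real.sq_sqrt (hpos x).le]
    field_simp [(hpos x).ne']
    ring
  set I := ∫ x in a..a + L, g' x ^ 2 with hI
  set m := L⁻¹ * ∫ x in a..a + L, g x with hm
  set S := L⁻¹ * ∫ x in a..a + L, f x with hS
  have haL : a < a + L := by linarith
  have ii : ∀ {h : ℝ → ℝ}, Continuous h → IntervalIntegrable h volume a (a + L) :=
    fun hh => hh.intervalIntegrable _ _
  have hI0 : 0 ≤ I := intervalIntegral.integral_nonneg haL.le fun _ _ => sq_nonneg _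
  have hmpos : 0 < m := mul_pos (inv_pos.2 hL)
    (intervalIntegral.intervalIntegral_pos_of_pos_on (ii hgc) (fun x _ => hgpos x) haL)
  have hSpos : 0 < S := mul_pos (inv_pos.2 hL)
    (intervalIntegral.intervalIntegral_pos_of_pos_on (ii hcf) (fun x _ => hpos x) haL)
  have hintf : ∫ x in a..a + L, f x = L * S := by rw [hS, mul_inv_cancel_left₀ hL.ne']
  have hintg : ∫ x in a..a + L, g x = L * m := by rw [hm, mul_inv_cancel_left₀ hL.ne']
  have hflog : Continuous fun x => Real.log (f x) := hcf.log fun x => (hpos x).ne'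
  set v := ∫ x in a..a + L, (g x - m) ^ 2 with hv
  have hvS : v = L * S - L * m ^ 2 := by
    have : ∀ x, (g x - m) ^ 2 = f x - 2 * m * g x + m ^ 2 := fun x => by rw [← hgsq]; ring
    simp only [hv, this]
    rw [intervalIntegral.integral_add (ii (by fun_prop)) (ii (by fun_prop)),
      intervalIntegral.integral_sub (ii (by fun_prop)) (ii (by fun_prop)),
      intervalIntegral.integral_const_mul, hintf, hintg]
    simp
    ring
  have hv0 : 0 ≤ v := intervalIntegral.integral_nonneg haL.le fun _ _ => sq_nonneg _
  have hvI : v ≤ (L / (2 * Real.pi)) ^ 2 * I := by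
    have := wirtinger_of_average_eq_zero haL (f := fun x => g x - m) (fun x => (hg x).sub_const m)
      hg'c (by simp [hgper a]) (by
        rw [intervalIntegral.integral_sub (ii hgc) (ii continuous_const), hintg]; simp)
    simpa using this
  have hsup : ∀ x, (g x - m) ^ 2 ≤ L / 12 * I := fun x => sq_sub_average_le hL hg hg'c hgper a x
  have hrhs : L ^ 2 / (4 * Real.pi ^ 2) * ∫ x in a..a + L, f' x ^ 2 / f x =
      4 * ((L / (2 * Real.pi)) ^ 2 * I) := by
    simp only [← hg'sq]
    rw [intervalIntegral.integral_const_mul]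
    ring
  rw [hrhs, hintf]
  -- The goal is now that the entropy is at most 4J. Wirtinger gives v ≤ J, and since π² ≤ 10 the
  -- sup bound becomes (g − m)² ≤ (10/3) J/L.
  set J := (L / (2 * Real.pi)) ^ 2 * I with hJ
  have hJ0 : 0 ≤ J := by positivity
  have hsup' : ∀ x, (g x - m) ^ 2 ≤ 10 / 3 * (J / L) := fun x => by
    refine (hsup x).trans ?_
    have hpi : Real.pi ^ 2 ≤ 10 := by nlinarith [Real.pi_lt_d2, Real.pi_pos]
    have : 10 / 3 * (J / L) = L / 12 * I * (10 / Real.pi ^ 2) := by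
      rw [hJ]; field_simp; ring
    rw [this]
    refine le_mul_of_one_le_right (by positivity) ?_
    rwa [le_div_iff₀ (by positivity), one_mul]
  have hmS : m ^ 2 ≤ S := by nlinarith
  have hJL : 0 ≤ J / L := by positivity
  -- If J/L ≤ S/2, then m² = S − v/L ≥ S/2, so g stays within 3m of m and a Taylor bound gives
  -- entropy at most 4v. Otherwise the pointwise bound log (f/S) ≤ 4J/(LS) is enough.
  rcases le_total (J / L) (S / 2) with hcase | hcase
  · have hbd : ∀ x, |g x - m| ≤ 3 * m := fun x => by
      refine abs_le_of_sq_le_sq ?_ (by positivity)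
      refine (hsup' x).trans ?_
      have : v / L ≤ J / L := by gcongr
      have : v / L = S - m ^ 2 := by rw [hvS]; field_simp
      nlinarith
    have hpt : ∀ x, f x * Real.log (f x) ≤
        Real.log (m ^ 2) * f x + f x - m ^ 2 + 4 * (g x - m) ^ 2 := fun x => by
      have h1 := sq_mul_log_div_le (hgpos x) hmpos
      rw [hgsq, Real.log_div (hpos x).ne' (by positivity)] at h1
      -- The cubic term is absorbed into the quadratic one because g − m ≤ 3m.
      have h2 : 2 / (3 * m) * (g x - m) ^ 3 ≤ 2 * (g x - m) ^ 2 := by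
        have : 2 / (3 * m) * (g x - m) ^ 3 = 2 * (g x - m) ^ 2 * ((g x - m) / (3 * m)) := by
          field_simp
        rw [this]
        refine mul_le_of_le_one_right (by positivity) ?_
        rw [div_le_one (by positivity)]
        exact (le_abs_self _).trans (hbd x)
      linarith
    have h3 : ∫ x in a..a + L, f x * Real.log (f x) ≤
        Real.log (m ^ 2) * (L * S) + L * S - L * m ^ 2 + 4 * v := by
      refine (intervalIntegral.integral_mono haL.le (ii (by fun_prop)) (ii (by fun_prop))
        hpt).trans_eq ?_
      rw [intervalIntegral.integral_add (ii (by fun_prop)) (ii (by fun_prop)),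
        intervalIntegral.integral_sub (ii (by fun_prop)) (ii (by fun_prop)),
        intervalIntegral.integral_add (ii (by fun_prop)) (ii (by fun_prop)),
        intervalIntegral.integral_const_mul, intervalIntegral.integral_const_mul, hintf]
      simp [hv]
    -- Passing from m² to S as reference value costs nothing: this cancels the terms LS − Lm² in
    -- `h3`.
    have h4 : Real.log (m ^ 2) - Real.log S ≤ m ^ 2 / S - 1 := by
      rw [← Real.log_div (by positivity) hSpos.ne']
      exact Real.log_le_sub_one_of_pos (by positivity)
    have h5 : L * S * (Real.log (m ^ 2) - Real.log S) ≤ L * m ^ 2 - L * S := by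
      refine (mul_le_mul_of_nonneg_left h4 (by positivity)).trans_eq ?_
      field_simp
    nlinarith
  · set r := √S with hr
    have hrS : r ^ 2 = S := Real.sq_sqrt hSpos.le
    have hrpos : 0 < r := Real.sqrt_pos.2 hSpos
    set q := √(J / L) with hq
    have hqS : q ^ 2 = J / L := Real.sq_sqrt hJL
    have hqpos : 0 ≤ q := Real.sqrt_nonneg _
    have hqr : 7 / 10 * r ≤ q := by
      refine le_of_sq_le_sq ?_ hqpos
      rw [mul_pow, hrS, hqS]
      nlinarith
    have hgle : ∀ x, g x ≤ r + 1.83 * q := fun x => by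
      have h1 : m ≤ r := le_of_sq_le_sq (by rw [hrS]; exact hmS) hrpos.le
      have h2 : g x - m ≤ 1.83 * q := by
        refine le_of_sq_le_sq ?_ (by positivity)
        rw [mul_pow, hqS]
        refine (hsup' x).trans ?_
        nlinarith
      linarith
    have hlog : ∀ x, Real.log (f x) - Real.log S ≤ 4 * (q ^ 2 / r ^ 2) := fun x => by
      -- The tangent of log at e, that is log y ≤ y/e, is sharper here than the tangent at 1.
      have h1 : Real.log (g x / r) ≤ 2 * (q ^ 2 / r ^ 2) := by
        have he : (2.7 : ℝ) < Real.exp 1 := by linarith [Real.exp_one_gt_d9]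
        have h2 : Real.log (g x / r / Real.exp 1) ≤ g x / r / Real.exp 1 - 1 :=
          Real.log_le_sub_one_of_pos (by have := hgpos x; positivity)
        rw [Real.log_div (by have := hgpos x; positivity) (Real.exp_pos 1).ne', Real.log_exp] at h2
        have h3 : g x / r / Real.exp 1 ≤ (r + 1.83 * q) / r / 2.7 := by
          have := hgle x
          have := hgpos x
          gcongr
        have h4 : (r + 1.83 * q) / r / 2.7 ≤ 2 * (q ^ 2 / r ^ 2) := by
          have h5 : 7 / 10 ≤ q / r := by rwa [le_div_iff₀ hrpos]
          have h6 : (r + 1.83 * q) / r / 2.7 = (1 + 1.83 * (q / r)) / 2.7 := by field_simp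
          rw [h6, ← div_pow]
          exact quadratic_bound h5
        linarith
      rw [← hgsq, ← hrS, Real.log_pow, Real.log_pow]
      rw [Real.log_div (hgpos x).ne' hrpos.ne'] at h1
      push_cast
      linarith
    have hpt : ∀ x, f x * Real.log (f x) ≤ (Real.log S + 4 * (q ^ 2 / r ^ 2)) * f x := fun x => by
      have := mul_le_mul_of_nonneg_left (hlog x) (hpos x).le
      linarith
    have h3 := intervalIntegral.integral_mono haL.le (ii (by fun_prop)) (ii (by fun_prop)) hpt
    rw [intervalIntegral.integral_const_mul, hintf, hqS, hrS] at h3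
    have : (Real.log S + 4 * (J / L / S)) * (L * S) = L * S * Real.log S + 4 * J := by
      field_simp
    linarith

/-! ### Tensorization of the entropy functional -/

/-- The entropy functional `∫ f log f - (∫ f) log (∫ f)` of a probability measure. -/
noncomputable def ent {X : Type*} [MeasurableSpace X] (μ : Measure X) (f : X → ℝ) : ℝ :=
  ∫ x, f x * Real.log (f x) ∂μ - (∫ x, f x ∂μ) * Real.log (∫ x, f x ∂μ)

theorem abs_log_le_of_mem {m M r : ℝ} (hm : 0 < m) (h1 : m ≤ r) (h2 : r ≤ M) :
    |Real.log r| ≤ |Real.log m| + |Real.log M| := by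
  have h3 := Real.log_le_log hm h1
  have h4 := Real.log_le_log (hm.trans_le h1) h2
  rw [abs_le]
  constructor
  · linarith [neg_abs_le (Real.log m), abs_nonneg (Real.log M)]
  · linarith [le_abs_self (Real.log M), abs_nonneg (Real.log m)]

section Bounded

variable {X : Type*} [MeasurableSpace X] {μ : Measure X} [IsProbabilityMeasure μ] {m M : ℝ}

theorem integrable_of_measurable_bounded {f : X → ℝ} (hf : Measurable f) {C : ℝ}
    (hC : ∀ x, |f x| ≤ C) : Integrable f μ :=
  Integrable.of_bound hf.aestronglyMeasurable C (ae_of_all _ hC)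

theorem integral_mem_Icc {f : X → ℝ} (hf : Measurable f) (hm : 0 < m)
    (hfm : ∀ x, m ≤ f x) (hfM : ∀ x, f x ≤ M) : m ≤ ∫ x, f x ∂μ ∧ ∫ x, f x ∂μ ≤ M := by
  have hi : Integrable f μ := integrable_of_measurable_bounded hf (C := M) fun x => by
    rw [abs_of_pos (hm.trans_le (hfm x))]; exact hfM x
  constructor
  · simpa using integral_mono (integrable_const m) hi hfm
  · simpa using integral_mono hi (integrable_const M) hfM

theorem abs_mul_log_le {a r : ℝ} (hm : 0 < m) (ha : m ≤ a) (haM : a ≤ M) (hr : m ≤ r)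
    (hrM : r ≤ M) : |a * Real.log r| ≤ M * (|Real.log m| + |Real.log M|) := by
  rw [abs_mul, abs_of_pos (hm.trans_le ha)]
  have := abs_log_le_of_mem hm hr hrM
  have : 0 ≤ M := hm.le.trans (ha.trans haM)
  gcongr

end Bounded

/-- Subadditivity of the entropy functional on a product of two probability spaces. -/
theorem ent_prod_le {X Y : Type*} [MeasurableSpace X] [MeasurableSpace Y] {μ : Measure X}
    {ν : Measure Y} [IsProbabilityMeasure μ] [IsProbabilityMeasure ν] {F : X × Y → ℝ}
    (hF : Measurable F) {m M : ℝ} (hm : 0 < m) (hFm : ∀ p, m ≤ F p) (hFM : ∀ p, F p ≤ M)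
    {A : Y → ℝ} {B : X → ℝ} (hA : Integrable A ν) (hB : Integrable B μ)
    (hentA : ∀ y, ent μ (fun x => F (x, y)) ≤ A y)
    (hentB : ∀ x, ent ν (fun y => F (x, y)) ≤ B x) :
    ent (μ.prod ν) F ≤ ∫ y, A y ∂ν + ∫ x, B x ∂μ := by
  set Φ : Y → ℝ := fun y => ∫ x, F (x, y) ∂μ with hΦ
  set q : X → ℝ := fun x => ∫ y, F (x, y) ∂ν with hq
  set c := ∫ p, F p ∂μ.prod ν with hc
  have hFi : ∀ {G : X × Y → ℝ}, Measurable G → (∀ p, m ≤ G p ∧ G p ≤ M) →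
      Integrable G (μ.prod ν) := fun hG hb =>
    integrable_of_measurable_bounded hG (C := M) fun p => by
      rw [abs_of_pos (hm.trans_le (hb p).1)]; exact (hb p).2
  have hΦmeas : Measurable Φ :=
    (hF.stronglyMeasurable.comp_measurable measurable_swap).integral_prod_right'.measurable
  have hqmeas : Measurable q := hF.stronglyMeasurable.integral_prod_right'.measurable
  have hΦb : ∀ y, m ≤ Φ y ∧ Φ y ≤ M := fun y =>
    integral_mem_Icc (hF.comp (measurable_id.prodMk measurable_const)) hm (fun _ => hFm _)
      fun _ => hFM _
  have hqb : ∀ x, m ≤ q x ∧ q x ≤ M := fun x =>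
    integral_mem_Icc (hF.comp (measurable_const.prodMk measurable_id)) hm (fun _ => hFm _)
      fun _ => hFM _
  have hcb : m ≤ c ∧ c ≤ M := integral_mem_Icc hF hm hFm hFM
  have hFint : Integrable F (μ.prod ν) := hFi hF fun p => ⟨hFm p, hFM p⟩
  have hint : ∀ {G H : X × Y → ℝ}, Measurable G → Measurable H → (∀ p, m ≤ G p ∧ G p ≤ M) →
      (∀ p, m ≤ H p ∧ H p ≤ M) → Integrable (fun p => G p * Real.log (H p)) (μ.prod ν) :=
    fun hG hH hGb hHb => integrable_of_measurable_bounded (hG.mul hH.log) fun p =>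
      abs_mul_log_le hm (hGb p).1 (hGb p).2 (hHb p).1 (hHb p).2
  have hFb : ∀ p, m ≤ F p ∧ F p ≤ M := fun p => ⟨hFm p, hFM p⟩
  have i1 := hint hF hF hFb hFb
  have i2 : Integrable (fun p => F p * Real.log (Φ p.2)) (μ.prod ν) := hint hF (hΦmeas.comp measurable_snd) hFb fun p => hΦb p.2
  have i3 : Integrable (fun p => F p * Real.log (q p.1)) (μ.prod ν) := hint hF (hqmeas.comp measurable_fst) hFb fun p => hqb p.1
  have i4 : Integrable (fun p : X × Y => q p.1 * Φ p.2) (μ.prod ν) :=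
    Integrable.mul_prod (hFint.integral_prod_left) (hFint.integral_prod_right)
  have e2 : ∫ p, F p * Real.log (Φ p.2) ∂μ.prod ν = ∫ y, Φ y * Real.log (Φ y) ∂ν := by
    rw [integral_prod_symm _ i2]
    simp only [integral_mul_const, hΦ]
  have e3 : ∫ p, F p * Real.log (q p.1) ∂μ.prod ν = ∫ x, q x * Real.log (q x) ∂μ := by
    rw [integral_prod _ i3]
    simp only [integral_mul_const, hq]
  have e4 : ∫ p : X × Y, q p.1 * Φ p.2 ∂μ.prod ν = c * c := by
    rw [integral_prod_mul q Φ, hc]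
    nth_rw 1 [integral_prod _ hFint]
    rw [integral_prod_symm _ hFint]
  -- This is log z ≤ z − 1 at z = qΦ/(cF), weighted by F. The last bracket integrates to zero
  -- because ∫ qΦ = c².
  have hpt : ∀ p : X × Y, F p * Real.log (Φ p.2) + F p * Real.log (q p.1) - F p * Real.log (F p)
      ≤ Real.log c * F p + (c⁻¹ * (q p.1 * Φ p.2) - F p) := fun p => by
    have hFp := hm.trans_le (hFm p)
    have hΦp := hm.trans_le (hΦb p.2).1
    have hqp := hm.trans_le (hqb p.1).1
    have hcp := hm.trans_le hcb.1
    have := mul_le_mul_of_nonneg_left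
      (Real.log_le_sub_one_of_pos (by positivity : 0 < q p.1 * Φ p.2 / (c * F p))) hFp.le
    rw [Real.log_div (by positivity) (by positivity), Real.log_mul hqp.ne' hΦp.ne',
      Real.log_mul hcp.ne' hFp.ne'] at this
    have e : F p * (q p.1 * Φ p.2 / (c * F p) - 1) = c⁻¹ * (q p.1 * Φ p.2) - F p := by
      field_simp
    linarith
  have key := integral_mono ((i2.add i3).sub i1) ((hFint.const_mul (Real.log c)).add
    ((i4.const_mul c⁻¹).sub hFint)) hpt
  simp only [Pi.add_apply, Pi.sub_apply] at key
  rw [integral_sub (by exact i2.add i3) i1, integral_add i2 i3,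
    integral_add (hFint.const_mul _) (by exact (i4.const_mul _).sub hFint),
    integral_sub (i4.const_mul _) hFint, integral_const_mul, integral_const_mul, e2, e3, e4,
    ← hc, inv_mul_cancel_left₀ (hm.trans_le hcb.1).ne'] at key
  have hΦi : Integrable (fun y => Φ y * Real.log (Φ y)) ν :=
    integrable_of_measurable_bounded (hΦmeas.mul hΦmeas.log) fun y =>
      abs_mul_log_le hm (hΦb y).1 (hΦb y).2 (hΦb y).1 (hΦb y).2
  have hqi : Integrable (fun x => q x * Real.log (q x)) μ :=
    integrable_of_measurable_bounded (hqmeas.mul hqmeas.log) fun x =>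
      abs_mul_log_le hm (hqb x).1 (hqb x).2 (hqb x).1 (hqb x).2
  have kA := integral_mono (i1.integral_prod_right.sub hΦi) hA hentA
  have kB := integral_mono (i1.integral_prod_left.sub hqi) hB hentB
  simp only [Pi.sub_apply] at kA kB
  rw [integral_sub i1.integral_prod_right hΦi, ← integral_prod_symm _ i1] at kA
  rw [integral_sub i1.integral_prod_left hqi, ← integral_prod _ i1] at kB
  unfold ent
  rw [← hc]
  linarith

/-- Subadditivity of the entropy functional on a finite power of a probability space, in the form
in which it tensorizes logarithmic Sobolev inequalities. -/
theorem ent_pi_le (ν : Measure ℝ) [IsProbabilityMeasure ν] {m M C : ℝ} (hm : 0 < m) :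
    ∀ (n : ℕ) (f : (Fin n → ℝ) → ℝ) (G : Fin n → (Fin n → ℝ) → ℝ), Measurable f →
      (∀ i, Measurable (G i)) → (∀ x, m ≤ f x) → (∀ x, f x ≤ M) → (∀ i x, |G i x| ≤ C) →
      (∀ i x, ent ν (fun s => f (Function.update x i s)) ≤ ∫ s, G i (Function.update x i s) ∂ν) →
      ent (Measure.pi fun _ : Fin n => ν) f ≤ ∑ i, ∫ x, G i x ∂(Measure.pi fun _ : Fin n => ν) := by
  intro n
  induction n with
  | zero =>
    intro f G hf _ _ _ _ _
    have : ∀ g : (Fin 0 → ℝ) → ℝ, ∫ x, g x ∂(Measure.pi fun _ : Fin 0 => ν) = g finZeroElim := by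
      intro g
      rw [integral_congr_ae (g := fun _ => g finZeroElim)
        (ae_of_all _ fun x => congrArg g (Subsingleton.elim _ _))]
      simp
    simp [ent, this]
  | succ n ih =>
    intro f G hf hG hfm hfM hGC hslice
    set π : Measure (Fin n → ℝ) := Measure.pi fun _ : Fin n => ν with hπ
    have hmp := (measurePreserving_piFinSuccAbove (fun _ : Fin (n + 1) => ν) 0).symm
    have hmp' : MeasurePreserving (fun p : ℝ × (Fin n → ℝ) => (Fin.cons p.1 p.2 : Fin (n + 1) → ℝ))
        (ν.prod π) (Measure.pi fun _ : Fin (n + 1) => ν) := by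
      convert hmp using 1
      ext p
      simp [MeasurableEquiv.piFinSuccAbove, Fin.insertNthEquiv]
    have hemb : MeasurableEmbedding
        (fun p : ℝ × (Fin n → ℝ) => (Fin.cons p.1 p.2 : Fin (n + 1) → ℝ)) := by
      convert (MeasurableEquiv.piFinSuccAbove (fun _ : Fin (n + 1) => ℝ) 0).symm.measurableEmbedding
        using 1
      ext p
      simp [MeasurableEquiv.piFinSuccAbove, Fin.insertNthEquiv]
    have htr : ∀ g : (Fin (n + 1) → ℝ) → ℝ, ∫ x, g x ∂(Measure.pi fun _ : Fin (n + 1) => ν) =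
        ∫ p : ℝ × (Fin n → ℝ), g (Fin.cons p.1 p.2) ∂ν.prod π := fun g =>
      (hmp'.integral_comp hemb g).symm
    have hmeas : ∀ {g : (Fin (n + 1) → ℝ) → ℝ}, Measurable g →
        Measurable fun p : ℝ × (Fin n → ℝ) => g (Fin.cons p.1 p.2) :=
      fun hg => hg.comp hmp'.measurable
    have hGi : ∀ i, Integrable (fun p : ℝ × (Fin n → ℝ) => G i (Fin.cons p.1 p.2)) (ν.prod π) :=
      fun i => integrable_of_measurable_bounded (hmeas (hG i)) fun p => hGC i _
    -- Coordinate 0 is split off: `A` comes from the slice hypothesis in that coordinate, `B` from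
    -- the induction hypothesis with that coordinate frozen.
    have h := ent_prod_le (μ := ν) (ν := π) (F := fun p => f (Fin.cons p.1 p.2)) (hmeas hf) hm
      (fun _ => hfm _) (fun _ => hfM _)
      (A := fun y => ∫ s, G 0 (Fin.cons s y) ∂ν)
      (B := fun s => ∑ i : Fin n, ∫ y, G i.succ (Fin.cons s y) ∂π)
      (hGi 0).integral_prod_right (integrable_finsetSum _ fun i _ => (hGi i.succ).integral_prod_left)
      (fun y => by simpa using hslice 0 (Fin.cons 0 y))
      (fun s => by
        refine ih (fun y => f (Fin.cons s y)) (fun i y => G i.succ (Fin.cons s y))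
          ((hmeas hf).comp (measurable_const.prodMk measurable_id))
          (fun i => (hmeas (hG i.succ)).comp (measurable_const.prodMk measurable_id))
          (fun _ => hfm _) (fun _ => hfM _) (fun _ _ => hGC _ _) fun i y => ?_
        simpa [Fin.cons_update] using hslice i.succ (Fin.cons s y))
    rw [Fin.sum_univ_succ]
    unfold ent at h ⊢
    simp only [htr]
    refine h.trans_eq ?_
    rw [integral_finsetSum _ fun i _ => (hGi i.succ).integral_prod_left,
      integral_prod_symm _ (hGi 0)]
    congr 1
    exact Finset.sum_congr rfl fun i _ => (integral_prod _ (hGi i.succ)).symm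

/-! ### The torus -/

section Torus

variable {d : ℕ} {L : ℝ}

theorem cell_eq_preimage (d : ℕ) (L : ℝ) :
    cell d L = WithLp.ofLp ⁻¹' Icc (fun _ => -L / 2) (fun _ => L / 2) := by
  ext x
  simp [cell, Pi.le_def, forall_and]

theorem toLp_preimage_cell (d : ℕ) (L : ℝ) :
    WithLp.toLp 2 ⁻¹' cell d L = Icc (fun _ => -L / 2) (fun _ => L / 2) := by
  rw [cell_eq_preimage]; rfl

theorem isCompact_cell (d : ℕ) (L : ℝ) : IsCompact (cell d L) := by
  rw [cell_eq_preimage]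
  exact (EuclideanSpace.equiv (Fin d) ℝ).toHomeomorph.isCompact_preimage.2 isCompact_Icc

theorem measurableSet_cell (d : ℕ) (L : ℝ) : MeasurableSet (cell d L) :=
  (isCompact_cell d L).isClosed.measurableSet

theorem setIntegral_cell (f : E d → ℝ) :
    ∫ x in cell d L, f x = ∫ y in Icc (fun _ => -L / 2) (fun _ => L / 2), f (WithLp.toLp 2 y) := by
  rw [← toLp_preimage_cell]
  exact ((PiLp.volume_preserving_toLp (Fin d)).setIntegral_preimage_emb
    (MeasurableEquiv.toLp 2 (Fin d → ℝ)).measurableEmbedding f _).symm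

theorem volume_cell (hL : 0 < L) : volume (cell d L) = ENNReal.ofReal (L ^ d) := by
  rw [cell_eq_preimage, (PiLp.volume_preserving_ofLp (Fin d)).measure_preimage
    measurableSet_Icc.nullMeasurableSet, Real.volume_Icc_pi]
  simp only [Finset.prod_const, Finset.card_univ, Fintype.card_fin]
  rw [← ENNReal.ofReal_pow (by linarith)]
  ring_nf

instance isFiniteMeasure_restrict_cell : IsFiniteMeasure (volume.restrict (cell d L)) :=
  ⟨by rw [Measure.restrict_apply_univ]; exact (isCompact_cell d L).measure_lt_top⟩

theorem real_volume_cell (hL : 0 < L) : volume.real (cell d L) = L ^ d := by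
  rw [Measure.real, volume_cell hL, ENNReal.toReal_ofReal (by positivity)]

theorem integrableOn_cell {f : E d → ℝ} (hf : Continuous f) : IntegrableOn f (cell d L) :=
  hf.continuousOn.integrableOn_compact (isCompact_cell d L)

theorem setIntegral_cell_const (hL : 0 < L) (c : ℝ) : ∫ _ in cell d L, c = L ^ d * c := by
  rw [setIntegral_const, real_volume_cell hL, smul_eq_mul]

/-! ### Periodic functions -/

theorem IsPeriodic.add_lattice {f : E d → ℝ} (hf : IsPeriodic L f) (k : Fin d → ℤ) (x : E d) :
    f (x + ∑ i, k i • EuclideanSpace.single i L) = f x := by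
  have : ∀ s : Finset (Fin d), Function.Periodic f (∑ i ∈ s, k i • EuclideanSpace.single i L) := by
    intro s
    induction s using Finset.induction_on with
    | empty => intro x; simp
    | insert i s hi ih =>
      rw [Finset.sum_insert hi]
      exact (Function.Periodic.zsmul (fun x => hf x i) (k i)).add_period ih
  exact this _ x

theorem exists_add_lattice_mem_cell (hL : 0 < L) (x : E d) :
    ∃ k : Fin d → ℤ, x + ∑ i, k i • EuclideanSpace.single i L ∈ cell d L := by
  refine ⟨fun i => -toIcoDiv hL (-L / 2) (x i), fun i => ?_⟩
  have h1 : (x + ∑ i, (-toIcoDiv hL (-L / 2) (x i)) • EuclideanSpace.single i L : E d) i =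
      toIcoMod hL (-L / 2) (x i) := by
    simp [Finset.sum_apply, toIcoMod, sub_eq_add_neg, Pi.single_apply, mul_comm]
  rw [h1]
  have := toIcoMod_mem_Ico hL (-L / 2) (x i)
  exact ⟨this.1, by linarith [this.2]⟩

theorem IsPeriodic.exists_mem_cell {f : E d → ℝ} (hf : IsPeriodic L f) (hL : 0 < L) (x : E d) :
    ∃ y ∈ cell d L, f y = f x :=
  let ⟨k, hk⟩ := exists_add_lattice_mem_cell hL x
  ⟨_, hk, hf.add_lattice k x⟩

theorem IsPeriodic.exists_bound {f : E d → ℝ} (hf : IsPeriodic L f) (hL : 0 < L)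
    (hc : Continuous f) : ∃ C, ∀ x, |f x| ≤ C := by
  obtain ⟨C, hC⟩ := (isCompact_cell d L).exists_bound_of_continuousOn hc.continuousOn
  refine ⟨C, fun x => ?_⟩
  obtain ⟨y, hy, hyx⟩ := hf.exists_mem_cell hL x
  exact hyx ▸ hC y hy

theorem IsPeriodic.exists_lower_bound {f : E d → ℝ} (hf : IsPeriodic L f) (hL : 0 < L)
    (hc : Continuous f) (hpos : ∀ x, 0 < f x) : ∃ m, 0 < m ∧ ∀ x, m ≤ f x := by
  rcases (cell d L).eq_empty_or_nonempty with h | h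
  · obtain ⟨y, hy, -⟩ := hf.exists_mem_cell hL 0
    simp [h] at hy
  · obtain ⟨z, -, hz⟩ := (isCompact_cell d L).exists_isMinOn h hc.continuousOn
    refine ⟨f z, hpos z, fun x => ?_⟩
    obtain ⟨y, hy, hyx⟩ := hf.exists_mem_cell hL x
    exact hyx ▸ hz hy

theorem IsPeriodic.partialD {f : E d → ℝ} (hf : IsPeriodic L f) (i : Fin d) :
    IsPeriodic L (partialD i f) := fun x j => by
  have h : (fun y => f (y + EuclideanSpace.single j L)) = f := funext fun y => hf y j
  unfold GraphopMcKeanVlasov.partialD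
  rw [← fderiv_comp_add_right, h]

theorem continuous_partialD {f : E d → ℝ} (hf : ContDiff ℝ 1 f) (i : Fin d) :
    Continuous (partialD i f) :=
  (hf.continuous_fderiv one_ne_zero).clm_apply continuous_const

/-! ### The divergence theorem on the torus -/

/-- Fluxes through opposite faces of the cell cancel by periodicity. Differentiability and an
integrable divergence suffice; this matters because the flux of a classical solution is not assumed
to be C¹. -/
theorem integral_divergence_eq_zero (hL : 0 < L) {F : Fin d → E d → ℝ}
    (hF : ∀ i, Differentiable ℝ (F i)) (hper : ∀ i, IsPeriodic L (F i))
    (hint : IntegrableOn (divergence F) (cell d L)) : ∫ x in cell d L, divergence F x = 0 := by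
  cases d with
  | zero => simp [divergence]
  | succ n =>
    let e : (Fin (n + 1) → ℝ) →L[ℝ] E (n + 1) :=
      (EuclideanSpace.equiv (Fin (n + 1)) ℝ).symm.toContinuousLinearMap
    have he : ∀ y, e y = WithLp.toLp 2 y := fun y => rfl
    have hes : ∀ i, e (Pi.single i 1) = EuclideanSpace.single i 1 := fun i => rfl
    rw [setIntegral_cell]
    have hint' : IntegrableOn (fun y => divergence F (WithLp.toLp 2 y))
        (Icc (fun _ => -L / 2) (fun _ => L / 2)) := by
      rw [← toLp_preimage_cell]
      exact ((PiLp.volume_preserving_toLp (Fin (n + 1))).integrableOn_comp_preimage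
        (MeasurableEquiv.toLp 2 (Fin (n + 1) → ℝ)).measurableEmbedding).2 hint
    have hder : ∀ i y, HasFDerivAt (fun y => F i (e y)) ((fderiv ℝ (F i) (e y)).comp e) y :=
      fun i y => (hF i (e y)).hasFDerivAt.comp y e.hasFDerivAt
    have key := integral_divergence_of_hasFDerivAt_off_countable' (n := n)
      (fun _ => -L / 2) (fun _ => L / 2) (fun _ => by simp only; linarith)
      (fun i y => F i (e y)) (fun i y => (fderiv ℝ (F i) (e y)).comp e) ∅ countable_empty
      (fun i => (continuous_iff_continuousAt.2 fun y => (hder i y).continuousAt).continuousOn)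
      (fun y _ i => hder i y) hint'
    refine Eq.trans key (Finset.sum_eq_zero fun i _ => ?_)
    rw [sub_eq_zero]
    refine setIntegral_congr_fun measurableSet_Icc fun y _ => ?_
    simp only [he]
    rw [← hper i (WithLp.toLp 2 (i.insertNth (-L / 2) y)) i]
    congr 1
    ext j
    refine Fin.succAboveCases i ?_ (fun j => ?_) j
    · simp; ring
    · simp

/-! ### The logarithmic Sobolev inequality on the torus -/

theorem pi_smul_restrict_Icc (hL : 0 < L) :
    Measure.pi (fun _ : Fin d => (ENNReal.ofReal L)⁻¹ • volume.restrict (Icc (-L / 2) (L / 2))) =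
      (ENNReal.ofReal (L ^ d))⁻¹ •
        volume.restrict (Icc (fun _ : Fin d => -L / 2) (fun _ => L / 2)) := by
  have : IsFiniteMeasure ((ENNReal.ofReal L)⁻¹ • volume.restrict (Icc (-L / 2) (L / 2))) :=
    Measure.smul_finite _ (by simpa using hL)
  refine Measure.pi_eq (μ := fun _ : Fin d => (ENNReal.ofReal L)⁻¹ •
    volume.restrict (Icc (-L / 2) (L / 2))) fun s hs => ?_
  rw [Measure.smul_apply, Measure.restrict_apply (MeasurableSet.univ_pi hs), ← pi_univ_Icc,
    ← pi_inter_distrib, volume_pi_pi]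
  simp only [Measure.smul_apply, Measure.restrict_apply (hs _), smul_eq_mul]
  rw [Finset.prod_mul_distrib, Finset.prod_const, Finset.card_univ, Fintype.card_fin,
    ENNReal.ofReal_pow hL.le, ENNReal.inv_pow]

/-- The circle inequality holds on every coordinate line, and `ent_pi_le` adds the lines up on the
product of the normalized Lebesgue measures. The constant does not depend on d. -/
theorem logSobolev_cell (hL : 0 < L) {u : E d → ℝ} (hu : ContDiff ℝ 1 u) (hper : IsPeriodic L u)
    (hpos : ∀ x, 0 < u x) :
    (∫ x in cell d L, u x * Real.log (u x)) -
        (∫ x in cell d L, u x) * Real.log ((∫ x in cell d L, u x) / L ^ d) ≤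
      L ^ 2 / (4 * Real.pi ^ 2) * ∑ i, ∫ x in cell d L, partialD i u x ^ 2 / u x := by
  set ν : Measure ℝ := (ENNReal.ofReal L)⁻¹ • volume.restrict (Icc (-L / 2) (L / 2)) with hν
  have hνint : ∀ g : ℝ → ℝ, ∫ s, g s ∂ν = L⁻¹ * ∫ s in (-L / 2)..(-L / 2 + L), g s := fun g => by
    rw [hν, integral_smul_measure, intervalIntegral.integral_of_le (by linarith),
      ← integral_Icc_eq_integral_Ioc, show -L / 2 + L = L / 2 by ring]
    simp [hL.le]
  have : IsProbabilityMeasure ν := ⟨by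
    rw [hν, Measure.smul_apply, Measure.restrict_apply_univ, Real.volume_Icc, smul_eq_mul,
      show L / 2 - -L / 2 = L by ring, ENNReal.inv_mul_cancel (by simpa using hL) (by simp)]⟩
  have hLd : 0 < L ^ d := by positivity
  have hπint : ∀ g : E d → ℝ, ∫ y, g (WithLp.toLp 2 y) ∂(Measure.pi fun _ : Fin d => ν) =
      (L ^ d)⁻¹ * ∫ x in cell d L, g x := fun g => by
    rw [hν, pi_smul_restrict_Icc hL, integral_smul_measure, setIntegral_cell]
    simp [hL.le]
  have hcu : Continuous u := hu.continuous
  obtain ⟨M, hM⟩ := hper.exists_bound hL hcu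
  obtain ⟨m, hm, hmu⟩ := hper.exists_lower_bound hL hcu hpos
  let G : Fin d → E d → ℝ := fun i x => L ^ 2 / (4 * Real.pi ^ 2) * (partialD i u x ^ 2 / u x)
  have hcG : ∀ i, Continuous (G i) := fun i =>
    continuous_const.mul (((continuous_partialD hu i).pow 2).div hcu fun x => (hpos x).ne')
  have hGper : ∀ i, IsPeriodic L (G i) := fun i x j => by
    simp only [G, (hper.partialD i) x j, hper x j]
  have hGb : ∃ C, ∀ i x, |G i x| ≤ C := by
    choose C hC using fun i => (hGper i).exists_bound hL (hcG i)
    exact ⟨∑ i, |C i|, fun i x => (hC i x).trans ((le_abs_self _).trans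
      (Finset.single_le_sum (f := fun i => |C i|) (fun _ _ => abs_nonneg _) (Finset.mem_univ i)))⟩
  obtain ⟨C, hC⟩ := hGb
  have hlp : Measurable (WithLp.toLp 2 : (Fin d → ℝ) → E d) :=
    (MeasurableEquiv.toLp 2 (Fin d → ℝ)).measurable
  have hupd : ∀ (x : Fin d → ℝ) i (s : ℝ), WithLp.toLp 2 (Function.update x i s) =
      (WithLp.toLp 2 (Function.update x i 0) : E d) + s • EuclideanSpace.single i (1 : ℝ) := by
    intro x i s
    ext j
    by_cases h : j = i
    · subst h; simp
    · simp [h]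
  have h := ent_pi_le ν (C := C) (M := M) hm d (fun y => u (WithLp.toLp 2 y))
    (fun i y => G i (WithLp.toLp 2 y)) (hcu.measurable.comp hlp)
    (fun i => (hcG i).measurable.comp hlp) (fun _ => hmu _)
    (fun _ => (le_abs_self _).trans (hM _)) (fun _ _ => hC _ _) (fun i x => by
      unfold ent
      rw [hνint, hνint, hνint]
      obtain ⟨z, hz⟩ : ∃ z : E d, ∀ s : ℝ, WithLp.toLp 2 (Function.update x i s) =
        z + s • EuclideanSpace.single i (1 : ℝ) := ⟨_, hupd x i⟩
      simp only [hz]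
      have hd : ∀ s : ℝ, HasDerivAt (fun s : ℝ => u (z + s • EuclideanSpace.single i (1 : ℝ)))
          (partialD i u (z + s • EuclideanSpace.single i (1 : ℝ))) s := fun s => by
        have h1 : HasDerivAt (fun s : ℝ => z + s • EuclideanSpace.single i (1 : ℝ))
            (EuclideanSpace.single i (1 : ℝ)) s := by
          simpa using ((hasDerivAt_id s).smul_const (EuclideanSpace.single i (1 : ℝ))).const_add z
        exact (hu.differentiable one_ne_zero _).hasFDerivAt.comp_hasDerivAt s h1
      have hc : Continuous fun s : ℝ => z + s • EuclideanSpace.single i (1 : ℝ) := by fun_prop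
      have hp : Function.Periodic (fun s : ℝ => u (z + s • EuclideanSpace.single i (1 : ℝ))) L :=
        fun s => by
          have : z + (s + L) • EuclideanSpace.single i (1 : ℝ) =
              z + s • EuclideanSpace.single i (1 : ℝ) + EuclideanSpace.single i L := by
            ext j; by_cases h : j = i
            · subst h; simp; ring
            · simp [h]
          simp only [this, hper _ i]
      have := mul_le_mul_of_nonneg_left (logSobolev_circle hL hd
        ((continuous_partialD hu i).comp hc) hp (fun _ => hpos _) (-L / 2)) (inv_pos.2 hL).le
      simp only [G]
      rw [intervalIntegral.integral_const_mul]
      linarith)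
  unfold ent at h
  rw [hπint (fun x => u x * Real.log (u x)), hπint u] at h
  simp only [hπint (G _)] at h
  have h2 := mul_le_mul_of_nonneg_left h hLd.le
  simp only [G] at h2
  rw [Finset.mul_sum] at h2 ⊢
  rw [div_eq_inv_mul]
  refine le_trans (le_of_eq ?_) (h2.trans_eq (Finset.sum_congr rfl fun i _ => ?_))
  · field_simp
  · rw [integral_const_mul]; field_simp

end Torus

open Filter Topology Convolution

/-! ### Mollification and smooth approximation of the potential -/

section Mollify

variable {d : ℕ} {L : ℝ}

/-- The convolution of `g` with the mollifier `η`. -/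
noncomputable def mollify (η g : E d → ℝ) (x : E d) : ℝ := ∫ t, g t * η (x - t)

theorem mollify_eq (η g : E d → ℝ) :
    mollify η g = g ⋆[ContinuousLinearMap.mul ℝ ℝ, volume] η := rfl

theorem contDiff_mollify {η g : E d → ℝ} (hη : ContDiff ℝ ∞ η) (hc : HasCompactSupport η)
    (hg : LocallyIntegrable g) : ContDiff ℝ ∞ (mollify η g) := by
  rw [mollify_eq]
  exact hc.contDiff_convolution_right _ hg hη

theorem partialD_comp_sub_left {η : E d → ℝ} (hη : Differentiable ℝ η) (i : Fin d) (x t : E d) :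
    partialD i (fun t => η (x - t)) t = -partialD i η (x - t) := by
  have h : HasFDerivAt (fun t => η (x - t)) ((fderiv ℝ η (x - t)).comp
      (-ContinuousLinearMap.id ℝ (E d))) t :=
    (hη (x - t)).hasFDerivAt.comp t ((hasFDerivAt_id t).const_sub x)
  simp [partialD, h.fderiv]

theorem partialD_comp_sub_right {η : E d → ℝ} (i : Fin d) (y x : E d) :
    partialD i (fun x => η (x - y)) x = partialD i η (x - y) := by
  unfold partialD
  rw [fderiv_comp_sub]

/-- The derivative falls on η, and t ↦ η(x − t) is a test function for the weak derivative. -/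
theorem partialD_mollify {η g h : E d → ℝ} {i : Fin d} (hη : ContDiff ℝ ∞ η)
    (hc : HasCompactSupport η) (hg : IsWeakPartial i g h) :
    partialD i (mollify η g) = mollify η h := by
  funext x
  have h1 := hc.hasFDerivAt_convolution_right (ContinuousLinearMap.mul ℝ ℝ)
    hg.locallyIntegrable_left (hη.of_le (by norm_cast)) x
  rw [partialD, mollify_eq, h1.fderiv,
    convolution_precompR_apply _ hg.locallyIntegrable_left (hc.fderiv ℝ)
      (hη.continuous_fderiv (by simp))]
  have h2 := hg.integral_eq (fun t => η (x - t)) (by fun_prop)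
    (hc.comp_homeomorph (Homeomorph.subLeft x))
  simp only [partialD_comp_sub_left (hη.differentiable (by simp)), mul_neg, integral_neg, neg_inj] at h2
  exact h2

theorem abs_mollify_le {η g : E d → ℝ} (hη : Continuous η) (hc : HasCompactSupport η)
    (h0 : ∀ x, 0 ≤ η x) (h1 : ∫ x, η x = 1) {C : ℝ} (hg : ∀ᵐ x, |g x| ≤ C) (x : E d) :
    |mollify η g x| ≤ C := by
  have hi : Integrable fun t => η (x - t) :=
    (hη.integrable_of_hasCompactSupport hc).comp_sub_left x
  have : ∫ t, C * η (x - t) = C := by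
    rw [integral_const_mul, integral_sub_left_eq_self (fun t => η t) volume x, h1, mul_one]
  rw [← this]
  refine norm_integral_le_of_norm_le (f := fun t => g t * η (x - t)) (hi.const_mul C) ?_
  filter_upwards [hg] with t ht
  rw [norm_mul, Real.norm_eq_abs, Real.norm_of_nonneg (h0 _)]
  exact mul_le_mul_of_nonneg_right ht (h0 _)

theorem IsPeriodic.mollify {η g : E d → ℝ} (hg : IsPeriodic L g) :
    IsPeriodic L (mollify η g) := fun x i => by
  unfold GraphopMcKeanVlasov.mollify
  rw [← integral_add_right_eq_self _ (EuclideanSpace.single i L)]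
  refine integral_congr_ae (ae_of_all _ fun t => ?_)
  simp only [hg t i, add_sub_add_right_eq_sub]

theorem mollify_finset_sum {ι : Type*} (s : Finset ι) {η : E d → ℝ} {g : ι → E d → ℝ}
    (hη : Continuous η) (hc : HasCompactSupport η) (hg : ∀ i, LocallyIntegrable (g i)) (x : E d) :
    mollify η (fun y => ∑ i ∈ s, g i y) x = ∑ i ∈ s, mollify η (g i) x := by
  unfold mollify
  simp only [Finset.sum_mul]
  exact integral_finsetSum _ fun i _ =>
    (hc.convolutionExists_right (ContinuousLinearMap.mul ℝ ℝ) (hg i) hη x)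

/-- A sequence of mollifiers. -/
noncomputable def bump (d n : ℕ) : ContDiffBump (0 : E d) where
  rIn := 1 / (2 * (n + 1))
  rOut := 1 / (n + 1)
  rIn_pos := by positivity
  rIn_lt_rOut := by
    rw [div_lt_div_iff₀ (by positivity) (by positivity)]
    nlinarith [Nat.cast_nonneg (α := ℝ) n]

theorem ae_tendsto_mollify {g : E d → ℝ} (hg : LocallyIntegrable g) :
    ∀ᵐ x, Tendsto (fun n => mollify ((bump d n).normed volume) g x) atTop (𝓝 (g x)) := by
  have h := ContDiffBump.ae_convolution_tendsto_right_of_locallyIntegrable (μ := volume)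
    (φ := fun n => bump d n) (l := atTop) (K := 2) tendsto_one_div_add_atTop_nhds_zero_nat
    (Eventually.of_forall fun n => by simp only [bump]; apply le_of_eq; field_simp) hg
  filter_upwards [h] with x hx
  refine hx.congr fun n => ?_
  rw [convolution_eq_swap]
  refine integral_congr_ae (ae_of_all _ fun t => ?_)
  simp [mul_comm]

theorem mollify_mollifier_abs_le {g : E d → ℝ} {C : ℝ} (hg : ∀ᵐ x, |g x| ≤ C) (n : ℕ) (x : E d) :
    |mollify ((bump d n).normed volume) g x| ≤ C :=
  abs_mollify_le (bump d n).continuous_normed (bump d n).hasCompactSupport_normed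
    (bump d n).nonneg_normed (bump d n).integral_normed hg x

theorem ae_abs_le_of_memLp_top {X : Type*} [MeasurableSpace X] {μ : Measure X} {f : X → ℝ}
    (hf : MemLp f ∞ μ) : ∀ᵐ x ∂μ, |f x| ≤ (eLpNorm f ∞ μ).toReal := by
  filter_upwards [ae_le_eLpNormEssSup (f := f) (μ := μ)] with x hx
  rw [← eLpNorm_exponent_top] at hx
  have := ENNReal.toReal_mono hf.2.ne hx
  simpa using this

/-- An a.e. bound on the cell for an a.e. periodic function is an a.e. bound everywhere. -/
theorem ae_of_ae_cell (hL : 0 < L) {g : E d → ℝ} {C : ℝ}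
    (hper : ∀ v : Fin d → ℤ, ∀ᵐ x, g (x + ∑ i, v i • EuclideanSpace.single i L) = g x)
    (hC : ∀ᵐ x ∂volume.restrict (cell d L), |g x| ≤ C) : ∀ᵐ x, |g x| ≤ C := by
  rw [ae_restrict_iff' (measurableSet_cell d L)] at hC
  have h2 : ∀ v : Fin d → ℤ, ∀ᵐ x, x + ∑ i, v i • EuclideanSpace.single i L ∈ cell d L →
      |g (x + ∑ i, v i • EuclideanSpace.single i L)| ≤ C := fun v =>
    (measurePreserving_add_right volume _).quasiMeasurePreserving.ae hC
  filter_upwards [ae_all_iff.2 hper, ae_all_iff.2 h2] with x hx1 hx2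
  obtain ⟨k, hk⟩ := exists_add_lattice_mem_cell hL x
  rw [← hx1 k]
  exact hx2 k hk

/-- Mollification commutes with weak derivatives, and averaging does not increase essential bounds.
What needs care is that `D.lapNorm` sees only the cell, while mollification averages over all of
space. -/
theorem Potential.exists_smooth_approx (hL : 0 < L) (D : Potential d L) :
    ∃ (P : ℕ → E d → ℝ) (C : ℝ), (∀ n, ContDiff ℝ ∞ (P n)) ∧ (∀ n, IsPeriodic L (P n)) ∧
      (∀ n i x, |partialD i (P n) x| ≤ C) ∧ (∀ n x, |lap (P n) x| ≤ D.lapNorm) ∧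
      ∀ᵐ x, ∀ i, Tendsto (fun n => partialD i (P n) x) atTop (𝓝 (D.grad i x)) := by
  let η : ℕ → E d → ℝ := fun n => (bump d n).normed volume
  have hη : ∀ n, ContDiff ℝ ∞ (η n) := fun n => (bump d n).contDiff_normed
  have hηc : ∀ n, HasCompactSupport (η n) := fun n => (bump d n).hasCompactSupport_normed
  let P : ℕ → E d → ℝ := fun n => mollify (η n) D.toFun
  have hP1 : ∀ n i, partialD i (P n) = mollify (η n) (D.grad i) := fun n i =>
    partialD_mollify (hη n) (hηc n) (D.isWeakPartial_grad i)
  have hP2 : ∀ n i j, partialD j (partialD i (P n)) = mollify (η n) (D.hess i j) := fun n i j => by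
    rw [hP1]
    exact partialD_mollify (hη n) (hηc n) (D.isWeakPartial_hess i j)
  have hhess : ∀ i j, LocallyIntegrable (D.hess i j) :=
    fun i j => (D.isWeakPartial_hess i j).locallyIntegrable_right
  have hPper : ∀ n, IsPeriodic L (P n) := fun n => D.periodic.mollify
  let ℓ : E d → ℝ := fun x => ∑ i, D.hess i i x
  have hlap : ∀ n x, lap (P n) x = mollify (η n) ℓ x := fun n x => by
    unfold lap
    simp only [hP2]
    exact (mollify_finset_sum _ (hη n).continuous (hηc n) (fun i => hhess i i) x).symm
  have hℓ : LocallyIntegrable ℓ := by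
    have := locallyIntegrable_finsetSum (μ := volume) (f := fun i x => D.hess i i x) Finset.univ
      fun i _ => hhess i i
    exact this
  have hlapper : ∀ n, IsPeriodic L (lap (P n)) := fun n x j => by
    unfold lap
    exact Finset.sum_congr rfl fun i _ => ((hPper n).partialD i).partialD i x j
  have hℓconv : ∀ᵐ x, Tendsto (fun n => lap (P n) x) atTop (𝓝 (ℓ x)) := by
    simp only [hlap]
    exact ae_tendsto_mollify hℓ
  -- Periodicity of the second derivatives is not part of `Potential`; the Laplacian inherits it
  -- almost everywhere as the limit of the periodic functions `lap (P n)`.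
  have hℓper : ∀ v : Fin d → ℤ, ∀ᵐ x, ℓ (x + ∑ i, v i • EuclideanSpace.single i L) = ℓ x := by
    intro v
    filter_upwards [hℓconv, (measurePreserving_add_right volume
      (∑ i, v i • EuclideanSpace.single i L)).quasiMeasurePreserving.ae hℓconv] with x h1 h2
    refine tendsto_nhds_unique h2 (h1.congr fun n => ?_)
    exact ((hlapper n).add_lattice v x).symm
  have hℓmem : MemLp ℓ ∞ (volume.restrict (cell d L)) :=
    memLp_finsetSum (f := fun i x => D.hess i i x) Finset.univ
      fun i _ => (D.memLp_hess i i).restrict _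
  have hℓbd : ∀ᵐ x, |ℓ x| ≤ D.lapNorm := ae_of_ae_cell hL hℓper (ae_abs_le_of_memLp_top hℓmem)
  refine ⟨P, ∑ i, (eLpNorm (D.grad i) ∞ volume).toReal, fun n => contDiff_mollify (hη n) (hηc n)
    (D.memLp_toFun.locallyIntegrable le_top), hPper, fun n i x => ?_, fun n x => ?_, ?_⟩
  · rw [hP1]
    refine (mollify_mollifier_abs_le (ae_abs_le_of_memLp_top (D.memLp_grad i)) n x).trans ?_
    exact Finset.single_le_sum (f := fun i => (eLpNorm (D.grad i) ∞ volume).toReal)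
      (fun _ _ => ENNReal.toReal_nonneg) (Finset.mem_univ i)
  · rw [hlap]
    exact mollify_mollifier_abs_le hℓbd n x
  · rw [ae_all_iff]
    intro i
    simp only [hP1]
    exact ae_tendsto_mollify (D.isWeakPartial_grad i).locallyIntegrable_right

end Mollify

/-! ### The interaction term -/

section Drift

variable {d : ℕ} {L : ℝ}

/-- The convolution over the torus of the `i`-th component of the vector field `g` with `a`. -/
noncomputable def drift (L : ℝ) (g : Fin d → E d → ℝ) (a : E d → ℝ) (i : Fin d) (x : E d) : ℝ :=
  ∫ y in cell d L, g i (x - y) * a y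

theorem abs_integral_le_of_abs_le {X : Type*} [MeasurableSpace X] {μ : Measure X} {f g : X → ℝ}
    (hg : Integrable g μ) (h : ∀ x, |f x| ≤ g x) : |∫ x, f x ∂μ| ≤ ∫ x, g x ∂μ :=
  norm_integral_le_of_norm_le (f := f) hg (ae_of_all _ h)

theorem partialD_mul {f g : E d → ℝ} {i : Fin d} {x : E d} (hf : DifferentiableAt ℝ f x)
    (hg : DifferentiableAt ℝ g x) :
    partialD i (fun y => f y * g y) x = partialD i f x * g x + f x * partialD i g x := by
  unfold partialD
  rw [fderiv_fun_mul hf hg]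
  simp
  ring

theorem integral_lap_eq_zero (hL : 0 < L) {P : E d → ℝ} (hP : ContDiff ℝ 2 P)
    (hper : IsPeriodic L P) : ∫ x in cell d L, lap P x = 0 := by
  have hd : ∀ i, ContDiff ℝ 1 (partialD i P) := fun i =>
    (hP.fderiv_right (m := 1) (by norm_num)).clm_apply contDiff_const
  refine integral_divergence_eq_zero hL (F := fun i => partialD i P)
    (fun i => (hd i).differentiable one_ne_zero) (fun i => hper.partialD i) ?_
  exact integrableOn_cell (continuous_finsetSum _ fun i _ => continuous_partialD (hd i) i)

theorem lap_comp_sub_right {P : E d → ℝ} (y x : E d) :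
    lap (fun x => P (x - y)) x = lap P (x - y) := by
  unfold lap
  have : ∀ i, partialD i (fun x => P (x - y)) = fun x => partialD i P (x - y) :=
    fun i => funext fun x => partialD_comp_sub_right i y x
  simp only [this, partialD_comp_sub_right]

theorem lap_comp_sub_left {P : E d → ℝ} (hP : ContDiff ℝ 2 P) (x y : E d) :
    lap (fun y => P (x - y)) y = lap P (x - y) := by
  unfold lap
  have hd : ∀ i, ContDiff ℝ 1 (partialD i P) := fun i =>
    (hP.fderiv_right (m := 1) (by norm_num)).clm_apply contDiff_const
  have : ∀ i, partialD i (fun y => P (x - y)) = fun y => -partialD i P (x - y) :=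
    fun i => funext fun y => partialD_comp_sub_left (hP.differentiable (by norm_num)) i x y
  refine Finset.sum_congr rfl fun i _ => ?_
  rw [this]
  have h := partialD_comp_sub_left ((hd i).differentiable one_ne_zero) i x y
  unfold partialD at h ⊢
  rw [fderiv_fun_neg]
  simp only [neg_apply] at h ⊢
  rw [h, neg_neg]

theorem IsPeriodic.comp_sub_right {P : E d → ℝ} (hP : IsPeriodic L P) (y : E d) :
    IsPeriodic L fun x => P (x - y) := fun x i => by
  have := hP (x - y) i
  rwa [sub_add_eq_add_sub] at this

theorem IsPeriodic.comp_sub_left {P : E d → ℝ} (hP : IsPeriodic L P) (x : E d) :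
    IsPeriodic L fun y => P (x - y) := fun y i => by
  have := hP (x - (y + EuclideanSpace.single i L)) i
  rw [show x - (y + EuclideanSpace.single i L) + EuclideanSpace.single i L = x - y by abel] at this
  exact this.symm

theorem contDiff_partialD {P : E d → ℝ} (hP : ContDiff ℝ 2 P) (i : Fin d) :
    ContDiff ℝ 1 (partialD i P) :=
  (hP.fderiv_right (m := 1) (by norm_num)).clm_apply contDiff_const

theorem continuous_lap {P : E d → ℝ} (hP : ContDiff ℝ 2 P) : Continuous (lap P) :=
  continuous_finsetSum _ fun i _ => continuous_partialD (contDiff_partialD hP i) i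

/-- Integration by parts against a translate of a smooth periodic potential. -/
theorem sum_integral_partialD_mul (hL : 0 < L) {P ψ : E d → ℝ} (hP : ContDiff ℝ 2 P)
    (hper : IsPeriodic L P) (hψ : ContDiff ℝ 1 ψ) (hψp : IsPeriodic L ψ) (y : E d) :
    ∑ i, ∫ x in cell d L, partialD i ψ x * partialD i P (x - y) =
      -∫ x in cell d L, ψ x * lap P (x - y) := by
  have hc : ∀ i, Continuous fun x => partialD i ψ x * partialD i P (x - y) := fun i =>
    (continuous_partialD hψ i).mul
      ((contDiff_partialD hP i).continuous.comp (continuous_id.sub continuous_const))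
  have hc2 : Continuous fun x => ψ x * lap P (x - y) :=
    hψ.continuous.mul ((continuous_lap hP).comp (continuous_id.sub continuous_const))
  have hdP : ∀ i, Differentiable ℝ fun x => partialD i P (x - y) := fun i =>
    ((contDiff_partialD hP i).differentiable one_ne_zero).comp
      (differentiable_id.sub_const y)
  have hdiv : ∀ x, divergence (fun i x => ψ x * partialD i P (x - y)) x =
      (∑ i, partialD i ψ x * partialD i P (x - y)) + ψ x * lap P (x - y) := fun x => by
    unfold divergence lap
    rw [Finset.mul_sum, ← Finset.sum_add_distrib]
    refine Finset.sum_congr rfl fun i _ => ?_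
    rw [partialD_mul (hψ.differentiable one_ne_zero x) (hdP i x), partialD_comp_sub_right]
  have hcdiv : Continuous (divergence (fun i x => ψ x * partialD i P (x - y))) := by
    have : divergence (fun i x => ψ x * partialD i P (x - y)) = fun x =>
      (∑ i, partialD i ψ x * partialD i P (x - y)) + ψ x * lap P (x - y) := funext hdiv
    rw [this]
    exact (continuous_finsetSum _ fun i _ => hc i).add hc2
  have h := integral_divergence_eq_zero hL (F := fun i x => ψ x * partialD i P (x - y))
    (fun i => (hψ.differentiable one_ne_zero).mul (hdP i))
    (fun i x j => by simp only [hψp x j, (hper.partialD i).comp_sub_right y x j])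
    (integrableOn_cell hcdiv)
  simp only [hdiv] at h
  rw [integral_add (integrableOn_cell (continuous_finsetSum _ fun i _ => hc i))
    (integrableOn_cell hc2), integral_finsetSum _ fun i _ => integrableOn_cell (hc i)] at h
  linarith

/-- By Fubini and integration by parts the sum is −∫ a N with N y = ∫ ψ x ΔP(x − y) dx. Since ΔP(x −
y) has mean zero in x, N is unchanged when c₁ is subtracted from ψ; since it has mean zero in y, ∫ N
= 0 and c₂ may be subtracted from a. -/
theorem abs_sum_integral_drift_le_of_smooth (hL : 0 < L) {P ψ a : E d → ℝ} {M : ℝ}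
    (hP : ContDiff ℝ 2 P) (hper : IsPeriodic L P) (hM : ∀ x, |lap P x| ≤ M)
    (hψ : ContDiff ℝ 1 ψ) (hψp : IsPeriodic L ψ) (ha : IntegrableOn a (cell d L)) (c₁ c₂ : ℝ) :
    |∑ i, ∫ x in cell d L, partialD i ψ x * drift L (fun i => partialD i P) a i x| ≤
      M * (∫ x in cell d L, |ψ x - c₁|) * ∫ y in cell d L, |a y - c₂| := by
  set ν : Measure (E d) := volume.restrict (cell d L) with hν
  have hbd : ∀ {F : E d × E d → ℝ}, Continuous F → (∃ C, ∀ p, |F p| ≤ C) →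
      ∀ {b : E d → ℝ}, Integrable b ν → Integrable (fun p : E d × E d => F p * b p.2) (ν.prod ν) :=
    fun {F} hF ⟨C, hC⟩ {b} hb => (hb.comp_snd ν).bdd_mul hF.aestronglyMeasurable
      (ae_of_all _ hC)
  have hsub : Continuous fun p : E d × E d => p.1 - p.2 := by fun_prop
  have hFi : ∀ i, Integrable (fun p : E d × E d =>
      (partialD i ψ p.1 * partialD i P (p.1 - p.2)) * a p.2) (ν.prod ν) := fun i => by
    refine hbd (F := fun p : E d × E d => partialD i ψ p.1 * partialD i P (p.1 - p.2))
      (((continuous_partialD hψ i).comp continuous_fst).mul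
      ((contDiff_partialD hP i).continuous.comp hsub)) ?_ ha
    obtain ⟨C1, hC1⟩ := (hψp.partialD i).exists_bound hL (continuous_partialD hψ i)
    obtain ⟨C2, hC2⟩ := (hper.partialD i).exists_bound hL (contDiff_partialD hP i).continuous
    refine ⟨C1 * C2, fun p => ?_⟩
    rw [abs_mul]
    exact mul_le_mul (hC1 _) (hC2 _) (abs_nonneg _) ((abs_nonneg _).trans (hC1 0))
  have hcsub : ∀ x, Continuous fun y => lap P (x - y) := fun x =>
    (continuous_lap hP).comp (continuous_const.sub continuous_id)
  have hcsub' : ∀ y, Continuous fun x => lap P (x - y) := fun y =>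
    (continuous_lap hP).comp (continuous_id.sub continuous_const)
  have hzero1 : ∀ y, ∫ x in cell d L, lap P (x - y) = 0 := fun y => by
    simp only [← lap_comp_sub_right]
    exact integral_lap_eq_zero hL (hP.comp (contDiff_id.sub contDiff_const))
      (hper.comp_sub_right y)
  have hzero2 : ∀ x, ∫ y in cell d L, lap P (x - y) = 0 := fun x => by
    simp only [← lap_comp_sub_left hP]
    exact integral_lap_eq_zero hL (hP.comp (contDiff_const.sub contDiff_id))
      (hper.comp_sub_left x)
  set N : E d → ℝ := fun y => ∫ x in cell d L, ψ x * lap P (x - y) with hN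
  have hNi : Integrable (fun p : E d × E d => ψ p.1 * lap P (p.1 - p.2)) (ν.prod ν) := by
    have := hbd (F := fun p : E d × E d => ψ p.1 * lap P (p.1 - p.2))
      ((hψ.continuous.comp continuous_fst).mul ((continuous_lap hP).comp hsub)) (by
        obtain ⟨C1, hC1⟩ := hψp.exists_bound hL hψ.continuous
        refine ⟨C1 * M, fun p => ?_⟩
        rw [abs_mul]
        exact mul_le_mul (hC1 _) (hM _) (abs_nonneg _) ((abs_nonneg _).trans (hC1 0)))
      (b := fun _ => 1) (integrable_const _)
    simpa using this
  have hNint : Integrable N ν := hNi.integral_prod_right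
  have hNbd : ∀ y, |N y| ≤ M * ∫ x in cell d L, |ψ x - c₁| := fun y => by
    have h1 : N y = ∫ x in cell d L, (ψ x - c₁) * lap P (x - y) := by
      simp only [sub_mul]
      rw [integral_sub (f := fun x => ψ x * lap P (x - y)) (g := fun x => c₁ * lap P (x - y))
        (integrableOn_cell (hψ.continuous.mul (hcsub' y)))
        (integrableOn_cell (continuous_const.mul (hcsub' y))), integral_const_mul, hzero1]
      simp [hN]
    rw [h1, ← integral_const_mul]
    have hcψ : Continuous fun x => |ψ x - c₁| := (hψ.continuous.sub continuous_const).abs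
    refine abs_integral_le_of_abs_le (g := fun x => M * |ψ x - c₁|)
      (integrableOn_cell (continuous_const.mul hcψ)) fun x => ?_
    rw [abs_mul, mul_comm]
    exact mul_le_mul_of_nonneg_right (hM _) (abs_nonneg _)
  have hNzero : ∫ y in cell d L, N y = 0 := by
    simp only [hN]
    rw [integral_integral_swap (f := fun y x => ψ x * lap P (x - y)) hNi.swap]
    simp only [integral_const_mul]
    simp only [hν, hzero2, mul_zero, integral_zero]
  have hNa : Integrable (fun y => a y * N y) ν :=
    ha.mul_bdd hNint.aestronglyMeasurable (ae_of_all _ hNbd)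
  have hmain : ∑ i, ∫ x in cell d L, partialD i ψ x * drift L (fun i => partialD i P) a i x =
      -∫ y in cell d L, (a y - c₂) * N y := by
    have h1 : ∀ i, ∫ x in cell d L, partialD i ψ x * drift L (fun i => partialD i P) a i x =
        ∫ y in cell d L, (∫ x in cell d L, partialD i ψ x * partialD i P (x - y)) * a y := by
      intro i
      unfold drift
      simp only [← integral_const_mul, ← integral_mul_const, ← mul_assoc]
      exact integral_integral_swap (hFi i)
    simp only [h1]
    rw [← integral_finsetSum]
    · simp only [← Finset.sum_mul, sum_integral_partialD_mul hL hP hper hψ hψp, sub_mul]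
      rw [integral_sub hNa (hNint.const_mul _), integral_const_mul, hNzero, mul_zero, sub_zero,
        ← integral_neg]
      refine integral_congr_ae (ae_of_all _ fun y => ?_)
      simp only [hN]
      ring
    · intro i _
      simpa only [integral_mul_const] using (hFi i).integral_prod_right
  rw [hmain, abs_neg, ← integral_const_mul]
  refine abs_integral_le_of_abs_le
    (by exact (ha.sub (integrable_const c₂)).abs.const_mul _) fun y => ?_
  rw [abs_mul, mul_comm]
  exact mul_le_mul_of_nonneg_right (hNbd y) (abs_nonneg _)

theorem tendsto_drift {P : ℕ → E d → ℝ} {C : ℝ} {g : Fin d → E d → ℝ}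
    (hP : ∀ n, ContDiff ℝ ∞ (P n)) (hC : ∀ n i x, |partialD i (P n) x| ≤ C)
    (hlim : ∀ᵐ x, ∀ i, Tendsto (fun n => partialD i (P n) x) atTop (𝓝 (g i x)))
    {a : E d → ℝ} (ha : IntegrableOn a (cell d L)) (i : Fin d) (x : E d) :
    Tendsto (fun n => drift L (fun i => partialD i (P n)) a i x) atTop (𝓝 (drift L g a i x)) := by
  refine tendsto_integral_of_dominated_convergence (fun y => C * |a y|) (fun n => ?_)
    (ha.abs.const_mul C) (fun n => ae_of_all _ fun y => ?_) ?_
  · exact (((continuous_partialD ((hP n).of_le (by norm_cast)) i).comp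
      (continuous_const.sub continuous_id)).aestronglyMeasurable).mul ha.aestronglyMeasurable
  · rw [norm_mul, Real.norm_eq_abs, Real.norm_eq_abs]
    exact mul_le_mul_of_nonneg_right (hC _ _ _) (abs_nonneg _)
  · have h := ((Measure.measurePreserving_sub_left volume x).quasiMeasurePreserving.ae hlim)
    filter_upwards [ae_restrict_of_ae h] with y hy
    exact (hy i).mul_const _

theorem IsPeriodic.drift {g : Fin d → E d → ℝ} (hg : ∀ i, IsPeriodic L (g i)) (a : E d → ℝ)
    (i : Fin d) : IsPeriodic L (drift L g a i) := fun x j => by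
  unfold GraphopMcKeanVlasov.drift
  exact integral_congr_ae (ae_of_all _ fun y => by simp only [(hg i).comp_sub_right y x j])

/-- Inherited from the smooth approximations, whose drifts converge at every point; the chosen
representative of the weak gradient need not be periodic. -/
theorem Potential.isPeriodic_drift (hL : 0 < L) (D : Potential d L) {a : E d → ℝ}
    (ha : IntegrableOn a (cell d L)) (i : Fin d) : IsPeriodic L (drift L D.grad a i) := by
  obtain ⟨P, C, hP, hper, hC, -, hlim⟩ := D.exists_smooth_approx hL
  intro x j
  refine tendsto_nhds_unique (tendsto_drift hP hC hlim ha i _)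
    ((tendsto_drift hP hC hlim ha i x).congr fun n => ?_)
  exact (IsPeriodic.drift (fun i => (hper n).partialD i) a i x j).symm

/-- The interaction estimate: the constants `c₁` and `c₂` may be subtracted since `ΔD` has mean
zero on the torus. -/
theorem Potential.abs_sum_integral_drift_le (hL : 0 < L) (D : Potential d L) {ψ a : E d → ℝ}
    (hψ : ContDiff ℝ 1 ψ) (hψp : IsPeriodic L ψ) (ha : IntegrableOn a (cell d L)) (c₁ c₂ : ℝ) :
    |∑ i, ∫ x in cell d L, partialD i ψ x * drift L D.grad a i x| ≤
      D.lapNorm * (∫ x in cell d L, |ψ x - c₁|) * ∫ y in cell d L, |a y - c₂| := by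
  obtain ⟨P, C, hP, hper, hC, hM, hlim⟩ := D.exists_smooth_approx hL
  have hP1 : ∀ n, ContDiff ℝ 1 (P n) := fun n => (hP n).of_le (by norm_cast)
  have hlim2 : Tendsto (fun n => ∑ i, ∫ x in cell d L, partialD i ψ x *
      drift L (fun i => partialD i (P n)) a i x) atTop
      (𝓝 (∑ i, ∫ x in cell d L, partialD i ψ x * drift L D.grad a i x)) := by
    refine tendsto_finsetSum _ fun i _ => ?_
    refine tendsto_integral_of_dominated_convergence
      (fun x => |partialD i ψ x| * (C * ∫ y in cell d L, |a y|)) (fun n => ?_) ?_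
      (fun n => ae_of_all _ fun x => ?_) (ae_of_all _ fun x => ?_)
    · refine (continuous_partialD hψ i).aestronglyMeasurable.mul ?_
      have h : AEStronglyMeasurable (fun p : E d × E d => partialD i (P n) (p.1 - p.2) * a p.2)
          ((volume.restrict (cell d L)).prod (volume.restrict (cell d L))) :=
        ((continuous_partialD (hP1 n) i).comp
          (continuous_fst.sub continuous_snd)).aestronglyMeasurable.mul
          ha.aestronglyMeasurable.comp_snd
      exact h.integral_prod_right'
    · exact (integrableOn_cell (continuous_partialD hψ i)).abs.mul_const _
    · rw [norm_mul, Real.norm_eq_abs]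
      refine mul_le_mul_of_nonneg_left ?_ (abs_nonneg _)
      rw [← integral_const_mul]
      refine norm_integral_le_of_norm_le (ha.abs.const_mul C) (ae_of_all _ fun y => ?_)
      rw [norm_mul, Real.norm_eq_abs, Real.norm_eq_abs]
      exact mul_le_mul_of_nonneg_right (hC _ _ _) (abs_nonneg _)
    · exact (tendsto_drift hP hC hlim ha i x).const_mul _
  refine le_of_tendsto hlim2.abs (Eventually.of_forall fun n => ?_)
  exact abs_sum_integral_drift_le_of_smooth hL ((hP n).of_le (by norm_cast)) (hper n) (hM n) hψ
    hψp ha c₁ c₂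

end Drift

/-! ### Entropy production for the regularized entropy -/

section Production

variable {d : ℕ} {L : ℝ}

/-- The map r ↦ r − ε log (r + ε) has derivative r/(r + ε), which lies in [0, 1]. It occurs because
v ∇log (v + ε) is the gradient of v − ε log (v + ε). -/
theorem abs_sub_log_sub_le {ε r s : ℝ} (hε : 0 < ε) (hr : 0 ≤ r) (hs : 0 ≤ s) :
    |(r - ε * Real.log (r + ε)) - (s - ε * Real.log (s + ε))| ≤ |r - s| := by
  wlog h : s ≤ r generalizing r s with H
  · rw [abs_sub_comm, abs_sub_comm r s]
    exact H hs hr (le_of_not_ge h)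
  have hr' : 0 < r + ε := by linarith
  have hs' : 0 < s + ε := by linarith
  have h1 : Real.log (s + ε) ≤ Real.log (r + ε) := Real.log_le_log hs' (by linarith)
  have h2 : Real.log (r + ε) - Real.log (s + ε) ≤ (r - s) / (s + ε) := by
    rw [← Real.log_div hr'.ne' hs'.ne']
    refine (Real.log_le_sub_one_of_pos (by positivity)).trans_eq ?_
    field_simp
    ring
  have h3 : ε * ((r - s) / (s + ε)) ≤ r - s := by
    rw [← mul_div_assoc, div_le_iff₀ hs']
    nlinarith
  have h4 := mul_le_mul_of_nonneg_left h2 hε.le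
  have h5 := mul_le_mul_of_nonneg_left h1 hε.le
  rw [abs_of_nonneg (sub_nonneg.2 h), abs_le]
  constructor <;> linarith

theorem partialD_add {f g : E d → ℝ} {i : Fin d} {x : E d} (hf : DifferentiableAt ℝ f x)
    (hg : DifferentiableAt ℝ g x) :
    partialD i (fun y => f y + g y) x = partialD i f x + partialD i g x := by
  unfold partialD
  rw [fderiv_fun_add hf hg]
  rfl

theorem partialD_const_mul {f : E d → ℝ} {i : Fin d} {x : E d} (c : ℝ)
    (hf : DifferentiableAt ℝ f x) :
    partialD i (fun y => c * f y) x = c * partialD i f x := by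
  unfold partialD
  rw [fderiv_const_mul hf]
  rfl

theorem partialD_comp {f : E d → ℝ} {φ : ℝ → ℝ} {φ' : ℝ} {i : Fin d} {x : E d}
    (hf : DifferentiableAt ℝ f x) (hφ : HasDerivAt φ φ' (f x)) :
    partialD i (fun y => φ (f y)) x = φ' * partialD i f x := by
  unfold partialD
  have := (hφ.comp_hasFDerivAt x hf.hasFDerivAt).fderiv
  rw [show (fun y => φ (f y)) = φ ∘ f from rfl, this]
  rfl

/-- The entropy production identity for the regularized entropy. -/
theorem integral_log_mul_eq (hL : 0 < L) {κ ε : ℝ} (hε : 0 < ε) {v w : E d → ℝ}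
    {V : Fin d → E d → ℝ} (hv : ContDiff ℝ 2 v) (hper : IsPeriodic L v) (h0 : ∀ x, 0 ≤ v x)
    (hVper : ∀ i, IsPeriodic L (V i)) (hflux : ∀ i, Differentiable ℝ fun y => v y * V i y)
    (hw : Continuous w) (heq : ∀ x, w x = κ * divergence (fun i y => v y * V i y) x + lap v x)
    (c : ℝ) :
    ∫ x in cell d L, (Real.log (v x + ε) - c) * w x =
      -(∑ i, ∫ x in cell d L, partialD i v x ^ 2 / (v x + ε)) -
        κ * ∑ i, ∫ x in cell d L, partialD i (fun y => v y - ε * Real.log (v y + ε)) x * V i x := by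
  have hpos : ∀ x, 0 < v x + ε := fun x => by linarith [h0 x]
  have hv1 : ContDiff ℝ 1 v := hv.of_le (by norm_num)
  have hdv : Differentiable ℝ v := hv.differentiable (by norm_num)
  have hcv := hv.continuous
  have hclog : Continuous fun x => Real.log (v x + ε) :=
    (hcv.add continuous_const).log fun x => (hpos x).ne'
  have hχd : Differentiable ℝ fun x => Real.log (v x + ε) - c := fun x =>
    ((hdv x).add_const ε).log (hpos x).ne' |>.sub_const c
  have hχp : ∀ i x, partialD i (fun x => Real.log (v x + ε) - c) x = partialD i v x / (v x + ε) :=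
    fun i x => by
      rw [partialD_comp (φ := fun r => Real.log (r + ε) - c) (hdv x)
        ((((hasDerivAt_id (v x)).add_const ε).log (hpos x).ne').sub_const c)]
      simp [div_eq_inv_mul]
  -- Writing the interaction integrand with a pure gradient is what makes the integration by parts
  -- of the drift estimate applicable.
  have hψp : ∀ i x, partialD i (fun y => v y - ε * Real.log (v y + ε)) x * V i x =
      partialD i v x / (v x + ε) * (v x * V i x) := fun i x => by
    rw [partialD_comp (φ := fun r => r - ε * Real.log (r + ε)) (hdv x)
      ((hasDerivAt_id (v x)).sub
        ((((hasDerivAt_id (v x)).add_const ε).log (hpos x).ne').const_mul ε))]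
    have := (hpos x).ne'
    simp only [id]
    field_simp
    ring
  -- The identity is the vanishing of ∫ div G, where G is the entropy variable times the total flux.
  let G : Fin d → E d → ℝ := fun i x =>
    (Real.log (v x + ε) - c) * (κ * (v x * V i x) + partialD i v x)
  have hpd : ∀ i, Differentiable ℝ (partialD i v) := fun i =>
    (contDiff_partialD hv i).differentiable one_ne_zero
  have hinner : ∀ i, Differentiable ℝ fun x => κ * (v x * V i x) + partialD i v x := fun i =>
    ((hflux i).const_mul κ).add (hpd i)
  have hGd : ∀ i, Differentiable ℝ (G i) := fun i => hχd.mul (hinner i)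
  have hGper : ∀ i, IsPeriodic L (G i) := fun i x j => by
    simp only [G, hper x j, hVper i x j, (hper.partialD i) x j]
  have hdiv : ∀ x, divergence G x = (Real.log (v x + ε) - c) * w x +
      ((∑ i, partialD i v x ^ 2 / (v x + ε)) +
        κ * ∑ i, partialD i v x / (v x + ε) * (v x * V i x)) := fun x => by
    rw [heq]
    unfold divergence lap
    rw [mul_add, Finset.mul_sum, Finset.mul_sum, Finset.mul_sum, Finset.mul_sum,
      ← Finset.sum_add_distrib, ← Finset.sum_add_distrib, ← Finset.sum_add_distrib]
    refine Finset.sum_congr rfl fun i _ => ?_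
    rw [partialD_mul (hχd x) (hinner i x), hχp,
      partialD_add (((hflux i).const_mul κ) x) (hpd i x), partialD_const_mul κ (hflux i x)]
    ring
  have hcp : ∀ i, Continuous (partialD i v) := fun i => continuous_partialD hv1 i
  have c1 : Continuous fun x => (Real.log (v x + ε) - c) * w x := (hclog.sub continuous_const).mul hw
  have c2 : ∀ i, Continuous fun x => partialD i v x ^ 2 / (v x + ε) := fun i =>
    ((hcp i).pow 2).div (hcv.add continuous_const) fun x => (hpos x).ne'
  have c3 : ∀ i, Continuous fun x => partialD i v x / (v x + ε) * (v x * V i x) := fun i =>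
    ((hcp i).div (hcv.add continuous_const) fun x => (hpos x).ne').mul (hflux i).continuous
  have c2' := continuous_finsetSum Finset.univ fun i _ => c2 i
  have c3' := continuous_finsetSum Finset.univ fun i _ => c3 i
  have hcdiv : Continuous (divergence G) := by
    rw [show divergence G = _ from funext hdiv]
    exact c1.add (c2'.add (continuous_const.mul c3'))
  have h := integral_divergence_eq_zero hL hGd hGper (integrableOn_cell hcdiv)
  simp only [hdiv] at h
  have c4 : Continuous fun x => κ * ∑ i, partialD i v x / (v x + ε) * (v x * V i x) :=
    continuous_const.mul c3'
  have c5 : Continuous fun x => (∑ i, partialD i v x ^ 2 / (v x + ε)) +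
      κ * ∑ i, partialD i v x / (v x + ε) * (v x * V i x) := c2'.add c4
  rw [integral_add (integrableOn_cell c1) (integrableOn_cell c5),
    integral_add (integrableOn_cell c2') (integrableOn_cell c4), integral_const_mul,
    integral_finsetSum _ fun i _ => integrableOn_cell (c2 i),
    integral_finsetSum _ fun i _ => integrableOn_cell (c3 i)] at h
  simp only [hψp]
  linarith

/-- The relative entropy of `v + ε` with respect to `ρ_∞ + ε`. -/
noncomputable def regEntropy (L ε : ℝ) (v : E d → ℝ) : ℝ :=
  ∫ x in cell d L, (v x + ε) * Real.log ((v x + ε) / (1 / L ^ d + ε))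

/-- With w = ∂_t v the left side is the time derivative of `regEntropy`. The logarithmic Sobolev
inequality is applied to v + ε, whose mean is exactly ρ_∞ + ε, so the regularization leaves no error
term. -/
theorem entropy_production_le (hL : 0 < L) (D : Potential d L) {κ ε : ℝ} (hκ : 0 < κ) (hε : 0 < ε)
    {v w a : E d → ℝ} (hv : ContDiff ℝ 2 v) (hper : IsPeriodic L v) (h0 : ∀ x, 0 ≤ v x)
    (hmass : ∫ x in cell d L, v x = 1) (ha : IntegrableOn a (cell d L))
    (hflux : ∀ i, Differentiable ℝ fun y => v y * drift L D.grad a i y) (hw : Continuous w)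
    (heq : ∀ x, w x = κ * divergence (fun i y => v y * drift L D.grad a i y) x + lap v x)
    (c : ℝ) :
    ∫ x in cell d L, (Real.log ((v x + ε) / (1 / L ^ d + ε)) + 1) * w x ≤
      -(4 * Real.pi ^ 2 / L ^ 2) * regEntropy L ε v +
        κ * D.lapNorm * (∫ x in cell d L, |v x - 1 / L ^ d|) * ∫ x in cell d L, |a x - c| := by
  have hLd : 0 < L ^ d := by positivity
  have hpos : ∀ x, 0 < v x + ε := fun x => by linarith [h0 x]
  have hρ : 0 < 1 / L ^ d + ε := by positivity
  have hcv := hv.continuous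
  have hlog : ∀ x, Real.log ((v x + ε) / (1 / L ^ d + ε)) =
      Real.log (v x + ε) - Real.log (1 / L ^ d + ε) := fun x =>
    Real.log_div (hpos x).ne' hρ.ne'
  have hclog : Continuous fun x => Real.log (v x + ε) :=
    (hcv.add continuous_const).log fun x => (hpos x).ne'
  have h1 := integral_log_mul_eq hL (κ := κ) hε hv hper h0
    (fun i => D.isPeriodic_drift hL ha i) hflux hw heq (Real.log (1 / L ^ d + ε) - 1)
  have hLHS : ∫ x in cell d L, (Real.log ((v x + ε) / (1 / L ^ d + ε)) + 1) * w x =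
      ∫ x in cell d L, (Real.log (v x + ε) - (Real.log (1 / L ^ d + ε) - 1)) * w x := by
    refine integral_congr_ae (ae_of_all _ fun x => ?_)
    simp only [hlog]
    ring
  have hmass' : ∫ x in cell d L, (v x + ε) = L ^ d * (1 / L ^ d + ε) := by
    rw [integral_add (integrableOn_cell hcv) (integrableOn_cell continuous_const), hmass,
      setIntegral_cell_const hL]
    field_simp
  have hE : regEntropy L ε v = (∫ x in cell d L, (v x + ε) * Real.log (v x + ε)) -
      L ^ d * (1 / L ^ d + ε) * Real.log (1 / L ^ d + ε) := by
    unfold regEntropy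
    have k1 : Continuous fun x => (v x + ε) * Real.log (v x + ε) :=
      (hcv.add continuous_const).mul hclog
    have k2 : Continuous fun x => (v x + ε) * Real.log (1 / L ^ d + ε) :=
      (hcv.add continuous_const).mul continuous_const
    rw [← hmass', ← integral_mul_const, ← integral_sub (integrableOn_cell k1)
      (integrableOn_cell k2)]
    refine integral_congr_ae (ae_of_all _ fun x => ?_)
    simp only [hlog]
    ring
  have hv1 : ContDiff ℝ 1 v := hv.of_le (by norm_num)
  have hlsi := logSobolev_cell hL (u := fun x => v x + ε) (hv1.add contDiff_const)
    (fun x i => by simp only [hper x i]) hpos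
  have hpd : ∀ i x, partialD i (fun x => v x + ε) x = partialD i v x := fun i x => by
    unfold partialD; rw [fderiv_add_const]
  rw [hmass', mul_div_cancel_left₀ _ hLd.ne', ← hE] at hlsi
  simp only [hpd] at hlsi
  have hdiss : 4 * Real.pi ^ 2 / L ^ 2 * regEntropy L ε v ≤
      ∑ i, ∫ x in cell d L, partialD i v x ^ 2 / (v x + ε) := by
    have := mul_le_mul_of_nonneg_left hlsi
      (by positivity : 0 ≤ 4 * Real.pi ^ 2 / L ^ 2)
    refine this.trans_eq ?_
    have hpi := Real.pi_ne_zero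
    field_simp
  have hψ : ContDiff ℝ 1 fun y => v y - ε * Real.log (v y + ε) :=
    hv1.sub (contDiff_const.mul ((hv1.add contDiff_const).log fun x => (hpos x).ne'))
  -- The constant c₁ is the value of r − ε log (r + ε) at ρ_∞, so the Lipschitz bound turns the
  -- first factor into the L¹ distance to ρ_∞.
  have hint := D.abs_sum_integral_drift_le hL hψ (fun x i => by simp only [hper x i]) ha
    (1 / L ^ d - ε * Real.log (1 / L ^ d + ε)) c
  have hM : 0 ≤ D.lapNorm := ENNReal.toReal_nonneg
  have hle : ∫ x in cell d L,
      |v x - ε * Real.log (v x + ε) - (1 / L ^ d - ε * Real.log (1 / L ^ d + ε))| ≤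
      ∫ x in cell d L, |v x - 1 / L ^ d| :=
    setIntegral_mono
      (integrableOn_cell ((hψ.continuous.sub continuous_const).abs))
      (integrableOn_cell ((hcv.sub continuous_const).abs))
      fun x => abs_sub_log_sub_le hε (h0 x) (by positivity)
  have hA : 0 ≤ ∫ x in cell d L, |a x - c| := integral_nonneg fun _ => abs_nonneg _
  have hint2 := (neg_le_abs _).trans (hint.trans (mul_le_mul_of_nonneg_right
    (mul_le_mul_of_nonneg_left hle hM) hA))
  have hint3 := mul_le_mul_of_nonneg_left hint2 hκ.le
  rw [hLHS, h1]
  linarith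

/-! ### Parametric integrals over the torus -/

theorem continuousOn_setIntegral_cell {g : ℝ → E d → ℝ}
    (hg : ContinuousOn (fun p : ℝ × E d => g p.1 p.2) (Ici 0 ×ˢ univ)) :
    ContinuousOn (fun t => ∫ x in cell d L, g t x) (Ici 0) := by
  have h1 : Continuous fun p : ℝ × E d => g (max p.1 0) p.2 :=
    hg.comp_continuous (f := fun p : ℝ × E d => (max p.1 0, p.2)) (by fun_prop)
      fun p => ⟨mem_Ici.2 (le_max_right _ _), mem_univ _⟩
  have h2 : Continuous fun t : ℝ => ∫ x in cell d L, g (max t 0) x :=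
    continuous_parametric_integral_of_continuous h1 (isCompact_cell d L)
  refine h2.continuousOn.congr fun t ht => ?_
  simp only [max_eq_left (mem_Ici.1 ht)]

theorem hasDerivAt_setIntegral_cell {g g' : ℝ → E d → ℝ}
    (hg : ContinuousOn (fun p : ℝ × E d => g p.1 p.2) (Ici 0 ×ˢ univ))
    (hd : ∀ t, 0 < t → ∀ x, HasDerivAt (fun s => g s x) (g' t x) t)
    (hg' : ContinuousOn (fun p : ℝ × E d => g' p.1 p.2) (Ioi 0 ×ˢ univ)) {t : ℝ} (ht : 0 < t) :
    HasDerivAt (fun s => ∫ x in cell d L, g s x) (∫ x in cell d L, g' t x) t := by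
  have hslice : ∀ s, 0 ≤ s → Continuous (g s) := fun s hs =>
    hg.comp_continuous (f := fun x : E d => (s, x)) (by fun_prop) fun x => ⟨hs, mem_univ _⟩
  have hslice' : ∀ s, 0 < s → Continuous (g' s) := fun s hs =>
    hg'.comp_continuous (f := fun x : E d => (s, x)) (by fun_prop) fun x => ⟨hs, mem_univ _⟩
  have hsub : ∀ s ∈ Metric.ball t (t / 2), s ∈ Icc (t / 2) (2 * t) := fun s hs => by
    rw [Metric.mem_ball, Real.dist_eq, abs_lt] at hs
    constructor <;> linarith
  obtain ⟨C, hC⟩ := ((isCompact_Icc (a := t / 2) (b := 2 * t)).prod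
    (isCompact_cell d L)).exists_bound_of_continuousOn
    (hg'.mono (prod_mono (fun s hs => lt_of_lt_of_le (by linarith) hs.1) (subset_univ _)))
  refine (hasDerivAt_integral_of_dominated_loc_of_deriv_le (F := g) (F' := g') (bound := fun _ => C)
    (Metric.ball_mem_nhds t (by linarith : 0 < t / 2)) ?_ (integrableOn_cell (hslice t ht.le))
    (hslice' t ht).aestronglyMeasurable ?_ (integrable_const C) ?_).2
  · filter_upwards [Metric.ball_mem_nhds t (by linarith : 0 < t / 2)] with s hs
    exact (hslice s (by linarith [(hsub s hs).1])).aestronglyMeasurable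
  · filter_upwards [ae_restrict_mem (measurableSet_cell d L)] with x hx s hs
    exact hC (s, x) ⟨hsub s hs, hx⟩
  · exact ae_of_all _ fun x s hs => hd s (by linarith [(hsub s hs).1]) x

/-- Integrated form of a linear differential inequality. -/
theorem le_of_deriv_le_linear {h h' b : ℝ → ℝ} {γ : ℝ} (hc : ContinuousOn h (Ici 0))
    (hd : ∀ t, 0 < t → HasDerivAt h (h' t) t) (hb : ContinuousOn b (Ici 0))
    (hle : ∀ t, 0 < t → h' t ≤ -γ * h t + b t) {t : ℝ} (ht : 0 ≤ t) :
    h t ≤ Real.exp (-γ * t) * (h 0 + ∫ s in 0..t, Real.exp (γ * s) * b s) := by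
  -- Continuous extension of b to negative times, so that its primitive is differentiable on (0, ∞)
  -- and continuous at 0.
  let b' : ℝ → ℝ := fun s => Real.exp (γ * s) * b (max s 0)
  have hb' : Continuous b' := (by fun_prop : Continuous fun s : ℝ => Real.exp (γ * s)).mul
    (hb.comp_continuous (by fun_prop) fun s => mem_Ici.2 (le_max_right _ _))
  let F : ℝ → ℝ := fun s => Real.exp (γ * s) * h s - ∫ r in 0..s, b' r
  have hFc : ContinuousOn F (Ici 0) :=
    ((by fun_prop : Continuous fun s : ℝ => Real.exp (γ * s)).continuousOn.mul hc).sub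
      (intervalIntegral.continuous_primitive (fun _ _ => hb'.intervalIntegrable _ _) 0).continuousOn
  have hFd : ∀ s, 0 < s → HasDerivAt F
      (Real.exp (γ * s) * γ * h s + Real.exp (γ * s) * h' s - b' s) s := fun s hs => by
    have h1 : HasDerivAt (fun s : ℝ => Real.exp (γ * s)) (Real.exp (γ * s) * γ) s := by
      simpa using ((hasDerivAt_id s).const_mul γ).exp
    exact (h1.mul (hd s hs)).sub (intervalIntegral.integral_hasDerivAt_right
      (hb'.intervalIntegrable _ _) (hb'.stronglyMeasurableAtFilter _ _) hb'.continuousAt)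
  have hanti : AntitoneOn F (Ici 0) := by
    refine antitoneOn_of_deriv_nonpos (convex_Ici 0) hFc (fun s hs => ?_) fun s hs => ?_ <;>
      rw [interior_Ici] at hs
    · exact (hFd s hs).differentiableAt.differentiableWithinAt
    · rw [(hFd s hs).deriv]
      have := mul_le_mul_of_nonneg_left (hle s hs) (Real.exp_pos (γ * s)).le
      simp only [b', max_eq_left (le_of_lt (mem_Ioi.1 hs))]
      linarith
  have h1 := hanti self_mem_Ici ht ht
  simp only [F, mul_zero, Real.exp_zero, one_mul, intervalIntegral.integral_same, sub_zero] at h1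
  have h2 : ∫ r in 0..t, b' r = ∫ s in 0..t, Real.exp (γ * s) * b s :=
    intervalIntegral.integral_congr fun s hs => by
      rw [uIcc_of_le ht] at hs
      simp only [b', max_eq_left hs.1]
  rw [h2] at h1
  have h3 : Real.exp (γ * t) * h t ≤ h 0 + ∫ s in 0..t, Real.exp (γ * s) * b s := by linarith
  have h4 := mul_le_mul_of_nonneg_left h3 (Real.exp_pos (-γ * t)).le
  rw [← mul_assoc, ← Real.exp_add, neg_mul, neg_add_cancel, Real.exp_zero, one_mul] at h4
  rwa [neg_mul]

end Production

/-! ### Pinsker's inequality -/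

/-- For z > 0, division by 2z(z + 2) gives a lower bound for log z, and the defect has derivative (z
− 1)³/(z²(z + 2)²). -/
theorem three_mul_sub_sq_le {z : ℝ} (hz : 0 ≤ z) :
    3 * (z - 1) ^ 2 ≤ (2 * z + 4) * (z * Real.log z - z + 1) := by
  rcases hz.eq_or_lt with rfl | hz
  · norm_num
  let F : ℝ → ℝ := fun s => Real.log s - (s - 1) * (5 * s + 1) / (2 * s * (s + 2))
  have hF : ∀ s, 0 < s → HasDerivAt F ((s - 1) ^ 3 * (s ^ 2 * (s + 2) ^ 2)⁻¹) s := fun s hs => by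
    have h1 := ((hasDerivAt_id s).sub_const 1).mul (((hasDerivAt_id s).const_mul 5).add_const 1)
    have h2 := ((hasDerivAt_id s).const_mul 2).mul ((hasDerivAt_id s).add_const 2)
    have hne : 2 * s * (s + 2) ≠ 0 := by positivity
    refine HasDerivAt.congr_deriv ((Real.hasDerivAt_log hs.ne').sub (h1.div h2 hne)) ?_
    simp
    field_simp
    ring
  have h := nonneg_of_hasDerivAt_cube_mul (by simp [F]) (fun s hs => by positivity) hF hz
  have h2 := mul_le_mul_of_nonneg_left (sub_nonneg.1 h) (by positivity : 0 ≤ 2 * z * (z + 2))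
  rw [mul_div_cancel₀ _ (by positivity)] at h2
  nlinarith

/-- AM–GM with weight (2z + 4)/3. A free parameter, the same at every point, replaces Cauchy–Schwarz
under the integral in Pinsker's inequality. -/
theorem two_mul_abs_sub_le (lam : ℝ) {z : ℝ} (hz : 0 ≤ z) :
    2 * lam * |z - 1| ≤ lam ^ 2 * ((2 * z + 4) / 3) + (z * Real.log z - z + 1) := by
  have h := three_mul_sub_sq_le hz
  have hA : 0 < (2 * z + 4) / 3 := by positivity
  have h2 : (z - 1) ^ 2 / ((2 * z + 4) / 3) ≤ z * Real.log z - z + 1 := by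
    rw [div_le_iff₀ hA]
    linarith
  have h3 : 2 * lam * |z - 1| ≤ lam ^ 2 * ((2 * z + 4) / 3) + |z - 1| ^ 2 / ((2 * z + 4) / 3) := by
    generalize (2 * z + 4) / 3 = A at hA
    have : lam ^ 2 * A + |z - 1| ^ 2 / A - 2 * lam * |z - 1| = (lam * A - |z - 1|) ^ 2 / A := by
      field_simp
      ring
    have : 0 ≤ (lam * A - |z - 1|) ^ 2 / A := by positivity
    linarith
  rw [sq_abs] at h3
  linarith

/-! ### Relative entropy at a single node -/

section Solution

variable {d : ℕ} {L : ℝ}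

/-- The entropy of a density on the torus relative to the uniform density. -/
noncomputable def relEntropy (L : ℝ) (v : E d → ℝ) : ℝ :=
  ∫ x in cell d L, v x * Real.log (v x / (1 / L ^ d))

theorem continuous_mul_log_div {v : E d → ℝ} (hL : 0 < L) (hv : Continuous v) :
    Continuous fun x => v x * Real.log (v x / (1 / L ^ d)) := by
  have hρ : 0 < 1 / L ^ d := by positivity
  have : (fun x => v x * Real.log (v x / (1 / L ^ d))) = fun x =>
      1 / L ^ d * (v x / (1 / L ^ d) * Real.log (v x / (1 / L ^ d))) := by
    funext x
    field_simp
  rw [this]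
  exact continuous_const.mul (Real.continuous_mul_log.comp (hv.div_const _))

/-- **Pinsker's inequality** on the torus. -/
theorem sq_integral_abs_sub_le (hL : 0 < L) {v : E d → ℝ} (hv : Continuous v)
    (h0 : ∀ x, 0 ≤ v x) (hmass : ∫ x in cell d L, v x = 1) :
    (∫ x in cell d L, |v x - 1 / L ^ d|) ^ 2 ≤ 2 * relEntropy L v := by
  have hLd : 0 < L ^ d := by positivity
  set n := ∫ x in cell d L, |v x - 1 / L ^ d| with hn
  -- The parameter is n/2, with n the L¹ distance itself. The weight integrates to 2, so integration
  -- gives n² ≤ n²/2 + `relEntropy L v`.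
  have hpt : ∀ x, n * |v x - 1 / L ^ d| ≤ (n / 2) ^ 2 * ((2 * v x + 4 * (1 / L ^ d)) / 3) +
      (v x * Real.log (v x / (1 / L ^ d)) - v x + 1 / L ^ d) := fun x => by
    have h1 := mul_le_mul_of_nonneg_left (two_mul_abs_sub_le (n / 2) (z := v x / (1 / L ^ d))
      (div_nonneg (h0 x) (by positivity))) (by positivity : 0 ≤ 1 / L ^ d)
    have h2 : |v x / (1 / L ^ d) - 1| = L ^ d * |v x - 1 / L ^ d| := by
      rw [← abs_of_pos hLd, ← abs_mul, abs_of_pos hLd]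
      congr 1
      field_simp
    rw [h2] at h1
    have e1 : 1 / L ^ d * (2 * (n / 2) * (L ^ d * |v x - 1 / L ^ d|)) =
      n * |v x - 1 / L ^ d| := by field_simp
    rw [e1] at h1
    refine h1.trans_eq ?_
    field_simp
  have hcabs : Continuous fun x => |v x - 1 / L ^ d| := (hv.sub continuous_const).abs
  have c1 := continuous_mul_log_div hL hv
  have c2 : Continuous fun x => (n / 2) ^ 2 * ((2 * v x + 4 * (1 / L ^ d)) / 3) := by fun_prop
  have c3 : Continuous fun x => v x * Real.log (v x / (1 / L ^ d)) - v x := c1.sub hv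
  have c4 : Continuous fun x => v x * Real.log (v x / (1 / L ^ d)) - v x + 1 / L ^ d :=
    c3.add continuous_const
  have c5 : Continuous fun x => 2 * v x := by fun_prop
  have c6 : Continuous fun x => n * |v x - 1 / L ^ d| := continuous_const.mul hcabs
  have c7 : Continuous fun x => (n / 2) ^ 2 * ((2 * v x + 4 * (1 / L ^ d)) / 3) +
    (v x * Real.log (v x / (1 / L ^ d)) - v x + 1 / L ^ d) := c2.add c4
  have h := setIntegral_mono (integrableOn_cell c6 : IntegrableOn _ (cell d L))
    (integrableOn_cell c7) hpt
  rw [integral_const_mul, ← hn, integral_add (integrableOn_cell c2) (integrableOn_cell c4),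
    integral_const_mul, integral_div,
    integral_add (integrableOn_cell c5) (integrableOn_cell continuous_const), integral_const_mul,
    integral_add (integrableOn_cell c3) (integrableOn_cell continuous_const),
    integral_sub (integrableOn_cell c1) (integrableOn_cell hv), hmass,
    setIntegral_cell_const hL, setIntegral_cell_const hL] at h
  unfold relEntropy
  have e1 : L ^ d * (1 / L ^ d) = 1 := by field_simp
  have e2 : L ^ d * (4 * (1 / L ^ d)) = 4 := by field_simp
  rw [e1, e2] at h
  nlinarith

theorem mul_log_div_eq {r ρ ε : ℝ} (hr : 0 ≤ r) (hρ : 0 < ρ) (hε : 0 ≤ ε) :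
    (r + ε) * Real.log ((r + ε) / (ρ + ε)) =
      (r + ε) * Real.log (r + ε) - (r + ε) * Real.log (ρ + ε) := by
  rcases (add_nonneg hr hε).eq_or_lt with h | h
  · simp [← h]
  · rw [Real.log_div h.ne' (by positivity)]
    ring

/-- With the logarithm of the quotient split, the integrand is jointly continuous in (ε, x) up to ε
= 0, even where v vanishes, because s log s is continuous at 0. -/
theorem tendsto_regEntropy (hL : 0 < L) {v : E d → ℝ} (hv : Continuous v) (h0 : ∀ x, 0 ≤ v x) :
    Tendsto (fun ε => regEntropy L ε v) (𝓝[>] 0) (𝓝 (relEntropy L v)) := by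
  have hρ : 0 < 1 / L ^ d := by positivity
  let F : ℝ → E d → ℝ := fun ε x => (v x + max ε 0) * Real.log (v x + max ε 0) -
    (v x + max ε 0) * Real.log (1 / L ^ d + max ε 0)
  have hF : Continuous (Function.uncurry F) := by
    have h1 : Continuous fun p : ℝ × E d => v p.2 + max p.1 0 := by fun_prop
    refine (Real.continuous_mul_log.comp h1).sub (h1.mul ?_)
    exact Continuous.log (by fun_prop) fun p =>
      (add_pos_of_pos_of_nonneg hρ (le_max_right _ _)).ne'
  have hc := continuous_parametric_integral_of_continuous hF (isCompact_cell d L) (μ := volume)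
  have hval : ∀ ε, 0 ≤ ε → ∫ x in cell d L, F ε x = regEntropy L ε v := fun ε hε => by
    unfold regEntropy
    refine integral_congr_ae (ae_of_all _ fun x => ?_)
    simp only [F, max_eq_left hε, mul_log_div_eq (h0 x) hρ hε]
  have hzero : regEntropy L 0 v = relEntropy L v := by simp [regEntropy, relEntropy]
  rw [← hzero, ← hval 0 le_rfl]
  refine Tendsto.congr' ?_ ((hc.tendsto 0).mono_left nhdsWithin_le_nhds)
  filter_upwards [self_mem_nhdsWithin] with ε hε
  exact hval ε (le_of_lt hε)

theorem IsC12.continuousOn_abs {u : ℝ → E d → ℝ} (hu : IsC12 L u) (c : ℝ) :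
    ContinuousOn (fun t => ∫ x in cell d L, |u t x - c|) (Ici 0) :=
  continuousOn_setIntegral_cell (g := fun t x => |u t x - c|)
    (hu.continuousOn.sub continuousOn_const).abs

theorem IsC12.continuous {u : ℝ → E d → ℝ} (hu : IsC12 L u) {t : ℝ} (ht : 0 ≤ t) :
    Continuous (u t) :=
  hu.continuousOn.comp_continuous (f := fun x : E d => (t, x)) (by fun_prop)
    fun x => ⟨ht, mem_univ _⟩

/-- The entropy estimate for a single node of the network, with a prescribed bound `m` for the
oscillation of the aggregated density `a`. -/
theorem relEntropy_le_of_equation (hL : 0 < L) (D : Potential d L) {κ : ℝ} (hκ : 0 < κ)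
    {u a : ℝ → E d → ℝ} {m : ℝ → ℝ} {c : ℝ} (hu : IsC12 L u) (h0 : ∀ t, 0 ≤ t → ∀ x, 0 ≤ u t x)
    (hmass : ∀ t, 0 ≤ t → ∫ x in cell d L, u t x = 1)
    (ha : ∀ t, 0 < t → IntegrableOn (a t) (cell d L))
    (hflux : ∀ t, 0 < t → ∀ i, Differentiable ℝ fun y => u t y * drift L D.grad (a t) i y)
    (heq : ∀ t, 0 < t → ∀ x, deriv (fun s => u s x) t =
      κ * divergence (fun i y => u t y * drift L D.grad (a t) i y) x + lap (u t) x)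
    (hm : ContinuousOn m (Ici 0)) (ham : ∀ t, 0 < t → ∫ x in cell d L, |a t x - c| ≤ m t)
    {t : ℝ} (ht : 0 ≤ t) :
    relEntropy L (u t) ≤ Real.exp (-(4 * Real.pi ^ 2 / L ^ 2) * t) * (relEntropy L (u 0) +
      ∫ s in 0..t, Real.exp (4 * Real.pi ^ 2 / L ^ 2 * s) *
        (κ * D.lapNorm * (∫ x in cell d L, |u s x - 1 / L ^ d|) * m s)) := by
  have hρ : 0 < 1 / L ^ d := by positivity
  have hreg : ∀ ε, 0 < ε → regEntropy L ε (u t) ≤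
      Real.exp (-(4 * Real.pi ^ 2 / L ^ 2) * t) * (regEntropy L ε (u 0) +
      ∫ s in 0..t, Real.exp (4 * Real.pi ^ 2 / L ^ 2 * s) *
        (κ * D.lapNorm * (∫ x in cell d L, |u s x - 1 / L ^ d|) * m s)) := by
    intro ε hε
    have hcb : ContinuousOn (fun s => κ * D.lapNorm * (∫ x in cell d L, |u s x - 1 / L ^ d|) * m s)
        (Ici 0) := (continuousOn_const.mul (hu.continuousOn_abs _)).mul hm
    have hpos : ∀ s, 0 ≤ s → ∀ x, 0 < (u s x + ε) / (1 / L ^ d + ε) := fun s hs x =>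
      div_pos (by linarith [h0 s hs x]) (by positivity)
    have hcu : ContinuousOn (fun p : ℝ × E d => (u p.1 p.2 + ε) / (1 / L ^ d + ε))
        (Ici 0 ×ˢ univ) := (hu.continuousOn.add continuousOn_const).div_const _
    have hclog : ContinuousOn (fun p : ℝ × E d => Real.log ((u p.1 p.2 + ε) / (1 / L ^ d + ε)))
        (Ici 0 ×ˢ univ) := hcu.log fun p hp => (hpos p.1 hp.1 p.2).ne'
    have hcg : ContinuousOn (fun p : ℝ × E d =>
        (u p.1 p.2 + ε) * Real.log ((u p.1 p.2 + ε) / (1 / L ^ d + ε))) (Ici 0 ×ˢ univ) :=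
      (hu.continuousOn.add continuousOn_const).mul hclog
    have hsub : (Ioi (0 : ℝ) ×ˢ (univ : Set (E d))) ⊆ Ici 0 ×ˢ univ :=
      prod_mono Ioi_subset_Ici_self le_rfl
    refine le_of_deriv_le_linear (h := fun s => regEntropy L ε (u s))
      (h' := fun s => ∫ x in cell d L,
        (Real.log ((u s x + ε) / (1 / L ^ d + ε)) + 1) * deriv (fun r => u r x) s)
      (continuousOn_setIntegral_cell hcg) (fun s hs => ?_) hcb (fun s hs => ?_) ht
    · refine hasDerivAt_setIntegral_cell
        (g := fun s x => (u s x + ε) * Real.log ((u s x + ε) / (1 / L ^ d + ε)))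
        (g' := fun s x => (Real.log ((u s x + ε) / (1 / L ^ d + ε)) + 1) * deriv (fun r => u r x) s)
        hcg (fun r hr x => ?_) (((hclog.mono hsub).add continuousOn_const).mul hu.continuousOn_time)
        hs
      have h1 := (hu.differentiableAt_time r hr x).hasDerivAt.add_const ε
      have h2 := h1.mul ((h1.div_const (1 / L ^ d + ε)).log (hpos r hr.le x).ne')
      refine h2.congr_deriv ?_
      have h3 : 0 < u r x + ε := by linarith [h0 r hr.le x]
      have h4 : 0 < 1 / L ^ d + ε := by positivity
      generalize 1 / L ^ d + ε = q at h4 ⊢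
      field_simp
    · have hw : Continuous fun x => deriv (fun r => u r x) s :=
        hu.continuousOn_time.comp_continuous (f := fun x : E d => (s, x)) (by fun_prop)
          fun x => ⟨hs, mem_univ _⟩
      refine (entropy_production_le hL D hκ hε (hu.contDiff_space s hs) (hu.periodic s hs.le)
        (h0 s hs.le) (hmass s hs.le) (ha s hs) (hflux s hs) hw (heq s hs) c).trans ?_
      gcongr
      · exact mul_nonneg (mul_nonneg hκ.le ENNReal.toReal_nonneg)
          (integral_nonneg fun _ => abs_nonneg _)
      · exact ham s hs
  -- Only the two entropies depend on ε; the coupling integral does not.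
  refine le_of_tendsto_of_tendsto (tendsto_regEntropy hL (hu.continuous ht) (h0 t ht))
    (((tendsto_regEntropy hL (hu.continuous le_rfl) (h0 0 le_rfl)).add_const _).const_mul _) ?_
  filter_upwards [self_mem_nhdsWithin] with ε hε
  exact hreg ε hε

end Solution

/-! ### Measurability of Carathéodory functions and Grönwall's inequality -/

/-- Joint measurability in (t, ξ) is not part of a classical solution. By continuity, f is the limit
of its values at the times ⌊s(k + 1)⌋/(k + 1); these are countably many, so the exceptional null
sets can be united. -/
theorem aestronglyMeasurable_of_continuousOn {Ω : Type*} [MeasurableSpace Ω] {μ : Measure Ω}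
    [SFinite μ] {f : ℝ → Ω → ℝ} (hmeas : ∀ s, 0 ≤ s → AEStronglyMeasurable (f s) μ)
    (hcont : ∀ᵐ ξ ∂μ, ContinuousOn (fun s => f s ξ) (Ici 0)) (t : ℝ) :
    AEStronglyMeasurable (fun p : ℝ × Ω => f p.1 p.2) ((volume.restrict (Ioc 0 t)).prod μ) := by
  let τ : ℕ → ℕ → ℝ := fun k j => (j : ℝ) / ((k : ℝ) + 1)
  have hτ : ∀ k j, 0 ≤ τ k j := fun k j => by simp only [τ]; positivity
  let N : ℕ → ℝ → ℕ := fun k s => ⌊s * ((k : ℝ) + 1)⌋₊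
  have hN : ∀ k, Measurable (N k) := fun k =>
    Nat.measurable_floor.comp (measurable_id.mul_const ((k : ℝ) + 1))
  have h' : ∀ k j, ∃ g : Ω → ℝ, StronglyMeasurable g ∧ f (τ k j) =ᵐ[μ] g := fun k j =>
    hmeas (τ k j) (hτ k j)
  choose g hg hfg using h'
  have hgf : ∀ᵐ ξ ∂μ, ∀ k j : ℕ, f (τ k j) ξ = g k j ξ :=
    ae_all_iff.2 fun k => ae_all_iff.2 fun j => hfg k j
  have hF : ∀ k : ℕ, Measurable fun p : ℝ × Ω => g k (N k p.1) p.2 := fun k => by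
    have h1 : Measurable fun q : ℕ × Ω => g k q.1 q.2 :=
      measurable_from_prod_countable_right fun j => (hg k j).measurable
    have h2 : Measurable fun p : ℝ × Ω => (N k p.1, p.2) :=
      ((hN k).comp measurable_fst).prodMk measurable_snd
    exact h1.comp h2
  refine aestronglyMeasurable_of_tendsto_ae atTop (fun k => (hF k).aestronglyMeasurable) ?_
  have h1 : ∀ᵐ p ∂(volume.restrict (Ioc 0 t)).prod μ, p.1 ∈ Ioc (0 : ℝ) t :=
    Measure.quasiMeasurePreserving_fst.ae (ae_restrict_mem measurableSet_Ioc)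
  filter_upwards [h1, Measure.quasiMeasurePreserving_snd.ae hgf,
    Measure.quasiMeasurePreserving_snd.ae hcont] with p hp1 hp2 hp3
  have h2 : Tendsto (fun k : ℕ => τ k (N k p.1)) atTop (𝓝 p.1) :=
    (tendsto_nat_floor_mul_div_atTop hp1.1.le).comp
      (tendsto_atTop_add_const_right _ (1 : ℝ) tendsto_natCast_atTop_atTop)
  have h3 : Tendsto (fun k : ℕ => τ k (N k p.1)) atTop (𝓝[Ici 0] p.1) :=
    tendsto_nhdsWithin_iff.2 ⟨h2, Eventually.of_forall fun k => hτ _ _⟩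
  have h4 : Tendsto (fun s => f s p.2) (𝓝[Ici 0] p.1) (𝓝 (f p.1 p.2)) := hp3 p.1 hp1.1.le
  have h5 := h4.comp h3
  exact h5.congr fun k => hp2 k _

/-- Grönwall for the primitive of q: `le_of_deriv_le_linear` with γ = −β and constant forcing K. -/
theorem integral_le_of_le_add_integral {q : ℝ → ℝ} (hq : Continuous q) {K β : ℝ} (hβ : 0 ≤ β)
    (hle : ∀ s, 0 ≤ s → q s ≤ K + β * ∫ r in 0..s, q r) {t : ℝ} (ht : 0 ≤ t) :
    β * ∫ r in 0..t, q r ≤ K * (Real.exp (β * t) - 1) := by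
  have hint : ∀ a b, IntervalIntegrable q volume a b := fun a b => hq.intervalIntegrable a b
  have h := le_of_deriv_le_linear (h := fun s => ∫ r in 0..s, q r) (h' := q) (b := fun _ => K)
    (γ := -β) (intervalIntegral.continuous_primitive hint 0).continuousOn
    (fun s _ => intervalIntegral.integral_hasDerivAt_right (hint _ _)
      (hq.stronglyMeasurableAtFilter _ _) hq.continuousAt) continuousOn_const
    (fun s hs => by linarith [hle s hs.le]) ht
  have hexp : ∫ s in 0..t, β * Real.exp (-β * s) = 1 - Real.exp (-β * t) := by
    have : ∀ s ∈ uIcc 0 t, HasDerivAt (fun s => -Real.exp (-β * s)) (β * Real.exp (-β * s)) s :=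
      fun s _ => by
        have := ((hasDerivAt_id s).const_mul (-β)).exp.neg
        refine this.congr_deriv ?_
        simp
        ring
    rw [intervalIntegral.integral_eq_sub_of_hasDerivAt this
      ((by fun_prop : Continuous fun s => β * Real.exp (-β * s)).intervalIntegrable _ _)]
    simp
    ring
  simp only [intervalIntegral.integral_same, zero_add, neg_neg] at h
  have h2 := mul_le_mul_of_nonneg_left h hβ
  refine h2.trans_eq ?_
  rw [intervalIntegral.integral_mul_const]
  rw [intervalIntegral.integral_const_mul] at hexp
  calc _ = Real.exp (β * t) * K * (β * ∫ s in 0..t, Real.exp (-β * s)) := by ring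
    _ = K * (Real.exp (β * t) - Real.exp (β * t) * Real.exp (-β * t)) := by rw [hexp]; ring
    _ = _ := by rw [← Real.exp_add]; simp

/-! ### Distances and entropies on the network -/

section Network

variable {d : ℕ} {L : ℝ} {Ω : Type*}

/-- The `L¹` distance of the density at the node `ξ` to the uniform density. -/
noncomputable def l1Dist (L : ℝ) (r : E d → Ω → ℝ) (ξ : Ω) : ℝ :=
  ∫ x in cell d L, |r x ξ - 1 / L ^ d|

theorem l1Dist_nonneg (r : E d → Ω → ℝ) (ξ : Ω) : 0 ≤ l1Dist L r ξ :=
  integral_nonneg fun _ => abs_nonneg _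

theorem IsProbDensity.nonneg_of_continuous {v : E d → ℝ} (h : IsProbDensity L v)
    (hv : Continuous v) (x : E d) : 0 ≤ v x := by
  have h1 : v =ᵐ[volume] fun x => |v x| := h.nonneg.mono fun x hx => (abs_of_nonneg hx).symm
  have h2 := (hv.ae_eq_iff_eq volume hv.abs).1 h1
  rw [h2]
  exact abs_nonneg _

theorem l1Dist_le_two (hL : 0 < L) {r : E d → Ω → ℝ} {ξ : Ω}
    (h : IsProbDensity L fun x => r x ξ) : l1Dist L r ξ ≤ 2 := by
  have h1 : ∫ x in cell d L, (r x ξ + 1 / L ^ d) = 2 := by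
    rw [integral_add h.integrableOn (integrable_const _), h.integral_eq_one,
      setIntegral_cell_const hL]
    have : 0 < L ^ d := by positivity
    field_simp
    norm_num
  rw [← h1]
  refine integral_mono_ae (h.integrableOn.sub (integrable_const _)).abs
    (h.integrableOn.add (integrable_const _)) ?_
  filter_upwards [ae_restrict_of_ae h.nonneg] with x hx
  have : 0 < 1 / L ^ d := by positivity
  change |r x ξ - 1 / L ^ d| ≤ r x ξ + 1 / L ^ d
  rw [abs_le]
  constructor <;> linarith

variable [MeasurableSpace Ω] {μ : Measure Ω} [IsProbabilityMeasure μ]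

theorem aestronglyMeasurable_restrict_cell {r : E d → Ω → ℝ}
    (h : AEStronglyMeasurable (fun p : E d × Ω => r p.1 p.2) (volume.prod μ)) :
    AEStronglyMeasurable (fun p : E d × Ω => r p.1 p.2) ((volume.restrict (cell d L)).prod μ) :=
  h.mono_ac (Measure.absolutelyContinuous_restrict.prod Measure.AbsolutelyContinuous.rfl)

theorem aestronglyMeasurable_l1Dist {r : E d → Ω → ℝ}
    (h : AEStronglyMeasurable (fun p : E d × Ω => r p.1 p.2) (volume.prod μ)) :
    AEStronglyMeasurable (l1Dist L r) μ :=
  ((aestronglyMeasurable_restrict_cell h).sub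
    aestronglyMeasurable_const).norm.prod_swap.integral_prod_right'

/-- The integral operator with kernel `|W|`. -/
noncomputable def absKernelOp (μ : Measure Ω) (W : Ω → Ω → ℝ) (f : Ω → ℝ) (ξ : Ω) : ℝ :=
  ∫ ξ', |W ξ ξ'| * f ξ' ∂μ

theorem aestronglyMeasurable_absKernelOp {W : Ω → Ω → ℝ}
    (hW : AEStronglyMeasurable (Function.uncurry W) (μ.prod μ)) {f : Ω → ℝ}
    (hf : AEStronglyMeasurable f μ) : AEStronglyMeasurable (absKernelOp μ W f) μ :=
  (AEStronglyMeasurable.mul (f := fun p : Ω × Ω => |W p.1 p.2|) (g := fun p : Ω × Ω => f p.2)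
    hW.norm hf.comp_snd).integral_prod_right'

/-- The aggregated density is integrable and its distance to a constant is controlled by the
distances of the node densities to the uniform density. -/
theorem integrableOn_kernelOp {W : Ω → Ω → ℝ} {ξ : Ω} (hWξ : Integrable (W ξ) μ)
    {r : E d → Ω → ℝ} (hr : AEStronglyMeasurable (fun p : E d × Ω => r p.1 p.2) (volume.prod μ))
    (hprob : ∀ᵐ ξ' ∂μ, IsProbDensity L fun x => r x ξ') :
    IntegrableOn (fun y => kernelOp μ W (r y) ξ) (cell d L) ∧
      ∫ y in cell d L, |kernelOp μ W (r y) ξ - (∫ ξ', W ξ ξ' ∂μ) * (1 / L ^ d)| ≤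
        absKernelOp μ W (l1Dist L r) ξ := by
  set ν := volume.restrict (cell d L) with hν
  have hr' := aestronglyMeasurable_restrict_cell (L := L) hr
  have hWm : AEStronglyMeasurable (fun p : E d × Ω => W ξ p.2) (ν.prod μ) :=
    hWξ.aestronglyMeasurable.comp_snd
  have hΦ : Integrable (fun p : E d × Ω => W ξ p.2 * r p.1 p.2) (ν.prod μ) := by
    have hm : AEStronglyMeasurable (fun p : E d × Ω => W ξ p.2 * r p.1 p.2) (ν.prod μ) :=
      hWm.mul hr'
    rw [integrable_prod_iff' hm]
    constructor
    · filter_upwards [hprob] with ξ' h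
      exact h.integrableOn.const_mul _
    · refine hWξ.abs.congr ?_
      filter_upwards [hprob] with ξ' h
      simp only [norm_mul, Real.norm_eq_abs]
      rw [integral_const_mul]
      have : ∫ x in cell d L, |r x ξ'| = 1 := by
        rw [← h.integral_eq_one]
        refine integral_congr_ae ?_
        filter_upwards [ae_restrict_of_ae h.nonneg] with x hx
        exact abs_of_nonneg hx
      rw [this, mul_one]
  have hc : Integrable (fun p : E d × Ω => W ξ p.2 * (1 / L ^ d)) (ν.prod μ) :=
    (hWξ.comp_snd ν).mul_const _
  have hΨ : Integrable (fun p : E d × Ω => W ξ p.2 * (r p.1 p.2 - 1 / L ^ d)) (ν.prod μ) := by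
    refine (hΦ.sub hc).congr (ae_of_all _ fun p => ?_)
    simp only [Pi.sub_apply]
    ring
  refine ⟨hΦ.integral_prod_left, ?_⟩
  have hΨn := hΨ.norm
  have hpt : ∀ᵐ y ∂ν, |kernelOp μ W (r y) ξ - (∫ ξ', W ξ ξ' ∂μ) * (1 / L ^ d)| ≤
      ∫ ξ', ‖W ξ ξ' * (r y ξ' - 1 / L ^ d)‖ ∂μ := by
    filter_upwards [hΦ.prod_right_ae] with y hy
    have : kernelOp μ W (r y) ξ - (∫ ξ', W ξ ξ' ∂μ) * (1 / L ^ d) =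
        ∫ ξ', W ξ ξ' * (r y ξ' - 1 / L ^ d) ∂μ := by
      simp only [mul_sub]
      rw [integral_sub hy (hWξ.mul_const _), integral_mul_const]
      rfl
    rw [this]
    exact norm_integral_le_integral_norm fun ξ' => W ξ ξ' * (r y ξ' - 1 / L ^ d)
  refine (integral_mono_ae (hΦ.integral_prod_left.sub (integrable_const _)).abs
    hΨn.integral_prod_left hpt).trans_eq ?_
  rw [integral_integral_swap hΨn]
  refine integral_congr_ae (ae_of_all _ fun ξ' => ?_)
  simp only [norm_mul, Real.norm_eq_abs, l1Dist, integral_const_mul]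
  rfl

theorem neg_le_mul_log_div {r ρ : ℝ} (hr : 0 ≤ r) (hρ : 0 < ρ) : -ρ ≤ r * Real.log (r / ρ) := by
  rcases hr.eq_or_lt with rfl | hr
  · simpa using hρ.le
  have h := Real.log_le_sub_one_of_pos (div_pos hρ hr)
  have h1 : Real.log (ρ / r) = -Real.log (r / ρ) := by rw [← Real.log_inv, inv_div]
  have h2 := mul_le_mul_of_nonneg_left h hr.le
  rw [h1] at h2
  have h3 : r * (ρ / r - 1) = ρ - r := by field_simp
  linarith

/-- The entropy integrand is at least −ρ_∞, so its absolute value is at most itself plus 2ρ_∞. Since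
the cell has volume L^d, the L¹ norm of a slice is at most B + 2. -/
theorem finiteEntropy_of_le (hL : 0 < L) {r : E d → Ω → ℝ}
    (hr : AEStronglyMeasurable (fun p : E d × Ω => r p.1 p.2) (volume.prod μ))
    (hnn : ∀ᵐ ξ ∂μ, ∀ x, 0 ≤ r x ξ) (hc : ∀ᵐ ξ ∂μ, Continuous fun x => r x ξ)
    {B : Ω → ℝ} (hB : Integrable B μ) (hle : ∀ᵐ ξ ∂μ, relEntropy L (fun x => r x ξ) ≤ B ξ) :
    FiniteEntropy L μ r := by
  have hρ : 0 < 1 / L ^ d := by positivity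
  have hm : AEStronglyMeasurable (fun p : E d × Ω => entropyIntegrand L r p.1 p.2)
      ((volume.restrict (cell d L)).prod μ) := by
    have h := aestronglyMeasurable_restrict_cell (L := L) hr
    exact h.mul (Real.measurable_log.comp_aemeasurable
      (h.aemeasurable.div_const _)).aestronglyMeasurable
  unfold FiniteEntropy
  rw [integrable_prod_iff' hm]
  have hi : ∀ᵐ ξ ∂μ, IntegrableOn (fun x => entropyIntegrand L r x ξ) (cell d L) := by
    filter_upwards [hc] with ξ h
    exact integrableOn_cell (continuous_mul_log_div hL h)
  refine ⟨hi, ?_⟩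
  refine Integrable.mono' (hB.add (integrable_const 2)) hm.norm.prod_swap.integral_prod_right' ?_
  filter_upwards [hi, hle, hnn] with ξ h1 h2 h3
  rw [Real.norm_of_nonneg (integral_nonneg fun _ => norm_nonneg _)]
  have h4 : ∫ x in cell d L, (entropyIntegrand L r x ξ + 2 * (1 / L ^ d)) =
      relEntropy L (fun x => r x ξ) + 2 := by
    rw [integral_add h1 (integrable_const _), setIntegral_cell_const hL]
    have : 0 < L ^ d := by positivity
    congr 1
    field_simp
  have h5 : ∫ x in cell d L, ‖entropyIntegrand L r x ξ‖ ≤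
      ∫ x in cell d L, (entropyIntegrand L r x ξ + 2 * (1 / L ^ d)) := by
    refine setIntegral_mono h1.norm (h1.add (integrable_const _)) fun x => ?_
    have := neg_le_mul_log_div (h3 x) hρ
    rw [Real.norm_eq_abs, abs_le]
    unfold entropyIntegrand
    constructor <;> linarith
  simp only [Pi.add_apply]
  linarith

end Network

/-! ### Averaging the node estimates over the network -/

section NetworkEstimate

variable {Ω : Type*} [MeasurableSpace Ω] {μ : Measure Ω} {W : Ω → Ω → ℝ}

theorem abs_absKernelOp_le {C : ℝ} {f : Ω → ℝ} {ξ : Ω} (hW : Integrable (W ξ) μ)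
    (hf : ∀ᵐ ξ' ∂μ, |f ξ'| ≤ C) : |absKernelOp μ W f ξ| ≤ C * ∫ ξ', |W ξ ξ'| ∂μ := by
  rw [← integral_const_mul]
  refine norm_integral_le_of_norm_le (f := fun ξ' => |W ξ ξ'| * f ξ') (hW.abs.const_mul C) ?_
  filter_upwards [hf] with ξ' h
  rw [Real.norm_eq_abs, abs_mul, abs_abs, mul_comm]
  gcongr

theorem continuousOn_absKernelOp {n : ℝ → Ω → ℝ} {C : ℝ}
    (hmeas : ∀ s, 0 ≤ s → AEStronglyMeasurable (n s) μ)
    (hcont : ∀ᵐ ξ ∂μ, ContinuousOn (fun s => n s ξ) (Ici 0))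
    (hC : ∀ᵐ ξ ∂μ, ∀ s, 0 ≤ s → |n s ξ| ≤ C) {ξ : Ω} (hW : Integrable (W ξ) μ) :
    ContinuousOn (fun s => absKernelOp μ W (n s) ξ) (Ici 0) := by
  refine continuousOn_of_dominated (bound := fun ξ' => C * |W ξ ξ'|)
    (fun s hs => hW.abs.aestronglyMeasurable.mul (hmeas s hs)) (fun s hs => ?_)
    (hW.abs.const_mul C) ?_
  · filter_upwards [hC] with ξ' h
    rw [Real.norm_eq_abs, abs_mul, abs_abs, mul_comm]
    gcongr
    exact h s hs
  · filter_upwards [hcont] with ξ' h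
    exact continuousOn_const.mul h

/-- Entropies `h` on the nodes whose growth is controlled by the coupling of the distances `n`
through `W` decay exponentially on average. -/
theorem integral_le_exp_mul_of_coupling [IsProbabilityMeasure μ]
    (hW : Integrable (Function.uncurry W) (μ.prod μ)) {n h : ℝ → Ω → ℝ} {H0 : Ω → ℝ}
    {A c C γ : ℝ} (hA : 0 ≤ A) (hc : 0 ≤ c)
    (hn : ∀ s, 0 ≤ s → AEStronglyMeasurable (n s) μ)
    (hcont : ∀ᵐ ξ ∂μ, ContinuousOn (fun s => n s ξ) (Ici 0))
    (hC : ∀ᵐ ξ ∂μ, ∀ s, 0 ≤ s → |n s ξ| ≤ C)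
    (hquad : ∀ s, 0 ≤ s → ∫ ξ, n s ξ * absKernelOp μ W (n s) ξ ∂μ ≤ c * ∫ ξ, n s ξ ^ 2 ∂μ)
    (hh : ∀ s, 0 ≤ s → AEStronglyMeasurable (h s) μ) (hH0 : Integrable H0 μ)
    (hnh : ∀ᵐ ξ ∂μ, ∀ s, 0 ≤ s → n s ξ ^ 2 ≤ 2 * h s ξ)
    (hle : ∀ᵐ ξ ∂μ, ∀ s, 0 ≤ s → h s ξ ≤ Real.exp (-γ * s) * (H0 ξ +
      ∫ r in 0..s, Real.exp (γ * r) * (A * n r ξ * absKernelOp μ W (n r) ξ)))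
    {t : ℝ} (ht : 0 ≤ t) :
    Integrable (h t) μ ∧ ∫ ξ, h t ξ ∂μ ≤ Real.exp (-(γ - 2 * A * c) * t) * ∫ ξ, H0 ξ ∂μ := by
  set G : ℝ → Ω → ℝ := fun r ξ => Real.exp (γ * r) * (A * n r ξ * absKernelOp μ W (n r) ξ)
    with hG
  have hC0 : 0 ≤ C := by
    obtain ⟨ξ, hξ⟩ := hC.exists
    exact (abs_nonneg _).trans (hξ 0 le_rfl)
  have hWξ : ∀ᵐ ξ ∂μ, Integrable (W ξ) μ := hW.prod_right_ae
  have hdeg : Integrable (fun ξ => ∫ ξ', |W ξ ξ'| ∂μ) μ := hW.abs.integral_prod_left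
  have hm : ∀ s, 0 ≤ s → AEStronglyMeasurable (absKernelOp μ W (n s)) μ := fun s hs =>
    aestronglyMeasurable_absKernelOp hW.aestronglyMeasurable (hn s hs)
  have hCs : ∀ s, 0 ≤ s → ∀ᵐ ξ ∂μ, |n s ξ| ≤ C := fun s hs => hC.mono fun ξ h => h s hs
  -- Needed for Fubini in time and node. The majorant is a constant times the degree ∫ |W ξ ξ'|
  -- dμ(ξ'), integrable in ξ.
  have hGint : ∀ s, Integrable (fun p : ℝ × Ω => G p.1 p.2)
      ((volume.restrict (Ioc 0 s)).prod μ) := fun s => by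
    have hGm : AEStronglyMeasurable (fun p : ℝ × Ω => G p.1 p.2)
        ((volume.restrict (Ioc 0 s)).prod μ) := by
      refine aestronglyMeasurable_of_continuousOn (f := G)
        (fun r hr => (((hn r hr).const_mul A).mul (hm r hr)).const_mul _) ?_ s
      filter_upwards [hcont, hWξ] with ξ h1 h2
      exact (by fun_prop : Continuous fun r => Real.exp (γ * r)).continuousOn.mul
        ((continuousOn_const.mul h1).mul (continuousOn_absKernelOp hn hcont hC h2))
    have hb : Integrable (fun p : ℝ × Ω =>
        Real.exp (|γ| * s) * (A * C * (C * ∫ ξ', |W p.2 ξ'| ∂μ)))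
        ((volume.restrict (Ioc 0 s)).prod μ) :=
      (((hdeg.const_mul C).const_mul (A * C)).const_mul _).comp_snd _
    refine hb.mono' hGm ?_
    have h1 : ∀ᵐ p ∂(volume.restrict (Ioc 0 s)).prod μ, p.1 ∈ Ioc (0 : ℝ) s :=
      Measure.quasiMeasurePreserving_fst.ae (ae_restrict_mem measurableSet_Ioc)
    filter_upwards [h1, Measure.quasiMeasurePreserving_snd.ae hC,
      Measure.quasiMeasurePreserving_snd.ae hWξ] with p hp1 hp2 hp3
    rw [hG, Real.norm_eq_abs, abs_mul, abs_mul, abs_mul, abs_of_nonneg hA, Real.abs_exp]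
    have h4 := abs_absKernelOp_le hp3 (hCs p.1 hp1.1.le)
    have h5 : γ * p.1 ≤ |γ| * s := mul_le_mul (le_abs_self _) hp1.2 hp1.1.le (abs_nonneg _)
    gcongr
    exact hp2 p.1 hp1.1.le
  have hGi : ∀ s, 0 ≤ s → Integrable (fun ξ => ∫ r in 0..s, G r ξ) μ := fun s hs => by
    simp only [intervalIntegral.integral_of_le hs]
    exact (hGint s).integral_prod_right
  -- Grönwall is run on ∫ n² rather than on ∫ h: n is bounded, so Q is continuous by dominated
  -- convergence, whereas no time continuity of ∫ h is available.
  let Q : ℝ → ℝ := fun s => Real.exp (γ * s) * ∫ ξ, n (max s 0) ξ ^ 2 ∂μ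
  have hQ : Continuous Q := by
    refine (by fun_prop : Continuous fun r => Real.exp (γ * r)).mul ?_
    refine continuous_of_dominated (bound := fun _ => C ^ 2)
      (fun s => (hn _ (le_max_right _ _)).pow 2) (fun s => ?_) (integrable_const _) ?_
    · filter_upwards [hCs _ (le_max_right s 0)] with ξ h
      rw [Real.norm_eq_abs, abs_pow]
      gcongr
    · filter_upwards [hcont] with ξ h
      exact (h.comp_continuous (by fun_prop) fun s => mem_Ici.2 (le_max_right _ _)).pow 2
  have hGQ : ∀ s, 0 ≤ s → ∫ ξ, (∫ r in 0..s, G r ξ) ∂μ ≤ A * c * ∫ r in 0..s, Q r :=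
    fun s hs => by
    rw [← intervalIntegral.integral_const_mul]
    simp only [intervalIntegral.integral_of_le hs]
    rw [← integral_integral_swap (hGint s)]
    refine setIntegral_mono_on (hGint s).integral_prod_left
      ((continuous_const.mul hQ).integrableOn_Ioc) measurableSet_Ioc fun r hr => ?_
    have h1 := mul_le_mul_of_nonneg_left (hquad r hr.1.le)
      (by positivity : 0 ≤ Real.exp (γ * r) * A)
    have h2 : ∫ ξ, G r ξ ∂μ =
        Real.exp (γ * r) * A * ∫ ξ, n r ξ * absKernelOp μ W (n r) ξ ∂μ := by
      rw [← integral_const_mul]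
      refine integral_congr_ae (ae_of_all _ fun ξ => ?_)
      simp only [hG]
      ring
    rw [h2]
    refine h1.trans_eq ?_
    simp only [Q, max_eq_left hr.1.le]
    ring
  have hint : ∀ s, 0 ≤ s → Integrable (h s) μ := fun s hs => by
    refine ((hH0.add (hGi s hs)).const_mul (Real.exp (-γ * s))).mono' (hh s hs) ?_
    filter_upwards [hnh, hle] with ξ h1 h2
    rw [Real.norm_of_nonneg (by nlinarith [h1 s hs, sq_nonneg (n s ξ)])]
    exact h2 s hs
  have hmain : ∀ s, 0 ≤ s → ∫ ξ, h s ξ ∂μ ≤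
      Real.exp (-γ * s) * (∫ ξ, H0 ξ ∂μ + A * c * ∫ r in 0..s, Q r) := fun s hs => by
    have h1 := integral_mono_ae (hint s hs)
      ((hH0.add (hGi s hs)).const_mul (Real.exp (-γ * s))) (hle.mono fun ξ h => h s hs)
    rw [integral_const_mul, integral_add' hH0 (hGi s hs)] at h1
    refine h1.trans ?_
    gcongr
    exact hGQ s hs
  -- Inserting n² ≤ 2h into `hmain` gives Q ≤ 2∫ H0 + 2Ac ∫ Q; the weight exp(γs) cancels the decay
  -- factor.
  have hgron := integral_le_of_le_add_integral hQ (K := 2 * ∫ ξ, H0 ξ ∂μ) (β := 2 * A * c)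
    (by positivity) (fun s hs => by
      have h1 : ∫ ξ, n s ξ ^ 2 ∂μ ≤ 2 * ∫ ξ, h s ξ ∂μ := by
        rw [← integral_const_mul]
        exact integral_mono_of_nonneg (ae_of_all _ fun ξ => sq_nonneg _)
          ((hint s hs).const_mul 2) (hnh.mono fun ξ h => h s hs)
      have h2 := mul_le_mul_of_nonneg_left (h1.trans (mul_le_mul_of_nonneg_left (hmain s hs)
        two_pos.le)) (Real.exp_pos (γ * s)).le
      have h3 : Real.exp (γ * s) * Real.exp (-γ * s) = 1 := by
        rw [← Real.exp_add]
        simp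
      simp only [Q, max_eq_left hs]
      refine h2.trans_eq ?_
      linear_combination (2 * (∫ ξ, H0 ξ ∂μ + A * c * ∫ r in 0..s, Q r)) * h3) ht
  refine ⟨hint t ht, (hmain t ht).trans ?_⟩
  have h1 : Real.exp (-(γ - 2 * A * c) * t) = Real.exp (-γ * t) * Real.exp (2 * A * c * t) := by
    rw [← Real.exp_add]
    ring_nf
  rw [h1, mul_assoc (Real.exp (-γ * t))]
  exact mul_le_mul_of_nonneg_left (by linarith) (Real.exp_pos _).le

end NetworkEstimate

/-- Entropy decay holds with every constant that bounds the quadratic form of `|W|`. -/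
theorem entropyDecay_of_quadratic_bound {d : ℕ} {L : ℝ} (hL : 0 < L) (D : Potential d L) {κ : ℝ}
    (hκ : 0 < κ) {Ω : Type*} [MeasurableSpace Ω] {μ : Measure Ω} [IsProbabilityMeasure μ]
    {W : Ω → Ω → ℝ} (hW : MemLp (Function.uncurry W) 2 (μ.prod μ)) {c : ℝ} (hc : 0 ≤ c)
    (hquad : ∀ f : Ω → ℝ, AEStronglyMeasurable f μ → (∀ ξ, 0 ≤ f ξ) → (∀ᵐ ξ ∂μ, f ξ ≤ 2) →
      ∫ ξ, f ξ * absKernelOp μ W f ξ ∂μ ≤ c * ∫ ξ, f ξ ^ 2 ∂μ) :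
    EntropyDecay D κ μ W c := by
  intro hsmall
  refine ⟨?_, fun ρ₀ ρ _ hfin hsol t ht => ?_⟩
  · unfold decayRate
    have h1 : 2 * κ * D.lapNorm * c = 2 * (κ * (L ^ 2 * D.lapNorm * c)) / L ^ 2 := by
      field_simp
    rw [h1, ← sub_div]
    refine div_pos ?_ (by positivity)
    linarith
  have hWi : Integrable (Function.uncurry W) (μ.prod μ) := hW.integrable one_le_two
  have hcont : ∀ᵐ ξ ∂μ, ∀ s, 0 ≤ s → Continuous fun x => ρ s x ξ := by
    filter_upwards [hsol.regular] with ξ h s hs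
    exact h.continuous hs
  have hnn : ∀ᵐ ξ ∂μ, ∀ s, 0 ≤ s → ∀ x, 0 ≤ ρ s x ξ := by
    filter_upwards [hcont, hsol.isProbDensity] with ξ h1 h2 s hs
    exact (h2 s hs).nonneg_of_continuous (h1 s hs)
  have hn : ∀ s, 0 ≤ s → AEStronglyMeasurable (l1Dist L (ρ s)) μ := fun s hs =>
    aestronglyMeasurable_l1Dist (hsol.aestronglyMeasurable s hs)
  have hncont : ∀ᵐ ξ ∂μ, ContinuousOn (fun s => l1Dist L (ρ s) ξ) (Ici 0) := by
    filter_upwards [hsol.regular] with ξ h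
    exact h.continuousOn_abs _
  have hn2 : ∀ᵐ ξ ∂μ, ∀ s, 0 ≤ s → |l1Dist L (ρ s) ξ| ≤ 2 := by
    filter_upwards [hsol.isProbDensity] with ξ h s hs
    rw [abs_of_nonneg (l1Dist_nonneg _ _)]
    exact l1Dist_le_two hL (h s hs)
  have hH0 : Integrable (fun ξ => relEntropy L fun x => ρ₀ x ξ) μ := hfin.integral_prod_right
  have hinit : ∀ᵐ ξ ∂μ, (relEntropy L fun x => ρ 0 x ξ) = relEntropy L fun x => ρ₀ x ξ := by
    filter_upwards [hsol.initial] with ξ h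
    refine integral_congr_ae ?_
    filter_upwards [ae_restrict_of_ae h] with x hx
    simp only [hx]
  have hh : ∀ s, 0 ≤ s → AEStronglyMeasurable (fun ξ => relEntropy L fun x => ρ s x ξ) μ :=
    fun s hs => by
    have h1 := aestronglyMeasurable_restrict_cell (L := L) (hsol.aestronglyMeasurable s hs)
    have h2 : AEStronglyMeasurable (fun p : E d × Ω => ρ s p.1 p.2 *
        Real.log (ρ s p.1 p.2 / (1 / L ^ d))) ((volume.restrict (cell d L)).prod μ) :=
      h1.mul (Real.measurable_log.comp_aemeasurable
        (h1.aemeasurable.div_const _)).aestronglyMeasurable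
    exact h2.prod_swap.integral_prod_right'
  -- At each node the aggregated density is compared with its degree times ρ_∞, and |W| applied to
  -- the L¹ distances bounds its oscillation.
  obtain ⟨hint, hdecay⟩ := integral_le_exp_mul_of_coupling (μ := μ) (W := W)
    (n := fun s => l1Dist L (ρ s)) (h := fun s ξ => relEntropy L fun x => ρ s x ξ)
    (A := κ * D.lapNorm) (c := c) (γ := 4 * Real.pi ^ 2 / L ^ 2) hWi
    (mul_nonneg hκ.le ENNReal.toReal_nonneg) hc hn hncont hn2
    (fun s hs => hquad _ (hn s hs) (l1Dist_nonneg _)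
      (hn2.mono fun ξ h => (le_abs_self _).trans (h s hs))) hh hH0
    (by
      filter_upwards [hcont, hnn, hsol.isProbDensity] with ξ h1 h2 h3 s hs
      exact sq_integral_abs_sub_le hL (h1 s hs) (h2 s hs) (h3 s hs).integral_eq_one)
    (by
      filter_upwards [hnn, hsol.isProbDensity, hsol.regular, hsol.differentiable_flux,
        hsol.equation, hinit, hWi.prod_right_ae] with ξ h0 h1 h2 h3 h4 h5 h6 s hs
      have hprob : ∀ r, 0 ≤ r → ∀ᵐ ξ' ∂μ, IsProbDensity L fun x => ρ r x ξ' := fun r hr =>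
        hsol.isProbDensity.mono fun ξ' h => h r hr
      have hk := fun r (hr : 0 < r) => integrableOn_kernelOp h6
        (hsol.aestronglyMeasurable r hr.le) (hprob r hr.le)
      rw [← h5]
      exact relEntropy_le_of_equation hL D hκ (a := fun r y => kernelOp μ W (ρ r y) ξ) h2 h0
        (fun r hr => (h1 r hr).integral_eq_one) (fun r hr => (hk r hr).1) h3 h4
        (continuousOn_absKernelOp hn hncont hn2 h6) (fun r hr => (hk r hr).2) hs) ht
  refine ⟨finiteEntropy_of_le hL (hsol.aestronglyMeasurable t ht) (hnn.mono fun ξ h => h t ht)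
    (hcont.mono fun ξ h => h t ht) hint (ae_of_all _ fun ξ => le_rfl), ?_⟩
  refine hdecay.trans_eq ?_
  unfold decayRate
  rw [← mul_assoc 2 κ]
  rfl

/-! ### Kernels are determined by their integrals over rectangles -/

section Rectangles

variable {Ω : Type*} [MeasurableSpace Ω]

/-- The sets in `Ω × Ω` that are unions of products of members of a finite measurable partition. -/
def gridSets (Ω : Type*) [MeasurableSpace Ω] : Set (Set (Ω × Ω)) :=
  {S | ∃ (π : SimpleFunc Ω ℕ) (R : Set (ℕ × ℕ)), S = {p | (π p.1, π p.2) ∈ R}}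

theorem isSetAlgebra_gridSets : IsSetAlgebra (gridSets Ω) where
  empty_mem := ⟨0, ∅, by simp⟩
  compl_mem := by
    rintro _ ⟨π, R, rfl⟩
    exact ⟨π, Rᶜ, rfl⟩
  union_mem := by
    rintro _ _ ⟨π, R, rfl⟩ ⟨π', R', rfl⟩
    -- The common refinement of the two partitions, coded in ℕ by `Nat.pair`.
    refine ⟨(π.pair π').map fun q => Nat.pair q.1 q.2, {q |
      (q.1.unpair.1, q.2.unpair.1) ∈ R ∨ (q.1.unpair.2, q.2.unpair.2) ∈ R'}, ?_⟩
    ext p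
    simp

theorem prod_mem_gridSets {A B : Set Ω} (hA : MeasurableSet A) (hB : MeasurableSet B) :
    A ×ˢ B ∈ gridSets Ω := by
  classical
  refine ⟨((SimpleFunc.piecewise A hA 1 0).pair (SimpleFunc.piecewise B hB 1 0)).map
    fun q => Nat.pair q.1 q.2, {q | q.1.unpair.1 = 1 ∧ q.2.unpair.2 = 1}, ?_⟩
  ext p
  by_cases h1 : p.1 ∈ A <;> by_cases h2 : p.2 ∈ B <;> simp [h1, h2]

theorem measurableSet_of_mem_gridSets {S : Set (Ω × Ω)} (hS : S ∈ gridSets Ω) :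
    MeasurableSet S := by
  obtain ⟨π, R, rfl⟩ := hS
  exact ((π.measurable.comp measurable_fst).prodMk (π.measurable.comp measurable_snd))
    (MeasurableSet.of_discrete (s := R))

theorem generateFrom_gridSets :
    (Prod.instMeasurableSpace : MeasurableSpace (Ω × Ω)) =
      MeasurableSpace.generateFrom (gridSets Ω) := by
  refine le_antisymm ?_ (MeasurableSpace.generateFrom_le fun S => measurableSet_of_mem_gridSets)
  rw [← generateFrom_prod]
  refine MeasurableSpace.generateFrom_mono ?_
  rintro _ ⟨A, hA, B, hB, rfl⟩
  exact prod_mem_gridSets hA hB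

variable {μ : Measure Ω} {F : Ω × Ω → ℝ}

/-- A grid set is a finite disjoint union of rectangles, one for each pair of values of the simple
function. -/
theorem setIntegral_gridSets_nonneg (hF : Integrable F (μ.prod μ))
    (h : ∀ A B, MeasurableSet A → MeasurableSet B → 0 ≤ ∫ p in A ×ˢ B, F p ∂μ.prod μ)
    {S : Set (Ω × Ω)} (hS : S ∈ gridSets Ω) : 0 ≤ ∫ p in S, F p ∂μ.prod μ := by
  classical
  obtain ⟨π, R, rfl⟩ := hS
  have h1 : {p : Ω × Ω | (π p.1, π p.2) ∈ R} =
      ⋃ q ∈ (π.range ×ˢ π.range).filter (· ∈ R), (π ⁻¹' {q.1}) ×ˢ (π ⁻¹' {q.2}) := by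
    ext p
    simp only [mem_ofPred_eq, mem_iUnion, Finset.mem_filter, Finset.mem_product,
      SimpleFunc.mem_range, mem_prod, mem_preimage, mem_singleton_iff]
    constructor
    · intro hp
      exact ⟨(π p.1, π p.2), ⟨⟨mem_range_self _, mem_range_self _⟩, hp⟩, rfl, rfl⟩
    · rintro ⟨q, ⟨_, hq⟩, e1, e2⟩
      rwa [e1, e2]
  rw [h1, integral_biUnion_finset _
    (fun q _ => (π.measurableSet_preimage _).prod (π.measurableSet_preimage _)) ?_
    fun q _ => hF.integrableOn]
  · exact Finset.sum_nonneg fun q _ =>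
      h _ _ (π.measurableSet_preimage _) (π.measurableSet_preimage _)
  · intro q _ q' _ hne
    refine Set.disjoint_left.2 fun p hp hp' => hne ?_
    simp only [mem_prod, mem_preimage, mem_singleton_iff] at hp hp'
    exact Prod.ext (hp.1.symm.trans hp'.1) (hp.2.symm.trans hp'.2)

/-- An integrable kernel with nonnegative integrals over rectangles is nonnegative. -/
theorem ae_nonneg_of_forall_setIntegral_prod_nonneg (hF : Integrable F (μ.prod μ))
    (h : ∀ A B, MeasurableSet A → MeasurableSet B → 0 ≤ ∫ p in A ×ˢ B, F p ∂μ.prod μ) :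
    0 ≤ᵐ[μ.prod μ] F := by
  refine ae_nonneg_of_forall_setIntegral_nonneg hF fun S hS _ => ?_
  -- Grid sets are dense for the finite measure |F| d(μ ⊗ μ), so each measurable S is close to a
  -- grid set T with nearly the same integral of F.
  let ν := (μ.prod μ).withDensity fun p => ‖F p‖ₑ
  have hν : IsFiniteMeasure ν := isFiniteMeasure_withDensity hF.2.ne
  have hdense := Measure.MeasureDense.of_generateFrom_isSetAlgebra_finite ν
    isSetAlgebra_gridSets generateFrom_gridSets
  refine le_of_forall_pos_le_add fun ε hε => ?_
  obtain ⟨T, hT, hST⟩ := hdense.approx S hS (measure_ne_top _ _) ε hε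
  have hTm := measurableSet_of_mem_gridSets hT
  have h1 := setIntegral_gridSets_nonneg hF h hT
  have hsymm : MeasurableSet (symmDiff S T) := hS.symmDiff hTm
  have h2 : ∫ p in symmDiff S T, |F p| ∂μ.prod μ ≤ ε := by
    have h3 : ν (symmDiff S T) = ∫⁻ p in symmDiff S T, ‖F p‖ₑ ∂μ.prod μ :=
      withDensity_apply _ hsymm
    have h4 := integral_norm_eq_lintegral_enorm
      (hF.aestronglyMeasurable.restrict (s := symmDiff S T))
    simp only [Real.norm_eq_abs] at h4
    rw [h4, ← h3]
    exact ENNReal.toReal_le_of_le_ofReal hε.le hST.le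
  have h5 : |∫ p in T, F p ∂μ.prod μ - ∫ p in S, F p ∂μ.prod μ| ≤
      ∫ p in symmDiff S T, |F p| ∂μ.prod μ := by
    rw [← integral_indicator hS, ← integral_indicator hTm, ← integral_indicator hsymm,
      ← integral_sub (hF.indicator hTm) (hF.indicator hS)]
    refine abs_integral_le_of_abs_le (hF.abs.indicator hsymm) fun p => ?_
    by_cases hp : p ∈ S <;> by_cases hp' : p ∈ T <;> simp [hp, hp', mem_symmDiff]
  have := (abs_le.1 (h5.trans h2)).2
  linarith

theorem ae_eq_zero_of_forall_setIntegral_prod_eq_zero (hF : Integrable F (μ.prod μ))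
    (h : ∀ A B, MeasurableSet A → MeasurableSet B → ∫ p in A ×ˢ B, F p ∂μ.prod μ = 0) :
    F =ᵐ[μ.prod μ] 0 := by
  have h' : ∀ A B, MeasurableSet A → MeasurableSet B →
      0 ≤ ∫ p in A ×ˢ B, -F p ∂μ.prod μ := fun A B hA hB => by
    rw [integral_neg, h A B hA hB, neg_zero]
  have h1 := ae_nonneg_of_forall_setIntegral_prod_nonneg hF fun A B hA hB => (h A B hA hB).ge
  have h2 := ae_nonneg_of_forall_setIntegral_prod_nonneg (F := fun p => -F p) hF.neg h'
  filter_upwards [h1, h2] with p hp hp'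
  simp only [Pi.zero_apply] at *
  linarith

end Rectangles

/-! ### Kernels of graphops -/

section Graphop

variable {Ω : Type*} [MeasurableSpace Ω] {μ : Measure Ω} [IsProbabilityMeasure μ]
  {A : Lp ℝ ∞ μ →L[ℝ] Lp ℝ 1 μ} {W : Ω → Ω → ℝ}

/-- Positivity and self-adjointness of the operator reach the kernel only through this pairing of
indicators. -/
theorem setIntegral_prod_eq_integral_graphop (hA : HasGraphon A W)
    (hW : Integrable (Function.uncurry W) (μ.prod μ)) {S T : Set Ω} (hS : MeasurableSet S)
    (hT : MeasurableSet T) :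
    ∫ p in S ×ˢ T, Function.uncurry W p ∂μ.prod μ =
      ∫ ξ, indicatorConstLp ∞ hS (measure_ne_top μ S) (1 : ℝ) ξ *
        A (indicatorConstLp ∞ hT (measure_ne_top μ T) (1 : ℝ)) ξ ∂μ := by
  rw [setIntegral_prod _ hW.integrableOn, ← integral_indicator hS]
  refine integral_congr_ae ?_
  filter_upwards [hA (indicatorConstLp ∞ hT (measure_ne_top μ T) (1 : ℝ)),
    indicatorConstLp_coeFn (p := ∞) (hs := hS) (hμs := measure_ne_top μ S) (c := (1 : ℝ))]
    with ξ h1 h2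
  rw [h1, h2]
  have h3 : kernelOp μ W (indicatorConstLp ∞ hT (measure_ne_top μ T) (1 : ℝ)) ξ =
      ∫ ξ' in T, W ξ ξ' ∂μ := by
    rw [← integral_indicator hT]
    refine integral_congr_ae ?_
    filter_upwards [indicatorConstLp_coeFn (p := ∞) (hs := hT) (hμs := measure_ne_top μ T)
      (c := (1 : ℝ))] with ξ' h
    rw [h]
    by_cases hξ : ξ' ∈ T <;> simp [hξ]
  rw [h3]
  by_cases hξ : ξ ∈ S <;> simp [hξ]

/-- The kernel of a graphop is nonnegative. -/
theorem IsGraphop.kernel_nonneg (hop : IsGraphop A) (hA : HasGraphon A W)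
    (hW : Integrable (Function.uncurry W) (μ.prod μ)) : ∀ᵐ p ∂μ.prod μ, 0 ≤ W p.1 p.2 := by
  refine ae_nonneg_of_forall_setIntegral_prod_nonneg (F := Function.uncurry W) hW
    fun S T hS hT => ?_
  rw [setIntegral_prod_eq_integral_graphop hA hW hS hT]
  have hnn : ∀ {T : Set Ω} (hT : MeasurableSet T),
      0 ≤ indicatorConstLp ∞ hT (measure_ne_top μ T) (1 : ℝ) := fun {T} hT => by
    rw [← Lp.coeFn_nonneg]
    filter_upwards [indicatorConstLp_coeFn (p := ∞) (hs := hT) (hμs := measure_ne_top μ T)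
      (c := (1 : ℝ))] with ξ' h
    rw [h]
    exact indicator_nonneg (fun _ _ => zero_le_one) _
  refine integral_nonneg_of_ae ?_
  filter_upwards [(Lp.coeFn_nonneg _).2 (hnn hS),
    (Lp.coeFn_nonneg _).2 (hop.posPreserving _ (hnn hT))] with ξ h1 h2
  exact mul_nonneg h1 h2

/-- The kernel of a graphop is symmetric. -/
theorem IsGraphop.kernel_symm (hop : IsGraphop A) (hA : HasGraphon A W)
    (hW : Integrable (Function.uncurry W) (μ.prod μ)) :
    ∀ᵐ p ∂μ.prod μ, W p.1 p.2 = W p.2 p.1 := by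
  have hW' : Integrable (fun p : Ω × Ω => Function.uncurry W p.swap) (μ.prod μ) := hW.swap
  have h := ae_eq_zero_of_forall_setIntegral_prod_eq_zero (hW.sub hW') fun S T hS hT => by
    have h1 : ∫ p in S ×ˢ T, Function.uncurry W p.swap ∂μ.prod μ =
        ∫ p in T ×ˢ S, Function.uncurry W p ∂μ.prod μ :=
      setIntegral_prod_swap T S (Function.uncurry W)
    simp only [Pi.sub_apply]
    rw [integral_sub hW.integrableOn hW'.integrableOn, h1,
      setIntegral_prod_eq_integral_graphop hA hW hS hT,
      setIntegral_prod_eq_integral_graphop hA hW hT hS, hop.selfAdjoint, sub_self]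
  filter_upwards [h] with p hp
  exact sub_eq_zero.1 hp

end Graphop

/-! ### Hilbert–Schmidt operators -/

section SquareIntegrable

variable {X : Type*} [MeasurableSpace X] {ν : Measure X} {f g : X → ℝ}

theorem norm_sq_toLp (hf : MemLp f 2 ν) : ‖hf.toLp f‖ ^ 2 = ∫ x, f x ^ 2 ∂ν := by
  rw [← real_inner_self_eq_norm_sq, L2.inner_def]
  refine integral_congr_ae ?_
  filter_upwards [hf.coeFn_toLp] with x hx
  rw [hx, real_inner_self_eq_norm_sq, Real.norm_eq_abs, sq_abs]

theorem inner_toLp (hf : MemLp f 2 ν) (hg : MemLp g 2 ν) :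
    inner ℝ (hf.toLp f) (hg.toLp g) = ∫ x, f x * g x ∂ν := by
  rw [L2.inner_def]
  refine integral_congr_ae ?_
  filter_upwards [hf.coeFn_toLp, hg.coeFn_toLp] with x hx hx'
  rw [hx, hx']
  simp [mul_comm]

theorem sq_integral_mul_le (hf : MemLp f 2 ν) (hg : MemLp g 2 ν) :
    (∫ x, f x * g x ∂ν) ^ 2 ≤ (∫ x, f x ^ 2 ∂ν) * ∫ x, g x ^ 2 ∂ν := by
  rw [← inner_toLp hf hg, ← norm_sq_toLp hf, ← norm_sq_toLp hg, ← mul_pow, ← sq_abs]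
  exact pow_le_pow_left₀ (abs_nonneg _) (abs_real_inner_le_norm _ _) 2

end SquareIntegrable

/-! ### Integral operators with square integrable kernels -/

section Kernel

variable {Ω : Type*} [MeasurableSpace Ω] {μ : Measure Ω} {W W' : Ω → Ω → ℝ} {f f' : Ω → ℝ}

theorem graphonNorm_nonneg {p : ℝ≥0∞} : 0 ≤ graphonNorm μ W p := ENNReal.toReal_nonneg

theorem graphonNorm_eq_norm_toLp (hW : MemLp (Function.uncurry W) 2 (μ.prod μ)) :
    graphonNorm μ W 2 = ‖hW.toLp _‖ := (Lp.norm_toLp _ hW).symm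

variable [IsProbabilityMeasure μ]

theorem kernelOp_congr (hW : Function.uncurry W =ᵐ[μ.prod μ] Function.uncurry W')
    (hf : f =ᵐ[μ] f') : kernelOp μ W f =ᵐ[μ] kernelOp μ W' f' := by
  filter_upwards [Measure.ae_ae_of_ae_prod hW] with ξ h
  refine integral_congr_ae ?_
  filter_upwards [h, hf] with ξ' h1 h2
  have h1 : W ξ ξ' = W' ξ ξ' := h1
  simp only [h1, h2]

theorem ae_memLp_kernel (hW : MemLp (Function.uncurry W) 2 (μ.prod μ)) :
    ∀ᵐ ξ ∂μ, MemLp (W ξ) 2 μ := by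
  filter_upwards [hW.integrable_sq.prod_right_ae, hW.aestronglyMeasurable.prodMk_left] with ξ h h'
  exact (memLp_two_iff_integrable_sq h').2 h

theorem sq_kernelOp_le (hW : MemLp (Function.uncurry W) 2 (μ.prod μ)) (hf : MemLp f 2 μ) :
    ∀ᵐ ξ ∂μ, kernelOp μ W f ξ ^ 2 ≤ (∫ ξ', W ξ ξ' ^ 2 ∂μ) * ∫ ξ', f ξ' ^ 2 ∂μ := by
  filter_upwards [ae_memLp_kernel hW] with ξ h
  exact sq_integral_mul_le h hf

theorem memLp_kernelOp (hW : MemLp (Function.uncurry W) 2 (μ.prod μ)) (hf : MemLp f 2 μ) :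
    MemLp (kernelOp μ W f) 2 μ := by
  have hm : AEStronglyMeasurable (kernelOp μ W f) μ :=
    (AEStronglyMeasurable.mul (f := Function.uncurry W) (g := fun p : Ω × Ω => f p.2)
      hW.aestronglyMeasurable hf.aestronglyMeasurable.comp_snd).integral_prod_right'
  rw [memLp_two_iff_integrable_sq hm]
  have hint : Integrable (fun ξ => ∫ ξ', W ξ ξ' ^ 2 ∂μ) μ := hW.integrable_sq.integral_prod_left
  refine (hint.mul_const (∫ ξ', f ξ' ^ 2 ∂μ)).mono' (hm.pow 2) ?_
  filter_upwards [sq_kernelOp_le hW hf] with ξ h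
  rwa [Real.norm_of_nonneg (sq_nonneg _)]

theorem norm_toLp_kernelOp_le (hW : MemLp (Function.uncurry W) 2 (μ.prod μ)) (hf : MemLp f 2 μ) :
    ‖(memLp_kernelOp hW hf).toLp _‖ ≤ ‖hW.toLp _‖ * ‖hf.toLp _‖ := by
  refine le_of_sq_le_sq ?_ (by positivity)
  rw [mul_pow, norm_sq_toLp, norm_sq_toLp, norm_sq_toLp, integral_prod _ hW.integrable_sq,
    ← integral_mul_const]
  have hint : Integrable (fun ξ => ∫ ξ', W ξ ξ' ^ 2 ∂μ) μ := hW.integrable_sq.integral_prod_left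
  exact integral_mono_ae (memLp_kernelOp hW hf).integrable_sq (hint.mul_const _)
    (sq_kernelOp_le hW hf)

/-- The integral operator on `L²` with a square integrable kernel. -/
noncomputable def kernelCLM (μ : Measure Ω) [IsProbabilityMeasure μ] :
    Lp ℝ 2 (μ.prod μ) →L[ℝ] Lp ℝ 2 μ →L[ℝ] Lp ℝ 2 μ :=
  -- Bilinearity in kernel and function makes compactness of the operator a closed linear condition
  -- on the kernel.
  LinearMap.mkContinuous₂ (LinearMap.mk₂ ℝ
    (fun K f => (memLp_kernelOp (W := fun ξ ξ' => K (ξ, ξ')) (Lp.memLp K) (Lp.memLp f)).toLp _)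
    (fun K K' f => by
      rw [← MemLp.toLp_add, MemLp.toLp_eq_toLp_iff]
      filter_upwards [Measure.ae_ae_of_ae_prod (Lp.coeFn_add K K'),
        ae_memLp_kernel (W := fun ξ ξ' => K (ξ, ξ')) (Lp.memLp K),
        ae_memLp_kernel (W := fun ξ ξ' => K' (ξ, ξ')) (Lp.memLp K')] with ξ h h1 h2
      simp only [kernelOp, Pi.add_apply]
      refine Eq.trans ?_ (integral_add (h1.integrable_mul (Lp.memLp f))
        (h2.integrable_mul (Lp.memLp f)))
      refine integral_congr_ae ?_
      filter_upwards [h] with ξ' h3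
      simp only [h3, Pi.add_apply, add_mul])
    (fun c K f => by
      rw [← MemLp.toLp_const_smul, MemLp.toLp_eq_toLp_iff]
      filter_upwards [Measure.ae_ae_of_ae_prod (Lp.coeFn_smul c K)] with ξ h
      simp only [kernelOp, Pi.smul_apply, smul_eq_mul]
      rw [← integral_const_mul]
      refine integral_congr_ae ?_
      filter_upwards [h] with ξ' h3
      simp only [h3, Pi.smul_apply, smul_eq_mul, mul_assoc])
    (fun K f f' => by
      rw [← MemLp.toLp_add, MemLp.toLp_eq_toLp_iff]
      filter_upwards [ae_memLp_kernel (W := fun ξ ξ' => K (ξ, ξ')) (Lp.memLp K)] with ξ h1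
      simp only [kernelOp, Pi.add_apply]
      refine Eq.trans ?_ (integral_add (h1.integrable_mul (Lp.memLp f))
        (h1.integrable_mul (Lp.memLp f')))
      refine integral_congr_ae ?_
      filter_upwards [Lp.coeFn_add f f'] with ξ' h3
      simp only [h3, Pi.add_apply, mul_add])
    (fun c K f => by
      rw [← MemLp.toLp_const_smul, MemLp.toLp_eq_toLp_iff]
      refine ae_of_all _ fun ξ => ?_
      simp only [kernelOp, Pi.smul_apply, smul_eq_mul]
      rw [← integral_const_mul]
      refine integral_congr_ae ?_
      filter_upwards [Lp.coeFn_smul c f] with ξ' h3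
      simp only [h3, Pi.smul_apply, smul_eq_mul]
      ring)) 1
    (fun K f => by
      have h := norm_toLp_kernelOp_le (W := fun ξ ξ' => K (ξ, ξ')) (Lp.memLp K) (Lp.memLp f)
      rw [one_mul]
      refine h.trans_eq ?_
      congr 2
      · exact Lp.toLp_coeFn K _
      · exact Lp.toLp_coeFn f _)

theorem kernelCLM_toLp_apply (hW : MemLp (Function.uncurry W) 2 (μ.prod μ)) (f : Lp ℝ 2 μ) :
    kernelCLM μ (hW.toLp _) f =ᵐ[μ] kernelOp μ W f := by
  refine (MemLp.coeFn_toLp (memLp_kernelOp (W := fun ξ ξ' => hW.toLp _ (ξ, ξ'))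
    (Lp.memLp _) (Lp.memLp f))).trans ?_
  exact kernelOp_congr hW.coeFn_toLp EventuallyEq.rfl

theorem norm_kernelCLM_le (K : Lp ℝ 2 (μ.prod μ)) : ‖kernelCLM μ K‖ ≤ ‖K‖ := by
  refine ContinuousLinearMap.opNorm_le_bound _ (norm_nonneg _) fun f => ?_
  have h := norm_toLp_kernelOp_le (W := fun ξ ξ' => K (ξ, ξ')) (Lp.memLp K) (Lp.memLp f)
  refine h.trans_eq ?_
  congr 2
  · exact Lp.toLp_coeFn K _
  · exact Lp.toLp_coeFn f _

/-- The operator has rank at most one: it sends f to ⟨1_B, f⟩ 1_A. -/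
theorem isCompactOperator_kernelCLM_indicator {A B : Set Ω} (hA : MeasurableSet A)
    (hB : MeasurableSet B) :
    IsCompactOperator (kernelCLM μ (indicatorConstLp 2 (hA.prod hB) (measure_ne_top _ _) 1)) := by
  set a : Lp ℝ 2 μ := indicatorConstLp 2 hA (measure_ne_top μ A) 1
  set b : Lp ℝ 2 μ := indicatorConstLp 2 hB (measure_ne_top μ B) 1
  have h : kernelCLM μ (indicatorConstLp 2 (hA.prod hB) (measure_ne_top _ _) 1) =
      (ContinuousLinearMap.toSpanSingleton ℝ a).comp (innerSL ℝ b) := by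
    ext1 f
    refine Lp.ext ?_
    refine (MemLp.coeFn_toLp (memLp_kernelOp (W := fun ξ ξ' =>
      indicatorConstLp 2 (hA.prod hB) (measure_ne_top (μ.prod μ) _) (1 : ℝ) (ξ, ξ'))
      (Lp.memLp _) (Lp.memLp f))).trans ?_
    simp only [ContinuousLinearMap.comp_apply, ContinuousLinearMap.toSpanSingleton_apply,
      innerSL_apply_apply]
    rw [L2.inner_indicatorConstLp_one]
    filter_upwards [Lp.coeFn_smul (∫ x in B, f x ∂μ) a,
      Measure.ae_ae_of_ae_prod (indicatorConstLp_coeFn (p := 2) (hs := hA.prod hB)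
        (hμs := measure_ne_top (μ.prod μ) _) (c := (1 : ℝ))),
      indicatorConstLp_coeFn (p := 2) (hs := hA) (hμs := measure_ne_top μ A) (c := (1 : ℝ))]
      with ξ h1 h2 h3
    rw [h1, Pi.smul_apply, h3, ← integral_indicator hB, smul_eq_mul, ← integral_mul_const]
    refine integral_congr_ae ?_
    filter_upwards [h2] with ξ' h4
    simp only [h4]
    by_cases h5 : ξ ∈ A <;> by_cases h6 : ξ' ∈ B <;> simp [h5, h6]
  rw [h]
  exact (isCompactOperator_of_locallyCompactSpace_dom (innerSL ℝ b)).continuous_comp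
    (ContinuousLinearMap.toSpanSingleton ℝ a).continuous

/-- The kernels with compact operator form a closed subspace containing the indicators of
rectangles. A kernel orthogonal to these vanishes, so the subspace is everything. -/
theorem isCompactOperator_kernelCLM (K : Lp ℝ 2 (μ.prod μ)) :
    IsCompactOperator (kernelCLM μ K) := by
  let S : Submodule ℝ (Lp ℝ 2 (μ.prod μ)) :=
    (compactOperator (RingHom.id ℝ) (Lp ℝ 2 μ) (Lp ℝ 2 μ)).comap (kernelCLM μ).toLinearMap
  have hS : IsClosed (S : Set (Lp ℝ 2 (μ.prod μ))) :=
    isClosed_setOfPred_isCompactOperator.preimage (kernelCLM μ).continuous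
  have hbot : Sᗮ = ⊥ := by
    rw [Submodule.eq_bot_iff]
    intro F hF
    rw [Submodule.mem_orthogonal] at hF
    rw [Lp.eq_zero_iff_ae_eq_zero]
    refine ae_eq_zero_of_forall_setIntegral_prod_eq_zero ((Lp.memLp F).integrable one_le_two)
      fun A B hA hB => ?_
    rw [← L2.inner_indicatorConstLp_one (𝕜 := ℝ) (hA.prod hB) (measure_ne_top _ _) F]
    exact hF _ (isCompactOperator_kernelCLM_indicator hA hB)
  have htop := (Submodule.topologicalClosure_eq_top_iff (K := S)).2 hbot
  rw [hS.submodule_topologicalClosure_eq] at htop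
  have : K ∈ S := htop ▸ Submodule.mem_top
  exact this

end Kernel

/-! ### The largest eigenvalue -/

section Spectrum

variable {Ω : Type*} [MeasurableSpace Ω] {μ : Measure Ω} {W : Ω → Ω → ℝ} {f g : Ω → ℝ}

theorem integrable_kernel_mul (hW : MemLp (Function.uncurry W) 2 (μ.prod μ)) (hf : MemLp f 2 μ)
    (hg : MemLp g 2 μ) :
    Integrable (fun p : Ω × Ω => W p.1 p.2 * (f p.1 * g p.2)) (μ.prod μ) := by
  have hm : AEStronglyMeasurable (fun p : Ω × Ω => f p.1 * g p.2) (μ.prod μ) :=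
    hf.aestronglyMeasurable.comp_fst.mul hg.aestronglyMeasurable.comp_snd
  have h : MemLp (fun p : Ω × Ω => f p.1 * g p.2) 2 (μ.prod μ) := by
    rw [memLp_two_iff_integrable_sq hm]
    refine (hf.integrable_sq.mul_prod hg.integrable_sq).congr (ae_of_all _ fun p => ?_)
    simp only [mul_pow]
  exact hW.integrable_mul h

theorem kernelOp_const (p : ℝ) (f : Ω → ℝ) (ξ : Ω) :
    kernelOp μ (fun _ _ => p) f ξ = p * ∫ ξ', f ξ' ∂μ := integral_const_mul _ _

variable [IsProbabilityMeasure μ]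

theorem integral_mul_kernelOp (hW : MemLp (Function.uncurry W) 2 (μ.prod μ)) (hf : MemLp f 2 μ)
    (hg : MemLp g 2 μ) :
    ∫ ξ, f ξ * kernelOp μ W g ξ ∂μ = ∫ p, W p.1 p.2 * (f p.1 * g p.2) ∂μ.prod μ := by
  rw [integral_prod _ (integrable_kernel_mul hW hf hg)]
  refine integral_congr_ae (ae_of_all _ fun ξ => ?_)
  simp only [kernelOp]
  rw [← integral_const_mul]
  refine integral_congr_ae (ae_of_all _ fun ξ' => ?_)
  simp only
  ring

theorem inner_kernelCLM (hW : MemLp (Function.uncurry W) 2 (μ.prod μ)) (f g : Lp ℝ 2 μ) :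
    inner ℝ f (kernelCLM μ (hW.toLp _) g) = ∫ p, W p.1 p.2 * (f p.1 * g p.2) ∂μ.prod μ := by
  rw [← integral_mul_kernelOp hW (Lp.memLp f) (Lp.memLp g), L2.inner_def]
  refine integral_congr_ae ?_
  filter_upwards [kernelCLM_toLp_apply hW g] with ξ h
  rw [h]
  simp [mul_comm]

theorem isSymmetric_kernelCLM (hW : MemLp (Function.uncurry W) 2 (μ.prod μ))
    (hsymm : ∀ᵐ p ∂μ.prod μ, W p.1 p.2 = W p.2 p.1) :
    (kernelCLM μ (hW.toLp _)).IsSymmetric := by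
  intro f g
  simp only [ContinuousLinearMap.coe_coe]
  rw [real_inner_comm, inner_kernelCLM, inner_kernelCLM,
    ← integral_prod_swap (fun p : Ω × Ω => W p.1 p.2 * (g p.1 * f p.2))]
  refine integral_congr_ae ?_
  filter_upwards [hsymm] with p hp
  simp only [Prod.fst_swap, Prod.snd_swap, hp]
  ring

/-- Absolute values are taken inside the double integral. This is the only use of positivity in
showing that the norm is an eigenvalue. -/
theorem abs_inner_kernelCLM_le (hW : MemLp (Function.uncurry W) 2 (μ.prod μ))
    (hpos : ∀ᵐ p ∂μ.prod μ, 0 ≤ W p.1 p.2) (f : Lp ℝ 2 μ) :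
    |inner ℝ f (kernelCLM μ (hW.toLp _) f)| ≤ inner ℝ |f| (kernelCLM μ (hW.toLp _) |f|) := by
  rw [inner_kernelCLM, inner_kernelCLM]
  refine (abs_integral_le_integral_abs).trans (integral_mono_ae
    (integrable_kernel_mul hW (Lp.memLp f) (Lp.memLp f)).abs
    (integrable_kernel_mul hW (Lp.memLp |f|) (Lp.memLp |f|)) ?_)
  filter_upwards [hpos, Measure.quasiMeasurePreserving_fst.ae (Lp.coeFn_abs f),
    Measure.quasiMeasurePreserving_snd.ae (Lp.coeFn_abs f)] with p h1 h2 h3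
  rw [h2, h3, abs_mul, abs_mul, abs_of_nonneg h1]

/-- For a symmetric operator the norm is the supremum of |Rayleigh quotient|, and by positivity
replacing f by |f| makes the quotient nonnegative without decreasing its absolute value. So the norm
cannot lie in the resolvent set, and by compactness it is an eigenvalue. -/
theorem exists_ne_zero_kernelCLM_eq_smul (hW : MemLp (Function.uncurry W) 2 (μ.prod μ))
    (hpos : ∀ᵐ p ∂μ.prod μ, 0 ≤ W p.1 p.2) (hsymm : ∀ᵐ p ∂μ.prod μ, W p.1 p.2 = W p.2 p.1) :
    ∃ f : Lp ℝ 2 μ, f ≠ 0 ∧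
      kernelCLM μ (hW.toLp _) f = ‖kernelCLM μ (hW.toLp _)‖ • f := by
  set T := kernelCLM μ (hW.toLp _) with hT
  have h1 : MemLp (fun _ : Ω => (1 : ℝ)) 2 μ := memLp_const 1
  have hone : h1.toLp _ ≠ 0 := fun h => by
    have := norm_sq_toLp h1
    rw [h] at this
    simp at this
  have hnt : Nontrivial (Lp ℝ 2 μ) := ⟨⟨_, 0, hone⟩⟩
  -- The alternative for compact operators needs a nonzero spectral value; for T = 0 the constant 1
  -- is an eigenvector.
  rcases eq_or_ne ‖T‖ 0 with h0 | h0
  · refine ⟨_, hone, ?_⟩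
    rw [h0, norm_eq_zero.1 h0, zero_smul]
    rfl
  rcases (isCompactOperator_kernelCLM (hW.toLp _)).hasEigenvalue_or_mem_resolventSet h0 with h | h
  · obtain ⟨f, hf⟩ := h.exists_hasEigenvector
    exact ⟨f, hf.2, hf.apply_eq_smul⟩
  · exfalso
    -- If ‖T‖ were in the resolvent set, all Rayleigh quotients would stay below ‖T‖ − ε, and so
    -- would their absolute values by passing to |f|.
    obtain ⟨ε, hε, hR⟩ := T.rayleighQuotient_le_of_norm_mem_resolventSet (𝕜 := ℝ) h
    have hsup : ‖T‖ ≤ ‖T‖ - ε := by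
      conv_lhs => rw [T.norm_eq_iSup_rayleighQuotient (isSymmetric_kernelCLM hW hsymm)]
      refine ciSup_le fun f => ?_
      refine le_trans ?_ (hR |f|)
      simp only [ContinuousLinearMap.rayleighQuotient, ContinuousLinearMap.reApplyInnerSelf_apply,
        norm_abs_eq_norm, abs_div, abs_pow, abs_norm]
      gcongr
      have h := abs_inner_kernelCLM_le hW hpos f
      rw [real_inner_comm, real_inner_comm _ |f|] at h
      exact h
    linarith

theorem isGreatest_eigenvalues (hW : MemLp (Function.uncurry W) 2 (μ.prod μ))
    (hpos : ∀ᵐ p ∂μ.prod μ, 0 ≤ W p.1 p.2) (hsymm : ∀ᵐ p ∂μ.prod μ, W p.1 p.2 = W p.2 p.1) :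
    IsGreatest (eigenvalues μ W) ‖kernelCLM μ (hW.toLp _)‖ := by
  constructor
  · obtain ⟨f, hf, hTf⟩ := exists_ne_zero_kernelCLM_eq_smul hW hpos hsymm
    refine ⟨f, Lp.memLp f, fun h => hf ((Lp.eq_zero_iff_ae_eq_zero).2 h), ?_⟩
    filter_upwards [kernelCLM_toLp_apply hW f,
      Lp.coeFn_smul ‖kernelCLM μ (hW.toLp _)‖ f] with ξ h1 h2
    rw [← h1, hTf, h2]
    rfl
  · rintro lam ⟨f, hf, hne, hlam⟩
    have h1 : kernelCLM μ (hW.toLp _) (hf.toLp f) = lam • hf.toLp f := by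
      refine Lp.ext ?_
      filter_upwards [kernelCLM_toLp_apply hW (hf.toLp f), Lp.coeFn_smul lam (hf.toLp f),
        kernelOp_congr (W := W) (W' := W) EventuallyEq.rfl hf.coeFn_toLp, hlam, hf.coeFn_toLp]
        with ξ h1 h2 h3 h4 h5
      rw [h1, h2, h3, h4, Pi.smul_apply, h5, smul_eq_mul]
    have h2 : 0 < ‖hf.toLp f‖ := by
      rw [norm_pos_iff]
      intro h
      rw [Lp.eq_zero_iff_ae_eq_zero] at h
      exact hne (hf.coeFn_toLp.symm.trans h)
    have h3 := (kernelCLM μ (hW.toLp _)).le_opNorm (hf.toLp f)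
    rw [h1, norm_smul] at h3
    exact (le_abs_self lam).trans (le_of_mul_le_mul_right h3 h2)

/-- As W is nonnegative a.e., |W| acts as W, and Cauchy–Schwarz bounds the quadratic form by the
operator norm. -/
theorem integral_mul_absKernelOp_le (hW : MemLp (Function.uncurry W) 2 (μ.prod μ))
    (hpos : ∀ᵐ p ∂μ.prod μ, 0 ≤ W p.1 p.2) {c : ℝ} (hc : ‖kernelCLM μ (hW.toLp _)‖ ≤ c)
    (hf : MemLp f 2 μ) :
    ∫ ξ, f ξ * absKernelOp μ W f ξ ∂μ ≤ c * ∫ ξ, f ξ ^ 2 ∂μ := by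
  have h1 : ∫ ξ, f ξ * absKernelOp μ W f ξ ∂μ =
      inner ℝ (hf.toLp f) (kernelCLM μ (hW.toLp _) (hf.toLp f)) := by
    rw [L2.inner_def]
    refine integral_congr_ae ?_
    filter_upwards [kernelCLM_toLp_apply hW (hf.toLp f), hf.coeFn_toLp,
      kernelOp_congr (W := W) (W' := W) EventuallyEq.rfl hf.coeFn_toLp,
      Measure.ae_ae_of_ae_prod hpos] with ξ h1 h2 h3 h4
    have h5 : absKernelOp μ W f ξ = kernelOp μ W f ξ := by
      refine integral_congr_ae ?_
      filter_upwards [h4] with ξ' h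
      simp only [abs_of_nonneg h]
    rw [h1, h2, h3, h5]
    simp [mul_comm]
  rw [h1, ← norm_sq_toLp hf, sq, ← mul_assoc]
  refine (real_inner_le_norm _ _).trans ?_
  rw [mul_comm]
  gcongr
  exact (kernelCLM μ (hW.toLp _)).le_of_opNorm_le hc _

end Spectrum

section Decay

variable {d : ℕ} {L : ℝ} {Ω : Type*} [MeasurableSpace Ω] {μ : Measure Ω} [IsProbabilityMeasure μ]
  {W : Ω → Ω → ℝ}

theorem memLp_of_nonneg_of_le {f : Ω → ℝ} {C : ℝ} (hf : AEStronglyMeasurable f μ)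
    (h0 : ∀ ξ, 0 ≤ f ξ) (hC : ∀ᵐ ξ ∂μ, f ξ ≤ C) : MemLp f 2 μ :=
  MemLp.of_bound hf C (hC.mono fun ξ h => by rwa [Real.norm_of_nonneg (h0 ξ)])

/-- Entropy decay for nonnegative square integrable kernels. -/
theorem entropyDecay_of_opNorm_le (hL : 0 < L) (D : Potential d L) {κ : ℝ} (hκ : 0 < κ)
    (hW : MemLp (Function.uncurry W) 2 (μ.prod μ)) (hpos : ∀ᵐ p ∂μ.prod μ, 0 ≤ W p.1 p.2)
    {c : ℝ} (hc : ‖kernelCLM μ (hW.toLp _)‖ ≤ c) : EntropyDecay D κ μ W c :=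
  entropyDecay_of_quadratic_bound hL D hκ hW ((norm_nonneg _).trans hc) fun _ hf h0 h2 =>
    integral_mul_absKernelOp_le hW hpos hc (memLp_of_nonneg_of_le hf h0 h2)

theorem norm_kernelCLM_le_graphonNorm (hW : MemLp (Function.uncurry W) 2 (μ.prod μ)) :
    ‖kernelCLM μ (hW.toLp _)‖ ≤ graphonNorm μ W 2 :=
  (norm_kernelCLM_le _).trans_eq (graphonNorm_eq_norm_toLp hW).symm

/-! ### Erdős–Rényi graphons -/

/-- Integrating the eigenvalue equation shows that an eigenfunction with nonzero mean has eigenvalue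
p; one with mean zero is annihilated, so its eigenvalue is 0. The constant 1 attains p. -/
theorem lambdaMax_const {p : ℝ} (hp : 0 ≤ p) : lambdaMax μ (fun _ _ => p) = p := by
  refine IsGreatest.csSup_eq ⟨⟨fun _ => 1, memLp_const 1, fun h => ?_, ?_⟩, ?_⟩
  · obtain ⟨ξ, hξ⟩ := h.exists
    exact one_ne_zero hξ
  · exact ae_of_all _ fun ξ => by simp [kernelOp_const]
  · rintro lam ⟨f, _, hne, hlam⟩
    have h1 : p * ∫ ξ, f ξ ∂μ = lam * ∫ ξ, f ξ ∂μ := by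
      rw [← integral_const_mul lam, ← integral_congr_ae hlam]
      simp [kernelOp_const]
    rcases eq_or_ne (∫ ξ, f ξ ∂μ) 0 with h0 | h0
    · by_contra hlt
      refine hne ?_
      filter_upwards [hlam] with ξ h
      rw [kernelOp_const, h0, mul_zero] at h
      exact (mul_eq_zero.1 h.symm).resolve_left (by linarith)
    · exact (mul_right_cancel₀ h0 h1).ge

/-- The quadratic form is p (∫ f)², at most p ∫ f² by Cauchy–Schwarz against 1. -/
theorem entropyDecay_const (hL : 0 < L) (D : Potential d L) {κ : ℝ} (hκ : 0 < κ) {p : ℝ}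
    (hp : 0 ≤ p) : EntropyDecay D κ μ (fun _ _ => p) p := by
  refine entropyDecay_of_quadratic_bound hL D hκ (memLp_const p) hp fun f hf h0 h2 => ?_
  have h := sq_integral_mul_le (memLp_of_nonneg_of_le hf h0 h2) (memLp_const (1 : ℝ))
  simp only [mul_one, one_pow, integral_const, probReal_univ, smul_eq_mul] at h
  simp only [absKernelOp, abs_of_nonneg hp, integral_const_mul, integral_mul_const]
  nlinarith

end Decay

/-! ### Power law graphons -/

section PowerLaw

variable {α : ℝ}

theorem integrable_rpow_unitInterval (hα : α < 1 / 2) :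
    Integrable (fun ξ : unitInterval => (ξ : ℝ) ^ (-(2 * α))) ∧
      ∫ ξ : unitInterval, (ξ : ℝ) ^ (-(2 * α)) = 1 / (1 - 2 * α) := by
  have h1 : IntervalIntegrable (fun x : ℝ => x ^ (-(2 * α))) volume 0 1 :=
    intervalIntegral.intervalIntegrable_rpow' (by linarith)
  rw [intervalIntegrable_iff_integrableOn_Icc_of_le zero_le_one] at h1
  constructor
  · exact (integrableOn_iff_comap_subtypeVal measurableSet_Icc).1 h1
  · have h2 := integral_subtype_comap (μ := volume) (measurableSet_Icc (a := (0 : ℝ)) (b := 1))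
      fun x : ℝ => x ^ (-(2 * α))
    refine h2.trans ?_
    rw [integral_Icc_eq_integral_Ioc, ← intervalIntegral.integral_of_le zero_le_one,
      integral_rpow (Or.inl (by linarith)), Real.zero_rpow (by linarith), Real.one_rpow]
    ring

theorem powerLaw_nonneg (ξ ξ' : unitInterval) : 0 ≤ powerLaw α ξ ξ' :=
  mul_nonneg (sq_nonneg _) (Real.rpow_nonneg (mul_nonneg ξ.2.1 ξ'.2.1) _)

/-- The square factorizes, so the L² norm reduces to the one-dimensional integral of ξ^(−2α), finite
for α < 1/2. -/
theorem powerLaw_sq (ξ ξ' : unitInterval) :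
    powerLaw α ξ ξ' ^ 2 =
      (1 - α) ^ 4 * ((ξ : ℝ) ^ (-(2 * α)) * (ξ' : ℝ) ^ (-(2 * α))) := by
  rw [powerLaw, Real.mul_rpow ξ.2.1 ξ'.2.1, show -(2 * α) = -α * (2 : ℕ) by push_cast; ring,
    Real.rpow_mul_natCast ξ.2.1, Real.rpow_mul_natCast ξ'.2.1]
  ring

theorem memLp_powerLaw (hα : α < 1 / 2) :
    MemLp (Function.uncurry (powerLaw α)) 2
      ((volume : Measure unitInterval).prod volume) := by
  have hm : Measurable (Function.uncurry (powerLaw α)) := by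
    unfold powerLaw Function.uncurry
    fun_prop
  rw [memLp_two_iff_integrable_sq hm.aestronglyMeasurable]
  have h := (integrable_rpow_unitInterval hα).1
  refine ((h.mul_prod h).const_mul ((1 - α) ^ 4)).congr (ae_of_all _ fun p => ?_)
  exact (powerLaw_sq p.1 p.2).symm

theorem graphonNorm_powerLaw (hα : α < 1 / 2) :
    graphonNorm volume (powerLaw α) 2 = (1 - α) ^ 2 / (1 - 2 * α) := by
  have hpos : 0 < 1 - 2 * α := by linarith
  rw [← sq_eq_sq₀ graphonNorm_nonneg (by positivity),
    graphonNorm_eq_norm_toLp (memLp_powerLaw hα), norm_sq_toLp]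
  have h1 : ∀ p : unitInterval × unitInterval, Function.uncurry (powerLaw α) p ^ 2 =
      (1 - α) ^ 4 * ((p.1 : ℝ) ^ (-(2 * α)) * (p.2 : ℝ) ^ (-(2 * α))) := fun p =>
    powerLaw_sq p.1 p.2
  simp only [h1]
  rw [integral_const_mul, integral_prod_mul (fun ξ : unitInterval => (ξ : ℝ) ^ (-(2 * α)))
    fun ξ : unitInterval => (ξ : ℝ) ^ (-(2 * α)), (integrable_rpow_unitInterval hα).2]
  field_simp

end PowerLaw

end GraphopMcKeanVlasov

theorem corollary3p4 (d : ℕ) (L : ℝ) (hL : 0 < L)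
    (D : GraphopMcKeanVlasov.Potential d L) (κ : ℝ) (hκ : 0 < κ)
    {Ω : Type*} [MeasurableSpace Ω] (μ : Measure Ω) [IsProbabilityMeasure μ] :
    -- graphons with finite `L²` norm
    (∀ (A : Lp ℝ ∞ μ →L[ℝ] Lp ℝ 1 μ) (W : Ω → Ω → ℝ),
      GraphopMcKeanVlasov.IsGraphop A → GraphopMcKeanVlasov.HasGraphon A W →
      MemLp (Function.uncurry W) 2 (μ.prod μ) →
        IsGreatest (GraphopMcKeanVlasov.eigenvalues μ W) (GraphopMcKeanVlasov.lambdaMax μ W) ∧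
        GraphopMcKeanVlasov.lambdaMax μ W ≤ GraphopMcKeanVlasov.graphonNorm μ W 2 ∧
        GraphopMcKeanVlasov.EntropyDecay D κ μ W (GraphopMcKeanVlasov.lambdaMax μ W) ∧
        GraphopMcKeanVlasov.EntropyDecay D κ μ W (GraphopMcKeanVlasov.graphonNorm μ W 2)) ∧
    -- Erdős–Rényi graphons
    (∀ p : ℝ, 0 < p → p < 1 →
      GraphopMcKeanVlasov.lambdaMax μ (fun _ _ => p) = p ∧
      GraphopMcKeanVlasov.EntropyDecay D κ μ (fun _ _ => p) p) ∧
    -- power law graphons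
    (∀ α : ℝ, 0 < α → α < 1 / 2 →
      MemLp (Function.uncurry (GraphopMcKeanVlasov.powerLaw α)) 2
        ((volume : Measure unitInterval).prod volume) ∧
      GraphopMcKeanVlasov.graphonNorm volume (GraphopMcKeanVlasov.powerLaw α) 2 =
        (1 - α) ^ 2 / (1 - 2 * α) ∧
      GraphopMcKeanVlasov.EntropyDecay D κ volume (GraphopMcKeanVlasov.powerLaw α)
        ((1 - α) ^ 2 / (1 - 2 * α))) := by
  open GraphopMcKeanVlasov in
  refine ⟨fun A W hA hAW hW => ?_, fun p hp _ => ⟨lambdaMax_const hp.le,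
    entropyDecay_const hL D hκ hp.le⟩, fun α _ hα => ⟨memLp_powerLaw hα,
    graphonNorm_powerLaw hα, ?_⟩⟩
  · have hWi := hW.integrable one_le_two
    have hpos := hA.kernel_nonneg hAW hWi
    have h := isGreatest_eigenvalues hW hpos (hA.kernel_symm hAW hWi)
    -- Both constants are now compared with the operator norm: λ_max equals it and ‖W‖₂ dominates
    -- it.
    have hmax : lambdaMax μ W = ‖kernelCLM μ (hW.toLp _)‖ := h.csSup_eq
    have hle := norm_kernelCLM_le_graphonNorm hW
    rw [hmax]
    exact ⟨h, hle, entropyDecay_of_opNorm_le hL D hκ hW hpos le_rfl,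
      entropyDecay_of_opNorm_le hL D hκ hW hpos hle⟩
  · rw [← graphonNorm_powerLaw hα]
    exact entropyDecay_of_opNorm_le hL D hκ (memLp_powerLaw hα)
      (ae_of_all _ fun p => powerLaw_nonneg p.1 p.2) (norm_kernelCLM_le_graphonNorm _)
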